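/- Let $q\in(-1,1)$, let $\nu$ be a compactly supported Borel probability measure on $\mathbb{R}$, and put $r_k=\int_{\mathbb{R}}x^{k-2}\,d\nu(x)$ for $k\ge 2$. Let $\mathcal{H}=L^2(\mathbb{R}_+,dt)\otimes L^2(\mathbb{R},\nu)$ and let $\mathcal{F}_q(\mathcal{H})$ be the $q$-Fock space, i.e. the completion of $\bigoplus_{n\ge 0}\mathcal{H}^{\otimes n}$ (with $\mathcal{H}^{\otimes 0}=\mathbb{C}\Omega$) for the inner product $$\langle\xi_1\otimes\dots\otimes\xi_n,\eta_1\otimes\dots\otimes\eta_m\rangle_q=\delta_{nm}\sum_{\sigma\in \mathrm{Sym}(n)}q^{i(\sigma)}\prod_{j=1}^n\langle\xi_j,\eta_{\sigma(j)}\rangle ,$$ where $i(\sigma)$ is the number of inversions of $\sigma$. For $\zeta\in\mathcal{H}$ and a bounded operator $T$ on $\mathcal{H}$ let $p(\zeta,T)=a(\zeta)+a^*(\zeta)+p(T)$, a bounded operator on $\mathcal{F}_q(\mathcal{H})$ when $\zeta$ is real and $T$ is self-adjoint and real, where $$a^*(\zeta)(\eta_1\otimes\dots\otimes\eta_n)=\zeta\otimes\eta_1\otimes\dots\otimes\eta_n,\qquad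 a(\zeta)(\eta_1\otimes\dots\otimes\eta_n)=\sum_{k=1}^n q^{k-1}\langle\zeta,\eta_k\rangle\,\eta_1\otimes\dots\otimes\check\eta_k\otimes\dots\otimes\eta_n,$$ $$p(T)(\eta_1\otimes\dots\otimes\eta_n)=\sum_{k=1}^n q^{k-1}(T\eta_k)\otimes\eta_1\otimes\dots\otimes\check\eta_k\otimes\dots\otimes\eta_n$$ ($\check\eta_k$ means that $\eta_k$ is omitted; $a(\zeta)\Omega=p(T)\Omega=0$ and $a^*(\zeta)\Omega=\zeta$). For $k\ge1$, $t\ge0$ let $Y_k(t)=p\bigl(\mathbf 1_{[0,t)}\otimes x^{k-1},\,M_{\mathbf 1_{[0,t)}\otimes x^{k}}\bigr)$, where $M_f$ denotes multiplication by $f$; $X(t)=Y_1(t)$ is the $q$-Lévy process with canonical measure $\nu$. The process is called the $q$-Brownian motion if $r_k=0$ for all $k>2$. Let $\mathcal{A}_{X,\Delta}$ be the von Neumann algebra on $\mathcal{F}_q(\mathcal{H})$ generated by $\{Y_k(t):k\ge1,\ t\ge0\}$. The following dichotomy holds. 1. If $q=0$, or if the process is the $q$-Brownian motion, then $\mathcal{A}_{X,\Delta}$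 is a $\mathrm{II}_1$-factor (an infinite-dimensional finite factor). 2. If $q\ne0$ and the process is not the $q$-Brownian motion (i.e. $r_k\neq0$ for some $k>2$), then $\mathcal{A}_{X,\Delta}$ has no normal tracial states, and it is infinite: it contains an isometry that is not unitary. -/

import Mathlib

open MeasureTheory
open scoped ComplexConjugate

noncomputable section

namespace QLevy

/-! ### The `q`-deformed inner product -/

/-- The number of inversions `i(σ)` of a permutation. -/
def inversions {n : ℕ} (σ : Equiv.Perm (Fin n)) : ℕ :=
  (Finset.univ.filter fun p : Fin n × Fin n => p.1 < p.2 ∧ σ p.2 < σ p.1).card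

section Kernel

open scoped ComplexOrder

variable {H : Type*} [NormedAddCommGroup H] [InnerProductSpace ℂ H]

/-- The `q`-inner product of two simple tensors `ξ₁ ⊗ ⋯ ⊗ ξₙ` and `η₁ ⊗ ⋯ ⊗ ηₘ`, each written as the
list of its factors (the empty list is the vacuum):
`⟨ξ, P η⟩₀ = δₙₘ ∑_σ q ^ i(σ) ∏ᵢ ⟨ξᵢ, η_{σ(i)}⟩`. -/
def qKernel (q : ℝ) (l l' : List H) : ℂ :=
  if h : l.length = l'.length then
    ∑ σ : Equiv.Perm (Fin l.length),
      (q : ℂ) ^ inversions σ * ∏ i, inner ℂ (l.get i) (l'.get (Fin.cast h (σ i)))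
  else 0

/-! Positivity of the `q`-inner product: the kernel `q ^ i(ρ τ⁻¹)` on permutations is an entrywise
product, over pairs of indices, of positive semidefinite kernels. -/

theorem posSemidef_inner {ι E : Type*} [NormedAddCommGroup E] [InnerProductSpace ℂ E]
    (v : ι → E) : (Matrix.of fun i j => inner ℂ (v i) (v j)).PosSemidef := by
  refine ⟨?_, fun x => ?_⟩
  · ext i j
    simp
  · have h : (x.sum fun i xi => x.sum fun j xj =>
        star xi * (Matrix.of fun i j => inner ℂ (v i) (v j)) i j * xj)
        = inner ℂ (x.sum fun i xi => xi • v i) (x.sum fun i xi => xi • v i) := by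
      simp only [Finsupp.sum, sum_inner, inner_sum, inner_smul_left, inner_smul_right,
        Finset.mul_sum]
      rw [Finset.sum_comm]
      refine Finset.sum_congr rfl fun i _ => Finset.sum_congr rfl fun j _ => ?_
      simp only [Matrix.of_apply, RCLike.star_def]
      ring
    rw [h, inner_self_eq_norm_sq_to_K]
    positivity

theorem posSemidef_prod {ι κ : Type*} (s : Finset κ) (A : κ → Matrix ι ι ℂ)
    (hA : ∀ k, (A k).PosSemidef) :
    (Matrix.of fun i j => ∏ k ∈ s, A k i j).PosSemidef := by
  classical
  induction s using Finset.induction_on with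
  | empty =>
    convert posSemidef_inner (fun _ : ι => (1 : ℂ)) using 1
    ext i j
    simp
  | insert a s ha ih =>
    have h : (Matrix.of fun i j => ∏ k ∈ insert a s, A k i j)
        = (A a).hadamard (Matrix.of fun i j => ∏ k ∈ s, A k i j) := by
      ext i j
      simp [Finset.prod_insert ha]
    rw [h]
    exact (hA a).hadamard ih

theorem posSemidef_sum_out {ι κ : Type*} [Fintype κ] (A : Matrix (ι × κ) (ι × κ) ℂ)
    (hA : A.PosSemidef) :
    (Matrix.of fun i j => ∑ a, ∑ b, A (i, a) (j, b)).PosSemidef := by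
  classical
  refine ⟨?_, fun x => ?_⟩
  · ext i j
    simp only [Matrix.conjTranspose_apply, Matrix.of_apply, star_sum]
    rw [Finset.sum_comm]
    refine Finset.sum_congr rfl fun a _ => Finset.sum_congr rfl fun b _ => ?_
    exact hA.1.apply _ _
  · let y : ι × κ →₀ ℂ := Finsupp.onFinset (x.support ×ˢ (Finset.univ : Finset κ))
      (fun p => x p.1) (fun p hp => by simpa using hp)
    have hy : ∀ g : ι × κ → ℂ → ℂ, (∀ p, g p 0 = 0) →
        y.sum g = ∑ i ∈ x.support, ∑ a, g (i, a) (x i) := by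
      intro g hg
      rw [Finsupp.onFinset_sum _ hg, Finset.sum_product]
    have h := hA.2 y
    rw [hy _ (by intro p; simp)] at h
    convert h using 1
    refine Finset.sum_congr rfl fun i _ => ?_
    rw [Finset.sum_congr rfl fun a _ => hy (fun j xj => star (x i) * A (i, a) j * xj)
      (by intro p; simp)]
    rw [Finset.sum_comm]
    refine Finset.sum_congr rfl fun j _ => ?_
    simp only [Matrix.of_apply, Finset.mul_sum, Finset.sum_mul]

theorem posSemidef_sign {ι : Type*} {q : ℝ} (hq : q ∈ Set.Icc (-1 : ℝ) 1) (P : ι → Prop)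
    [DecidablePred P] :
    (Matrix.of fun i j => if (P i ↔ P j) then (1 : ℂ) else q).PosSemidef := by
  have h1 := (posSemidef_inner (fun _ : ι => (1 : ℂ))).smul
    (show (0 : ℝ) ≤ (1 + q) / 2 by linarith [hq.1])
  have h2 := (posSemidef_inner (fun i : ι => if P i then (1 : ℂ) else -1)).smul
    (show (0 : ℝ) ≤ (1 - q) / 2 by linarith [hq.2])
  convert h1.add h2 using 1
  ext i j
  by_cases hi : P i <;> by_cases hj : P j <;> simp [hi, hj] <;> ring

/-- Counting inversions of `ρ τ⁻¹` through pairs ordered differently by `τ` and `ρ`. -/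
theorem pow_inversions {n : ℕ} (q : ℂ) (σ τ : Equiv.Perm (Fin n)) :
    q ^ inversions σ = ∏ p ∈ Finset.univ.filter fun p : Fin n × Fin n => p.1 < p.2,
      if (τ p.1 < τ p.2 ↔ (σ * τ) p.1 < (σ * τ) p.2) then 1 else q := by
  rw [Finset.prod_ite, Finset.prod_const_one, one_mul, Finset.prod_const, Finset.filter_filter,
    inversions]
  congr 1
  refine Finset.card_bij'
    (fun p _ => if τ.symm p.1 < τ.symm p.2 then (τ.symm p.1, τ.symm p.2)
      else (τ.symm p.2, τ.symm p.1))
    (fun p _ => if τ p.1 < τ p.2 then (τ p.1, τ p.2) else (τ p.2, τ p.1)) ?_ ?_ ?_ ?_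
  · rintro ⟨x, y⟩ h
    simp only [Finset.mem_filter, Finset.mem_univ, true_and] at h ⊢
    have hne : τ.symm x ≠ τ.symm y := fun e => h.1.ne (τ.symm.injective e)
    split_ifs with hl
    · simpa [h.1, h.2.not_gt] using hl
    · simpa [h.1.not_gt, h.2] using lt_of_le_of_ne (not_lt.1 hl) hne.symm
  · rintro ⟨a, b⟩ h
    replace h := (Finset.mem_filter.1 h).2
    simp only [Finset.mem_filter, Finset.mem_univ, true_and, Equiv.Perm.mul_apply] at h ⊢
    have hne : τ a ≠ τ b := fun e => h.1.ne (τ.injective e)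
    have hne' : σ (τ a) ≠ σ (τ b) := fun e => hne (σ.injective e)
    split_ifs with hl
    · exact ⟨hl, lt_of_le_of_ne (not_lt.1 fun h' => h.2 ⟨fun _ => h', fun _ => hl⟩) hne'.symm⟩
    · refine ⟨lt_of_le_of_ne (not_lt.1 hl) hne.symm, ?_⟩
      by_contra h'
      exact h.2 ⟨fun h'' => absurd h'' hl, fun h'' => absurd h'' h'⟩
  · rintro ⟨x, y⟩ h
    simp only [Finset.mem_filter, Finset.mem_univ, true_and] at h
    by_cases hl : τ.symm x < τ.symm y <;> simp [hl, h.1, h.1.not_gt]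
  · rintro ⟨a, b⟩ h
    replace h := (Finset.mem_filter.1 h).2
    by_cases hl : τ a < τ b <;> simp [hl, h.1, h.1.not_gt]

theorem posSemidef_perm {q : ℝ} (hq : q ∈ Set.Icc (-1 : ℝ) 1) (n : ℕ) {ι : Type*}
    (x : ι → Fin n → H) :
    (Matrix.of fun i j => ∑ σ : Equiv.Perm (Fin n),
      (q : ℂ) ^ inversions σ * ∏ a, inner ℂ (x i a) (x j (σ a))).PosSemidef := by
  have h := posSemidef_sum_out (ι := ι) (κ := Equiv.Perm (Fin n)) _
    ((posSemidef_prod (ι := ι × Equiv.Perm (Fin n))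
      (Finset.univ.filter fun p : Fin n × Fin n => p.1 < p.2)
      (fun p => Matrix.of fun i j => if (i.2 p.1 < i.2 p.2 ↔ j.2 p.1 < j.2 p.2) then (1 : ℂ) else q)
      (fun p => posSemidef_sign hq _)).hadamard
    (posSemidef_prod (ι := ι × Equiv.Perm (Fin n)) (Finset.univ : Finset (Fin n))
      (fun a => Matrix.of fun i j => inner ℂ (x i.1 (i.2 a)) (x j.1 (j.2 a)))
      (fun a => posSemidef_inner _)))
  have h' := h.smul (show (0 : ℝ) ≤ ((n.factorial : ℝ))⁻¹ by positivity)
  convert h' using 1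
  ext i j
  simp only [Matrix.of_apply, Matrix.smul_apply, Matrix.hadamard_apply]
  have key : ∀ τ : Equiv.Perm (Fin n),
      ∑ σ : Equiv.Perm (Fin n), (q : ℂ) ^ inversions σ * ∏ a, inner ℂ (x i a) (x j (σ a))
      = ∑ ρ : Equiv.Perm (Fin n),
        (∏ p ∈ Finset.univ.filter fun p : Fin n × Fin n => p.1 < p.2,
          if (τ p.1 < τ p.2 ↔ ρ p.1 < ρ p.2) then (1 : ℂ) else q)
        * ∏ a, inner ℂ (x i (τ a)) (x j (ρ a)) := by
    intro τ
    refine Fintype.sum_equiv (Equiv.mulRight τ) _ _ fun σ => ?_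
    rw [pow_inversions _ σ τ, Equiv.coe_mulRight]
    congr 1
    exact (Equiv.prod_comp τ fun a => inner ℂ (x i a) (x j (σ a))).symm
  rw [← Finset.sum_congr rfl fun τ _ => key τ, Finset.sum_const, Finset.card_univ,
    Fintype.card_perm, Fintype.card_fin, ← Nat.cast_smul_eq_nsmul ℝ, smul_smul,
    inv_mul_cancel₀ (by positivity), one_smul]

theorem posSemidef_qKernel {q : ℝ} (hq : q ∈ Set.Icc (-1 : ℝ) 1) :
    (Matrix.of fun l l' : List H => qKernel q l l').PosSemidef := by
  classical
  let x : (n : ℕ) → List H → Fin n → H := fun n l a => l.getD a 0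
  let K : ℕ → Matrix (List H) (List H) ℂ := fun n => Matrix.hadamard
    (Matrix.of fun l l' => inner ℂ (if l.length = n then (1 : ℂ) else 0)
      (if l'.length = n then (1 : ℂ) else 0))
    (Matrix.of fun l l' => ∑ σ : Equiv.Perm (Fin n),
      (q : ℂ) ^ inversions σ * ∏ a, inner ℂ (x n l a) (x n l' (σ a)))
  have hK : ∀ n, (K n).PosSemidef := fun n =>
    (posSemidef_inner _).hadamard (posSemidef_perm hq n _)
  have hKne : ∀ n (l l' : List H), l.length ≠ n → K n l l' = 0 := by
    intro n l l' h
    simp [K, h]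
  have hKeq : ∀ l l' : List H, K l.length l l' = qKernel q l l' := by
    intro l l'
    by_cases h : l.length = l'.length
    · rw [qKernel, dif_pos h]
      simp only [K, Matrix.hadamard_apply, Matrix.of_apply, h.symm, if_true]
      have hx : ∀ a : Fin l.length, x l.length l a = l.get a := fun a => by
        simp [x, a.2]
      have hx' : ∀ a : Fin l.length, x l.length l' a = l'.get (Fin.cast h a) := fun a => by
        have : (a : ℕ) < l'.length := a.2.trans_eq h
        simp [x, this]
      simp [hx, hx']
    · have h' : ¬ l'.length = l.length := fun e => h e.symm
      simp [K, qKernel, h, h']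
  refine ⟨?_, fun f => ?_⟩
  · ext l l'
    simp only [Matrix.conjTranspose_apply, Matrix.of_apply]
    by_cases h : l.length = l'.length
    · rw [← hKeq, ← hKeq, h]
      exact (hK _).1.apply _ _
    · have h' : ¬ l'.length = l.length := fun e => h e.symm
      simp [qKernel, h, h']
  · have hsum : (∑ n ∈ f.support.image List.length, K n).PosSemidef :=
      Matrix.posSemidef_sum _ fun n _ => hK n
    refine (hsum.2 f).trans_eq ?_
    refine Finset.sum_congr rfl fun l hl => Finset.sum_congr rfl fun l' _ => ?_
    simp only [Matrix.of_apply, Matrix.sum_apply]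
    rw [Finset.sum_eq_single l.length (fun n _ hn => hKne n l l' hn.symm)
      (fun h => absurd (Finset.mem_image_of_mem _ hl) h), hKeq]

end Kernel

/-! ### The `q`-Fock space and its operators -/

section Fock

variable (q : Set.Ioo (-1 : ℝ) 1) (H : Type*) [NormedAddCommGroup H] [InnerProductSpace ℂ H]

/-- Formal complex linear combinations of simple tensors `η₁ ⊗ ⋯ ⊗ ηₙ`, `n ≥ 0`, a simple tensor
being the list of its factors. It maps onto the algebraic Fock space `⨁ₙ H^{⊗n}`; the multilinearity
relations of the tensor product hold up to vectors of `q`-seminorm zero, which the separated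
completion `Fock q H` identifies with zero. -/
def AlgFock (_q : Set.Ioo (-1 : ℝ) 1) (H : Type*) : Type _ := List H →₀ ℂ

instance : AddCommGroup (AlgFock q H) := inferInstanceAs (AddCommGroup (List H →₀ ℂ))

instance : Module ℂ (AlgFock q H) := inferInstanceAs (Module ℂ (List H →₀ ℂ))

/-- The sesquilinear extension of the `q`-inner product of simple tensors. -/
def qInner (q : ℝ) {H : Type*} [NormedAddCommGroup H] [InnerProductSpace ℂ H]
    (f g : List H →₀ ℂ) : ℂ :=
  f.sum fun l a => g.sum fun l' b => conj a * b * qKernel q l l'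

/-- The `q`-inner product on the algebraic Fock space. -/
@[reducible]
def preCore : PreInnerProductSpace.Core ℂ (AlgFock q H) where
  inner f g := qInner (q : ℝ) (f : List H →₀ ℂ) (g : List H →₀ ℂ)
  conj_inner_symm f g := by
    have hK := (posSemidef_qKernel (H := H) (Set.Ioo_subset_Icc_self q.2)).1
    simp only [qInner, Finsupp.sum, map_sum]
    rw [Finset.sum_comm]
    refine Finset.sum_congr rfl fun l _ => Finset.sum_congr rfl fun l' _ => ?_
    have h := hK.apply l l'
    simp only [Matrix.of_apply, RCLike.star_def] at h
    rw [map_mul, map_mul, h, Complex.conj_conj]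
    ring
  re_inner_nonneg f := by
    have h := (posSemidef_qKernel (H := H) (Set.Ioo_subset_Icc_self q.2)).2 f
    have h' := (RCLike.nonneg_iff.1 h).1
    refine h'.trans_eq (congrArg _ ?_)
    refine Finset.sum_congr rfl fun l _ => Finset.sum_congr rfl fun l' _ => ?_
    simp only [Matrix.of_apply, RCLike.star_def]
    ring
  add_left f g h := by
    classical
    refine Finsupp.sum_add_index' (fun l => ?_) fun l a b => ?_
    · simp [Finsupp.sum]
    · simp only [map_add, add_mul, Finsupp.sum, Finset.sum_add_distrib]
  smul_left f g r := by
    refine (Finsupp.sum_smul_index' (fun l => ?_)).trans ?_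
    · simp [Finsupp.sum]
    · simp only [qInner, Finsupp.sum, Finset.mul_sum, smul_eq_mul, map_mul, mul_assoc]

instance : SeminormedAddCommGroup (AlgFock q H) :=
  @InnerProductSpace.Core.toSeminormedAddCommGroup ℂ _ _ _ _ (preCore q H)

instance : InnerProductSpace ℂ (AlgFock q H) := InnerProductSpace.ofCore (preCore q H)

/-- The `q`-Fock space `F_q(H)`: the Hilbert space completion of the algebraic Fock space with
respect to the `q`-inner product. -/
abbrev Fock : Type _ := UniformSpace.Completion (AlgFock q H)

variable {H}

/-- The simple tensor `η₁ ⊗ ⋯ ⊗ ηₙ`; the vacuum `Ω` is `tensor q []`. -/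
def tensor (l : List H) : AlgFock q H := Finsupp.single l (1 : ℂ)

theorem inner_tensor (l l' : List H) :
    inner ℂ (tensor q l) (tensor q l') = qKernel q l l' := by
  change qInner (q : ℝ) (Finsupp.single l (1 : ℂ)) (Finsupp.single l' (1 : ℂ)) = _
  simp [qInner]

/-- The linear map on the algebraic Fock space with prescribed values on simple tensors. -/
def extendTensor (φ : List H → AlgFock q H) : AlgFock q H →ₗ[ℂ] AlgFock q H :=
  Finsupp.linearCombination ℂ φ

/-- Creation: `a*(ζ) (η₁ ⊗ ⋯ ⊗ ηₙ) = ζ ⊗ η₁ ⊗ ⋯ ⊗ ηₙ`. -/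
def creation (ζ : H) : AlgFock q H →ₗ[ℂ] AlgFock q H :=
  extendTensor q fun l => tensor q (ζ :: l)

/-- Annihilation: `a(ζ) (η₁ ⊗ ⋯ ⊗ ηₙ) = ∑ₖ q^{k-1} ⟨ζ, ηₖ⟩ η₁ ⊗ ⋯ ⊗ η̌ₖ ⊗ ⋯ ⊗ ηₙ`
(in the code the positions are counted from `0`). -/
def annihilation (ζ : H) : AlgFock q H →ₗ[ℂ] AlgFock q H :=
  extendTensor q fun l => ∑ k : Fin l.length,
    (((q : ℝ) : ℂ) ^ (k : ℕ) * inner ℂ ζ (l.get k)) • tensor q (l.eraseIdx k)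

/-- Gauge operator: `p(T) (η₁ ⊗ ⋯ ⊗ ηₙ) = ∑ₖ q^{k-1} (T ηₖ) ⊗ η₁ ⊗ ⋯ ⊗ η̌ₖ ⊗ ⋯ ⊗ ηₙ`
(in the code the positions are counted from `0`). -/
def gauge (T : H →L[ℂ] H) : AlgFock q H →ₗ[ℂ] AlgFock q H :=
  extendTensor q fun l => ∑ k : Fin l.length,
    (((q : ℝ) : ℂ) ^ (k : ℕ)) • tensor q (T (l.get k) :: l.eraseIdx k)

/-- `p(ζ, T) = a(ζ) + a*(ζ) + p(T)` on the algebraic Fock space. -/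
def fieldOp (ζ : H) (T : H →L[ℂ] H) : AlgFock q H →ₗ[ℂ] AlgFock q H :=
  annihilation q ζ + creation q ζ + gauge q T

/-- The bounded operator `A` on `F_q(H)` is the continuous extension of the operator `B` on the
algebraic Fock space. Such an `A` is unique, since the algebraic Fock space is dense. -/
def IsExtension (A : Fock q H →L[ℂ] Fock q H) (B : AlgFock q H →ₗ[ℂ] AlgFock q H) : Prop :=
  ∀ v : AlgFock q H, A (v : Fock q H) = ((B v : AlgFock q H) : Fock q H)

end Fock

/-! ### Von Neumann algebras -/

section VonNeumann

variable {F : Type*} [NormedAddCommGroup F] [InnerProductSpace ℂ F] [CompleteSpace F]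

/-- The von Neumann algebra generated by a set `S` of bounded operators: the double commutant of
`S ∪ S*`. -/
def vonNeumannGenerated (S : Set (F →L[ℂ] F)) : VonNeumannAlgebra F where
  toStarSubalgebra := StarSubalgebra.centralizer ℂ
    (StarSubalgebra.centralizer ℂ S : Set (F →L[ℂ] F))
  centralizer_centralizer' := by simp

/-- A von Neumann algebra is finite if every isometry in it is unitary. -/
def IsFiniteVN (M : VonNeumannAlgebra F) : Prop :=
  ∀ v ∈ M, star v * v = 1 → v * star v = 1

/-- A von Neumann algebra is infinite if it is not finite: it contains a non-unitary isometry. -/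
def IsInfiniteVN (M : VonNeumannAlgebra F) : Prop :=
  ∃ v ∈ M, star v * v = 1 ∧ v * star v ≠ 1

/-- A factor: the center consists of the scalars. -/
def IsFactor (M : VonNeumannAlgebra F) : Prop :=
  ∀ z ∈ M, z ∈ M.commutant → ∃ c : ℂ, z = c • (1 : F →L[ℂ] F)

/-- A `II₁`-factor: an infinite-dimensional finite factor. -/
structure IsIIOneFactor (M : VonNeumannAlgebra F) : Prop where
  factor : IsFactor M
  finite : IsFiniteVN M
  infinite_dimensional : ¬ FiniteDimensional ℂ M.toStarSubalgebra

/-- Normal tracial states on a von Neumann algebra: positive unital linear functionals `τ` with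
`τ(ab) = τ(ba)` that preserve least upper bounds of (bounded) increasing nets of positive
elements. The order is the operator order. -/
structure IsNormalTracialState (M : VonNeumannAlgebra F)
    (τ : M.toStarSubalgebra →ₗ[ℂ] ℂ) : Prop where
  map_one : τ 1 = 1
  nonneg : ∀ a, 0 ≤ (τ (star a * a)).re ∧ (τ (star a * a)).im = 0
  trace : ∀ a b, τ (a * b) = τ (b * a)
  normal : ∀ (D : Set M.toStarSubalgebra) (s : M.toStarSubalgebra), D.Nonempty →
    DirectedOn (· ≤ ·) D → (∀ a ∈ D, 0 ≤ a) → IsLUB D s →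
    IsLUB ((fun a => (τ a).re) '' D) (τ s).re

end VonNeumann

/-! ### `q`-Lévy processes -/

section Levy

/-- `ν` is carried by a compact set. -/
def CompactlySupported (ν : Measure ℝ) : Prop := ∃ K : Set ℝ, IsCompact K ∧ ν Kᶜ = 0

/-- The numbers `r_k = ∫ x^{k-2} dν(x)` for `k ≥ 2`. -/
def levyMoment (ν : Measure ℝ) (k : ℕ) : ℝ := ∫ x, x ^ (k - 2) ∂ν

/-- The measure `dt ⊗ ν` on `ℝ₊ × ℝ`. -/
def levyMeasure (ν : Measure ℝ) : Measure (ℝ × ℝ) := (volume.restrict (Set.Ici 0)).prod ν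

/-- The complex one-particle Hilbert space `L²(ℝ₊, dt) ⊗ L²(ℝ, ν) = L²(ℝ₊ × ℝ, dt ⊗ ν)`. -/
abbrev OneParticle (ν : Measure ℝ) : Type := Lp ℂ 2 (levyMeasure ν)

/-- The function `1_{[0,t)} ⊗ x^k` on `ℝ₊ × ℝ`. -/
def stepPow (k : ℕ) (t : ℝ) : ℝ × ℝ → ℂ :=
  Set.indicator (Set.Ico 0 t ×ˢ Set.univ) fun p => (p.2 : ℂ) ^ k

theorem measurable_stepPow (k : ℕ) (t : ℝ) : Measurable (stepPow k t) :=
  Measurable.indicator (by fun_prop) (measurableSet_Ico.prod MeasurableSet.univ)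

theorem stepPow_bound (ν : Measure ℝ) (hν : CompactlySupported ν) (k : ℕ) (t : ℝ) :
    ∃ C : ℝ, ∀ᵐ p ∂(levyMeasure ν), ‖stepPow k t p‖ ≤ C := by
  obtain ⟨K, hK, hνK⟩ := hν
  obtain ⟨R, hR⟩ := hK.isBounded.exists_norm_le
  refine ⟨|R| ^ k, ?_⟩
  have h1 : ∀ᵐ x ∂ν, x ∈ K := by
    rw [ae_iff]
    exact hνK
  have h2 : ∀ᵐ p ∂(levyMeasure ν), p.2 ∈ K :=
    Measure.quasiMeasurePreserving_snd.ae h1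
  filter_upwards [h2] with p hp
  refine (norm_indicator_le_norm_self _ _).trans ?_
  rw [norm_pow, Complex.norm_real]
  exact pow_le_pow_left₀ (norm_nonneg _) ((hR _ hp).trans (le_abs_self R)) k

theorem memLp_top_stepPow (ν : Measure ℝ) (hν : CompactlySupported ν) (k : ℕ) (t : ℝ) :
    MemLp (stepPow k t) ⊤ (levyMeasure ν) := by
  obtain ⟨C, hC⟩ := stepPow_bound ν hν k t
  exact memLp_top_of_bound (measurable_stepPow k t).aestronglyMeasurable C hC

theorem memLp_two_stepPow (ν : Measure ℝ) [IsProbabilityMeasure ν] (hν : CompactlySupported ν)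
    (k : ℕ) (t : ℝ) :
    MemLp (stepPow k t) 2 (levyMeasure ν) := by
  obtain ⟨C, hC⟩ := stepPow_bound ν hν k t
  have hS : MeasurableSet (Set.Ico 0 t ×ˢ (Set.univ : Set ℝ)) :=
    measurableSet_Ico.prod MeasurableSet.univ
  have hfin : levyMeasure ν (Set.Ico 0 t ×ˢ Set.univ) < ⊤ := by
    rw [levyMeasure, Measure.prod_prod, measure_univ, mul_one]
    exact (Measure.restrict_apply_le _ _).trans_lt measure_Ico_lt_top
  have : IsFiniteMeasure ((levyMeasure ν).restrict (Set.Ico 0 t ×ˢ Set.univ)) :=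
    ⟨by simpa using hfin⟩
  have h : MemLp (stepPow k t) 2 ((levyMeasure ν).restrict (Set.Ico 0 t ×ˢ Set.univ)) :=
    MemLp.of_bound (measurable_stepPow k t).aestronglyMeasurable C (ae_restrict_of_ae hC)
  have h' := (memLp_indicator_iff_restrict hS).2 h
  rwa [stepPow, Set.indicator_indicator, Set.inter_self] at h'

/-- The vector `1_{[0,t)} ⊗ x^{k-1}` of the process `Y_k(t)`, `k ≥ 1`. -/
def levyVector (ν : Measure ℝ) [IsProbabilityMeasure ν] (hν : CompactlySupported ν)
    (k : ℕ) (t : ℝ) : OneParticle ν :=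
  (memLp_two_stepPow ν hν (k - 1) t).toLp _

/-- The operator of multiplication by the bounded function `1_{[0,t)} ⊗ x^k`. -/
def levyMul (ν : Measure ℝ) [IsProbabilityMeasure ν] (hν : CompactlySupported ν)
    (k : ℕ) (t : ℝ) : OneParticle ν →L[ℂ] OneParticle ν :=
  (ContinuousLinearMap.mul ℂ ℂ).holderL (levyMeasure ν) ⊤ 2 2
    ((memLp_top_stepPow ν hν k t).toLp _)

theorem levyMul_apply (ν : Measure ℝ) [IsProbabilityMeasure ν] (hν : CompactlySupported ν)
    (k : ℕ) (t : ℝ) (η : OneParticle ν) :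
    levyMul ν hν k t η =ᵐ[levyMeasure ν] fun p => stepPow k t p * η p := by
  refine (ContinuousLinearMap.coeFn_holder _ _ _).trans ?_
  filter_upwards [(memLp_top_stepPow ν hν k t).coeFn_toLp] with p hp
  simp [hp]

/-- The operators `Y_k(t) = p(1_{[0,t)} ⊗ x^{k-1}, 1_{[0,t)} ⊗ x^k)`, `k ≥ 1`, `t ≥ 0`; in
particular `X(t) = Y_1(t)` is the `q`-Lévy process itself. -/
def levyOperators (ν : Measure ℝ) [IsProbabilityMeasure ν] (q : Set.Ioo (-1 : ℝ) 1)
    (hν : CompactlySupported ν) :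
    Set (Fock q (OneParticle ν) →L[ℂ] Fock q (OneParticle ν)) :=
  {A | ∃ (k : ℕ) (t : ℝ), 1 ≤ k ∧ 0 ≤ t ∧
    IsExtension q A (fieldOp q (levyVector ν hν k t) (levyMul ν hν k t))}

/-- The von Neumann algebra of the `q`-Lévy process with canonical measure `ν`: it is generated by
the operators `Y_k(t)`, `k ≥ 1`, `t ≥ 0`. -/
def levyVN (ν : Measure ℝ) [IsProbabilityMeasure ν] (q : Set.Ioo (-1 : ℝ) 1)
    (hν : CompactlySupported ν) :
    VonNeumannAlgebra (Fock q (OneParticle ν)) :=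
  vonNeumannGenerated (levyOperators ν q hν)

/-- The `q`-Lévy process with canonical measure `ν` is the `q`-Brownian motion: `r_k = 0` for all
`k > 2`. -/
def IsBrownian (ν : Measure ℝ) : Prop := ∀ k : ℕ, 2 < k → levyMoment ν k = 0

end Levy

end QLevy

end

/-! Time is unbounded, so the increments of `X` over `[n, n + 1)` (`incOp`) eventually lie beyond
the support of any fixed tensor built from the vectors `1_{[0,t)} ⊗ x^{k-1}`. On such a tensor
`incOp` only creates the unit vector `e_n = 1_{[n,n+1)} ⊗ 1` (`incVec` with `k = 1`). Weak limits of
products with these increments stay in the algebra, and they are computed by counting how many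
letters `e_n` must pass, each costing a factor `q`.

If `q ≠ 0`, consider the limit of `s_n Z s_n`, where `s_n` is the increment
(`mem_levyVN_of_compression`). Write `Y_k(t) = G + P` with `G` the sum of annihilation and creation
and `P` the gauge part. The compression sends this to `q G + q² P`, and `q ≠ q²`, so `G` and `P`
both lie in the algebra (`gau_and_gaussian_mem`). For `k = 1` the product `P G` contains the
creation of `1_{[0,t)} ⊗ x`; the compression scales that term by `q` and the remainder by `q³`, so
this creation operator lies in the algebra too (`cre_mem`). Its increments `A_n` satisfy `A_n* A_n =
c + q A_n A_n*` with `c = ∫ x² dν`, positive exactly when the process is not Brownian. A trace would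
give every `A_n A_n*` the value `c / (1 - q)`, although the partial sums of the `A_n A_n*` are
uniformly bounded (`not_exists_trace`). Moreover `A_0` is bounded below while `A_0*` kills the
vacuum, so its polar part is a non-unitary isometry (`isInfiniteVN_of_bounded_below`).

If `q = 0` or the process is Brownian, conjugation by the reversal of tensors turns the `Y_k(t)`
into right operators that commute with all the left ones (`levyOp_mul_rightOp_levyOp`). Left and
right operators agree on the vacuum `Ω`, which is cyclic; hence `Ω` is separating and its vector
state is tracial (`eq_zero_of_apply_vacuum`, `inner_vacuum_comm`), which gives finiteness. For
central `z` the left and right increments agree on `z Ω`. Pairing `z Ω` with `s_n s_n η - r_n s_n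
η`, where `r_n` is the right increment, and letting `n → ∞` gives `(1 - q^m) ⟨z Ω, η⟩ = 0` for
tensors `η` of degree `m ≥ 1`. So `z Ω` is a multiple of `Ω` and `z` is scalar (`isFactor_levyVN`).

Underneath lie the boundedness of annihilation, creation and gauge operators, derived from the
`q`-commutation relation (`sum_norm_annihilation_sq_le`), and the totality of the vectors `1_{[0,t)}
⊗ x^{k-1}` (`closure_span_levyVector`). -/

noncomputable section

set_option linter.unusedSectionVars false

namespace QLevy

/-! ### Combinatorics of inversions -/

/-- The permutation of `Fin (n + 1)` that sends `0` to `k` and acts as `τ` on the remaining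
indices. -/
def consPerm {n : ℕ} (k : Fin (n + 1)) (τ : Equiv.Perm (Fin n)) : Equiv.Perm (Fin (n + 1)) :=
  (finSuccEquiv' 0).trans ((Equiv.optionCongr τ).trans (finSuccEquiv' k).symm)

@[simp] theorem consPerm_zero {n : ℕ} (k : Fin (n + 1)) (τ : Equiv.Perm (Fin n)) :
    consPerm k τ 0 = k := by
  simp [consPerm]

@[simp] theorem consPerm_succ {n : ℕ} (k : Fin (n + 1)) (τ : Equiv.Perm (Fin n)) (i : Fin n) :
    consPerm k τ i.succ = k.succAbove (τ i) := by
  simp only [consPerm, Equiv.trans_apply, ← Fin.succAbove_zero_apply, finSuccEquiv'_succAbove,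
    Equiv.optionCongr_apply, Option.map_some, finSuccEquiv'_symm_some]

theorem bijective_consPerm (n : ℕ) :
    Function.Bijective fun p : Fin (n + 1) × Equiv.Perm (Fin n) => consPerm p.1 p.2 := by
  rw [Fintype.bijective_iff_injective_and_card]
  refine ⟨?_, ?_⟩
  · rintro ⟨k, τ⟩ ⟨k', τ'⟩ h
    have hk : k = k' := by simpa using congrArg (fun σ : Equiv.Perm (Fin (n + 1)) => σ 0) h
    subst hk
    refine Prod.ext rfl (Equiv.ext fun i => ?_)
    have := congrArg (fun σ : Equiv.Perm (Fin (n + 1)) => σ i.succ) h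
    simpa using this
  · simp [Fintype.card_perm, Nat.factorial_succ]

theorem inversions_eq_sum {n : ℕ} (σ : Equiv.Perm (Fin n)) :
    inversions σ = ∑ i, ∑ j, if i < j ∧ σ j < σ i then 1 else 0 := by
  rw [inversions, Finset.card_filter, Fintype.sum_prod_type]

/-- Index `0` precedes every other index and is inverted exactly with the `k` indices sent below
`k`. Since `k.succAbove` is increasing, the other inversions are those of `τ`. -/
theorem inversions_consPerm {n : ℕ} (k : Fin (n + 1)) (τ : Equiv.Perm (Fin n)) :
    inversions (consPerm k τ) = k + inversions τ := by
  have hk : (∑ j : Fin n, if k.succAbove (τ j) < k then 1 else 0) = (k : ℕ) := by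
    rw [Equiv.sum_comp τ fun j => if k.succAbove j < k then 1 else 0]
    simp only [Fin.succAbove_lt_iff_castSucc_lt]
    rw [← Finset.card_filter]
    have h := Fin.sum_univ_castSucc fun j : Fin (n + 1) => if j < k then 1 else 0
    rw [← Finset.card_filter, Finset.filter_gt_eq_Iio, Fin.card_Iio,
      if_neg (not_lt.2 (Fin.le_last k)), add_zero, ← Finset.card_filter] at h
    exact h.symm
  rw [inversions_eq_sum, inversions_eq_sum, Fin.sum_univ_succ]
  congr 1
  · rw [Fin.sum_univ_succ]
    simpa using hk
  · refine Finset.sum_congr rfl fun i _ => ?_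
    rw [Fin.sum_univ_succ]
    simp [(Fin.strictMono_succAbove k).lt_iff_lt]

theorem inversions_conj_rev {n : ℕ} (σ : Equiv.Perm (Fin n)) :
    inversions (Fin.revPerm.trans (σ.trans Fin.revPerm)) = inversions σ := by
  refine Finset.card_bij' (fun p _ => (p.2.rev, p.1.rev)) (fun p _ => (p.2.rev, p.1.rev))
    ?_ ?_ ?_ ?_ <;> simp +contextual [Fin.rev_lt_rev]

/-! ### Recursion and reversal symmetry of the `q`-inner product -/

section Kernel

variable {H : Type*} [NormedAddCommGroup H] [InnerProductSpace ℂ H]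

theorem qKernel_eq_sum (q : ℝ) {n : ℕ} {l l' : List H} (hl : l.length = n) (hl' : l'.length = n) :
    qKernel q l l' = ∑ σ : Equiv.Perm (Fin n), (q : ℂ) ^ inversions σ *
      ∏ i, inner ℂ (l.get (Fin.cast hl.symm i)) (l'.get (Fin.cast hl'.symm (σ i))) := by
  subst hl
  rw [qKernel, dif_pos hl'.symm]
  rfl

theorem qKernel_of_length_ne (q : ℝ) {l l' : List H} (h : l.length ≠ l'.length) :
    qKernel q l l' = 0 := dif_neg h

/-- Expansion of the `q`-inner product along the first factor. -/
theorem qKernel_cons (q : ℝ) (ζ : H) (l l' : List H) :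
    qKernel q (ζ :: l) l' = ∑ k : Fin l'.length,
      (q : ℂ) ^ (k : ℕ) * inner ℂ ζ (l'.get k) * qKernel q l (l'.eraseIdx k) := by
  by_cases h : l'.length = l.length + 1
  · obtain ⟨m, hm⟩ : ∃ m, l.length = m := ⟨_, rfl⟩
    have hl' : l'.length = m + 1 := by omega
    have he : ∀ k : Fin (m + 1), (l'.eraseIdx k).length = m := fun k => by
      rw [List.length_eraseIdx_of_lt (by omega)]; omega
    rw [qKernel_eq_sum q (n := m + 1) (by simp [hm]) hl',
      ← (bijective_consPerm m).sum_comp, Fintype.sum_prod_type,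
      ← Equiv.sum_comp (finCongr hl').symm]
    refine Finset.sum_congr rfl fun k _ => ?_
    have hk : qKernel q l (l'.eraseIdx ((finCongr hl').symm k : Fin l'.length)) = _ :=
      qKernel_eq_sum q hm (he k)
    rw [hk, Finset.mul_sum]
    refine Finset.sum_congr rfl fun τ _ => ?_
    rw [inversions_consPerm, pow_add, Fin.prod_univ_succ]
    -- Erasing position `k` from a list amounts to reindexing by `k.succAbove`, which is how
    -- `consPerm k τ` acts on successors.
    have hg : ∀ i : Fin m, (l'.eraseIdx k).get (Fin.cast (he k).symm (τ i))
        = l'.get (Fin.cast hl'.symm (k.succAbove (τ i))) := by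
      intro i
      simp only [List.get_eq_getElem, List.getElem_eraseIdx, Fin.val_cast]
      by_cases hik : ((τ i : Fin m) : ℕ) < k
      · rw [dif_pos hik]
        congr 1
        simp [Fin.succAbove, Fin.lt_def, hik]
      · rw [dif_neg hik]
        congr 1
        simp [Fin.succAbove, Fin.lt_def, hik]
    simp only [consPerm_zero, consPerm_succ]
    simp only [finCongr_symm, finCongr_apply, Fin.val_cast]
    simp only [hg]
    rw [mul_mul_mul_comm]
    rfl
  · rw [qKernel_of_length_ne q (by simpa using fun e => h e.symm)]
    refine (Finset.sum_eq_zero fun k _ => ?_).symm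
    rw [qKernel_of_length_ne q, mul_zero]
    rw [List.length_eraseIdx_of_lt k.2]
    have := k.2
    omega

theorem qKernel_reverse (q : ℝ) (l l' : List H) :
    qKernel q l.reverse l'.reverse = qKernel q l l' := by
  by_cases h : l.length = l'.length
  · obtain ⟨m, hm⟩ : ∃ m, l.length = m := ⟨_, rfl⟩
    have hm' : l'.length = m := by omega
    rw [qKernel_eq_sum q (n := m) (by simp [hm]) (by simp [hm']), qKernel_eq_sum q hm hm',
      ← Equiv.sum_comp (Equiv.permCongr Fin.revPerm)]
    refine Finset.sum_congr rfl fun σ _ => ?_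
    rw [← inversions_conj_rev σ]
    congr 1
    · rw [← Equiv.prod_comp Fin.revPerm]
      refine Finset.prod_congr rfl fun i _ => ?_
      simp only [List.get_eq_getElem, List.getElem_reverse]
      congr 2 <;> simp [hm, hm'] <;> omega
  · rw [qKernel_of_length_ne q h, qKernel_of_length_ne q (by simpa using h)]

end Kernel

/-! ### Creation, annihilation and gauge operators on the algebraic Fock space -/

section AlgFock

variable {q : Set.Ioo (-1 : ℝ) 1} {H : Type*} [NormedAddCommGroup H] [InnerProductSpace ℂ H]

@[simp] theorem extendTensor_tensor (φ : List H → AlgFock q H) (l : List H) :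
    extendTensor q φ (tensor q l) = φ l := by
  change Finsupp.linearCombination ℂ φ (Finsupp.single l 1) = _
  simp

theorem tensor_induction {p : AlgFock q H → Prop} (tensor : ∀ l, p (tensor q l))
    (add : ∀ v w, p v → p w → p (v + w)) (smul : ∀ (c : ℂ) v, p v → p (c • v)) (v : AlgFock q H) :
    p v := by
  refine Finsupp.induction_linear (motive := p) v ?_ add fun l c => ?_
  · have h := smul 0 _ (tensor [])
    rwa [zero_smul] at h
  · have h := smul c _ (tensor l)
    have h2 : c • QLevy.tensor q l = (Finsupp.single l c : List H →₀ ℂ) := by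
      refine (Finsupp.smul_single c l 1).trans ?_
      simp
    rwa [h2] at h

theorem algFock_ext {E : Type*} [AddCommMonoid E] [Module ℂ E] {f g : AlgFock q H →ₗ[ℂ] E}
    (h : ∀ l, f (tensor q l) = g (tensor q l)) : f = g := by
  refine LinearMap.ext fun v => ?_
  induction v using tensor_induction with
  | tensor l => exact h l
  | add v w hv hw => rw [map_add, map_add, hv, hw]
  | smul c v hv => rw [map_smul, map_smul, hv]

@[simp] theorem creation_tensor (ζ : H) (l : List H) :
    creation q ζ (tensor q l) = tensor q (ζ :: l) := extendTensor_tensor _ _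

theorem annihilation_tensor (ζ : H) (l : List H) :
    annihilation q ζ (tensor q l) = ∑ k : Fin l.length,
      (((q : ℝ) : ℂ) ^ (k : ℕ) * inner ℂ ζ (l.get k)) • tensor q (l.eraseIdx k) :=
  extendTensor_tensor _ _

theorem gauge_tensor (T : H →L[ℂ] H) (l : List H) :
    gauge q T (tensor q l) = ∑ k : Fin l.length,
      (((q : ℝ) : ℂ) ^ (k : ℕ)) • tensor q (T (l.get k) :: l.eraseIdx k) :=
  extendTensor_tensor _ _

@[simp] theorem annihilation_vacuum (ζ : H) : annihilation q ζ (tensor q []) = 0 := by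
  rw [annihilation_tensor]; exact Finset.sum_empty

@[simp] theorem gauge_vacuum (T : H →L[ℂ] H) : gauge q T (tensor q []) = 0 := by
  rw [gauge_tensor]; exact Finset.sum_empty

/-- The new factor occupies position `0`, so every other position moves up by one and gains a factor
`q`. -/
theorem annihilation_tensor_cons (ζ x : H) (l : List H) :
    annihilation q ζ (tensor q (x :: l)) = (inner ℂ ζ x) • tensor q l +
      ((q : ℝ) : ℂ) • creation q x (annihilation q ζ (tensor q l)) := by
  rw [annihilation_tensor, annihilation_tensor]
  refine (Fin.sum_univ_succ (n := l.length) _).trans ?_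
  simp only [map_sum, Finset.smul_sum, map_smul, creation_tensor, smul_smul, Fin.val_zero,
    Fin.val_succ, pow_zero, one_mul]
  congr 1
  refine Finset.sum_congr rfl fun k _ => ?_
  rw [pow_succ', mul_assoc]
  rfl

theorem annihilation_creation (ζ η : H) (v : AlgFock q H) :
    annihilation q ζ (creation q η v) = (inner ℂ ζ η) • v +
      ((q : ℝ) : ℂ) • creation q η (annihilation q ζ v) := by
  have h : annihilation q ζ ∘ₗ creation q η = (inner ℂ ζ η) • LinearMap.id +
      ((q : ℝ) : ℂ) • (creation q η ∘ₗ annihilation q ζ) := by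
    refine algFock_ext fun l => ?_
    simp [annihilation_tensor_cons]
  exact LinearMap.congr_fun h v

/-- On simple tensors this adjointness is the expansion `qKernel_cons`. -/
theorem inner_creation_left (ζ : H) (v w : AlgFock q H) :
    inner ℂ (creation q ζ v) w = inner ℂ v (annihilation q ζ w) := by
  induction v using tensor_induction with
  | tensor l =>
    induction w using tensor_induction with
    | tensor l' =>
      rw [creation_tensor, inner_tensor, qKernel_cons, annihilation_tensor, inner_sum]
      simp only [inner_smul_right, inner_tensor]
    | add v w hv hw => simp only [map_add, inner_add_right, hv, hw]
    | smul c v hv => simp only [map_smul, inner_smul_right, hv]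
  | add v w hv hw => simp only [map_add, inner_add_left, hv, hw]
  | smul c v hv => simp only [map_smul, inner_smul_left, hv]

theorem inner_annihilation_left (ζ : H) (v w : AlgFock q H) :
    inner ℂ (annihilation q ζ v) w = inner ℂ v (creation q ζ w) := by
  rw [← inner_conj_symm, ← inner_creation_left, inner_conj_symm]

theorem annihilation_add (ζ η : H) (v : AlgFock q H) :
    annihilation q (ζ + η) v = annihilation q ζ v + annihilation q η v := by
  have h : annihilation q (ζ + η) = annihilation q ζ + annihilation q η := by
    refine algFock_ext fun l => ?_
    simp only [LinearMap.add_apply, annihilation_tensor, inner_add_left, mul_add, add_smul,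
      Finset.sum_add_distrib]
  rw [h, LinearMap.add_apply]

theorem annihilation_smul (c : ℂ) (ζ : H) (v : AlgFock q H) :
    annihilation q (c • ζ) v = conj c • annihilation q ζ v := by
  have h : annihilation q (c • ζ) = conj c • annihilation q ζ := by
    refine algFock_ext fun l => ?_
    simp only [LinearMap.smul_apply, annihilation_tensor, inner_smul_left, Finset.smul_sum,
      smul_smul]
    refine Finset.sum_congr rfl fun k _ => ?_
    congr 1
    ring
  rw [h, LinearMap.smul_apply]

/-- Annihilation as a conjugate linear map of its argument. -/
def annihilationₛₗ (v : AlgFock q H) : H →ₛₗ[starRingEnd ℂ] AlgFock q H where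
  toFun ζ := annihilation q ζ v
  map_add' ζ η := annihilation_add ζ η v
  map_smul' c ζ := annihilation_smul c ζ v

theorem annihilation_sum_smul {ι : Type*} (s : Finset ι) (c : ι → ℂ) (f : ι → H)
    (v : AlgFock q H) :
    annihilation q (∑ i ∈ s, c i • f i) v = ∑ i ∈ s, conj (c i) • annihilation q (f i) v := by
  refine (map_sum (annihilationₛₗ v) _ _).trans (Finset.sum_congr rfl fun i _ => ?_)
  exact annihilation_smul _ _ _

theorem inner_gauge_right (T : H →L[ℂ] H) (l : List H) (u : AlgFock q H) :
    inner ℂ u (gauge q T (tensor q l)) = ∑ k : Fin l.length, ((q : ℝ) : ℂ) ^ (k : ℕ) *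
      inner ℂ (annihilation q (T (l.get k)) u) (tensor q (l.eraseIdx k)) := by
  rw [gauge_tensor, inner_sum]
  refine Finset.sum_congr rfl fun k _ => ?_
  rw [inner_smul_right, inner_annihilation_left, creation_tensor]

/-- Both sides expand into a double sum over one position in each tensor: a matrix coefficient of
`T` times the inner product of the tensors with these factors removed, an expression symmetric in
the two tensors. -/
theorem inner_gauge_left {T : H →L[ℂ] H} (hT : ∀ x y, inner ℂ (T x) y = inner ℂ x (T y))
    (v w : AlgFock q H) : inner ℂ (gauge q T v) w = inner ℂ v (gauge q T w) := by
  induction v using tensor_induction with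
  | tensor l =>
    induction w using tensor_induction with
    | tensor l' =>
      rw [← inner_conj_symm, inner_gauge_right, inner_gauge_right, map_sum]
      simp only [annihilation_tensor, sum_inner, Finset.mul_sum, map_sum, inner_smul_left, map_mul,
        inner_conj_symm, map_pow, Complex.conj_ofReal]
      rw [Finset.sum_comm]
      refine Finset.sum_congr rfl fun j _ => Finset.sum_congr rfl fun k _ => ?_
      rw [hT]
      ring
    | add v w hv hw => simp only [map_add, inner_add_right, hv, hw]
    | smul c v hv => simp only [map_smul, inner_smul_right, hv]
  | add v w hv hw => simp only [map_add, inner_add_left, hv, hw]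
  | smul c v hv => simp only [map_smul, inner_smul_left, hv]

/-! ### Norm bounds -/

variable (q H) in
/-- The linear span of the simple tensors of length at most `n`. -/
def degreeLE (n : ℕ) : Submodule ℂ (AlgFock q H) :=
  Submodule.span ℂ (tensor q '' {l | l.length ≤ n})

theorem exists_mem_degreeLE (v : AlgFock q H) : ∃ n, v ∈ degreeLE q H n := by
  have mono : ∀ {m n : ℕ}, m ≤ n → degreeLE q H m ≤ degreeLE q H n := fun h =>
    Submodule.span_mono (Set.image_mono fun l (hl : l.length ≤ _) => hl.trans h)
  induction v using tensor_induction with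
  | tensor l => exact ⟨l.length, Submodule.subset_span ⟨l, le_refl l.length, rfl⟩⟩
  | add v w hv hw =>
    obtain ⟨m, hm⟩ := hv
    obtain ⟨n, hn⟩ := hw
    exact ⟨max m n, add_mem (mono (le_max_left _ _) hm) (mono (le_max_right _ _) hn)⟩
  | smul c v hv => exact hv.imp fun n hn => Submodule.smul_mem _ _ hn

theorem annihilation_of_mem_degreeLE_zero (ζ : H) {v : AlgFock q H} (hv : v ∈ degreeLE q H 0) :
    annihilation q ζ v = 0 := by
  induction hv using Submodule.span_induction with
  | mem v hv =>
    obtain ⟨l, hl, rfl⟩ := hv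
    obtain rfl : l = [] := List.length_eq_zero_iff.1 (Nat.le_zero.1 hl)
    exact annihilation_vacuum ζ
  | zero => exact map_zero _
  | add v w _ _ hv hw => rw [map_add, hv, hw, add_zero]
  | smul c v _ hv => rw [map_smul, hv, smul_zero]

theorem annihilation_mem_degreeLE (ζ : H) {n : ℕ} {v : AlgFock q H}
    (hv : v ∈ degreeLE q H (n + 1)) : annihilation q ζ v ∈ degreeLE q H n := by
  induction hv using Submodule.span_induction with
  | mem v hv =>
    obtain ⟨l, hl, rfl⟩ := hv
    rw [annihilation_tensor]
    refine Submodule.sum_mem _ fun k _ => Submodule.smul_mem _ _ (Submodule.subset_span ⟨_, ?_, rfl⟩)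
    have hk := k.2
    have hl' : l.length ≤ n + 1 := hl
    simp only [Set.mem_ofPred_eq, List.length_eraseIdx_of_lt k.2]
    omega
  | zero => simp
  | add v w _ _ hv hw => rw [map_add]; exact add_mem hv hw
  | smul c v _ hv => rw [map_smul]; exact Submodule.smul_mem _ _ hv

theorem one_sub_abs_pos (q : Set.Ioo (-1 : ℝ) 1) : 0 < 1 - |(q : ℝ)| :=
  sub_pos.2 (abs_lt.2 q.2)

theorem norm_sq_sum_creation {ι : Type*} [Fintype ι] (f : ι → H) (w : ι → AlgFock q H) :
    ‖∑ i, creation q (f i) (w i)‖ ^ 2 =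
      (∑ i, ∑ j, inner ℂ (f i) (f j) * inner ℂ (w i) (w j)).re +
      q * (∑ i, ∑ j, inner ℂ (annihilation q (f j) (w i)) (annihilation q (f i) (w j))).re := by
  have h : inner ℂ (∑ i, creation q (f i) (w i)) (∑ i, creation q (f i) (w i)) =
      (∑ i, ∑ j, inner ℂ (f i) (f j) * inner ℂ (w i) (w j)) +
      ((q : ℝ) : ℂ) *
        (∑ i, ∑ j, inner ℂ (annihilation q (f j) (w i)) (annihilation q (f i) (w j))) := by
    simp only [sum_inner, inner_sum, inner_creation_left, annihilation_creation, inner_add_right,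
      inner_smul_right, Finset.sum_add_distrib, Finset.mul_sum]
    simp only [← inner_annihilation_left]
    refine congrArg₂ _ Finset.sum_comm Finset.sum_comm
  rw [@norm_sq_eq_re_inner ℂ, h, RCLike.re_eq_complex_re, Complex.add_re, Complex.re_ofReal_mul]

/-- A family of annihilation operators is a bounded column operator, provided the Gram matrix of the
vectors is bounded. -/
theorem sum_norm_annihilation_sq_le {ι : Type*} [Fintype ι] (f : ι → H) {t : ℝ} (ht : 0 ≤ t)
    (hf : ∀ w : ι → AlgFock q H,
      (∑ i, ∑ j, inner ℂ (f i) (f j) * inner ℂ (w i) (w j)).re ≤ t * ∑ i, ‖w i‖ ^ 2)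
    (u : AlgFock q H) :
    ∑ i, ‖annihilation q (f i) u‖ ^ 2 ≤ t / (1 - |(q : ℝ)|) * ‖u‖ ^ 2 := by
  have hq := one_sub_abs_pos q
  set C := t / (1 - |(q : ℝ)|) with hC
  have hC0 : 0 ≤ C := div_nonneg ht hq.le
  -- `C` is chosen as the fixed point of `C ↦ t + |q| C`, so that the induction on the degree
  -- reproduces the same constant.
  have hCt : t + |(q : ℝ)| * C = C := by rw [hC]; field_simp; ring
  obtain ⟨n, hn⟩ := exists_mem_degreeLE u
  induction n generalizing u with
  | zero =>
    simp only [annihilation_of_mem_degreeLE_zero _ hn, norm_zero]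
    simp
    positivity
  | succ n ih =>
    set w := fun i => annihilation q (f i) u with hw
    set S := ∑ i, ‖w i‖ ^ 2 with hS
    set U := ∑ i, creation q (f i) (w i) with hU
    have hS0 : 0 ≤ S := Finset.sum_nonneg fun i _ => sq_nonneg _
    -- By adjointness `S = ⟨U, u⟩`. The estimate `‖U‖² ≤ C S` proved next then yields `S² ≤ C ‖u‖²
    -- S`, from which `S` is cancelled.
    have h1 : S ≤ ‖U‖ * ‖u‖ := by
      have : inner ℂ U u = ((S : ℝ) : ℂ) := by
        simp only [hU, hS, sum_inner, inner_creation_left, Complex.ofReal_sum]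
        refine Finset.sum_congr rfl fun i _ => ?_
        rw [Complex.ofReal_pow]
        exact inner_self_eq_norm_sq_to_K (𝕜 := ℂ) (w i)
      have h2 := norm_inner_le_norm (𝕜 := ℂ) U u
      rwa [this, Complex.norm_real, Real.norm_of_nonneg hS0] at h2
    have h2 : ‖U‖ ^ 2 ≤ C * S := by
      rw [hU, norm_sq_sum_creation]
      have h3 := hf w
      -- The commutation relation leaves a term with two annihilations. It is at most `|q|` times
      -- the sum of all `‖a(f j) (w i)‖²`, which the induction hypothesis bounds because each `w i`
      -- has lower degree.
      have h4 : q * (∑ i, ∑ j, inner ℂ (annihilation q (f j) (w i))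
          (annihilation q (f i) (w j))).re ≤ |(q : ℝ)| * (C * S) := by
        refine (le_abs_self _).trans ?_
        rw [abs_mul]
        refine mul_le_mul_of_nonneg_left ?_ (abs_nonneg _)
        refine (Complex.abs_re_le_norm _).trans ?_
        refine (norm_sum_le _ _).trans ?_
        have h5 : ∀ i j, ‖(inner ℂ (annihilation q (f j) (w i)) (annihilation q (f i) (w j)) : ℂ)‖
            ≤ (‖annihilation q (f j) (w i)‖ ^ 2 + ‖annihilation q (f i) (w j)‖ ^ 2) / 2 := by
          intro i j
          refine (norm_inner_le_norm _ _).trans ?_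
          nlinarith [sq_nonneg (‖annihilation q (f j) (w i)‖ - ‖annihilation q (f i) (w j)‖)]
        calc ∑ i, ‖∑ j, (inner ℂ (annihilation q (f j) (w i)) (annihilation q (f i) (w j)) : ℂ)‖
            ≤ ∑ i, ∑ j, (‖annihilation q (f j) (w i)‖ ^ 2
                + ‖annihilation q (f i) (w j)‖ ^ 2) / 2 :=
              Finset.sum_le_sum fun i _ => (norm_sum_le _ _).trans
                (Finset.sum_le_sum fun j _ => h5 i j)
          _ = ∑ i, ∑ j, ‖annihilation q (f j) (w i)‖ ^ 2 := by
              simp only [add_div, Finset.sum_add_distrib]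
              rw [Finset.sum_comm (f := fun i j => ‖annihilation q (f i) (w j)‖ ^ 2 / 2),
                ← Finset.sum_add_distrib]
              refine Finset.sum_congr rfl fun i _ => ?_
              rw [← Finset.sum_add_distrib]
              exact Finset.sum_congr rfl fun j _ => add_halves _
          _ ≤ ∑ i, C * ‖w i‖ ^ 2 :=
              Finset.sum_le_sum fun i _ => ih _ (annihilation_mem_degreeLE _ hn)
          _ = C * S := by rw [Finset.mul_sum]
      nlinarith
    have h3 : S * S ≤ C * ‖u‖ ^ 2 * S := by nlinarith [norm_nonneg U, norm_nonneg u]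
    rcases hS0.eq_or_lt with h | h
    · rw [← h]; positivity
    · exact le_of_mul_le_mul_right h3 h

theorem norm_annihilation_sq_le (ζ : H) (u : AlgFock q H) :
    ‖annihilation q ζ u‖ ^ 2 ≤ ‖ζ‖ ^ 2 / (1 - |(q : ℝ)|) * ‖u‖ ^ 2 := by
  have h := sum_norm_annihilation_sq_le (q := q) (fun _ : Unit => ζ) (sq_nonneg ‖ζ‖)
    (fun w => by
      simp only [Finset.univ_unique, Finset.sum_singleton, inner_self_eq_norm_sq_to_K]
      norm_cast) u
  simpa using h

theorem sum_norm_annihilation_sq_le_of_orthogonal {ι : Type*} [Fintype ι] (f : ι → H) {t : ℝ}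
    (hf : ∀ i j, i ≠ j → inner ℂ (f i) (f j) = 0) (ht : 0 ≤ t) (hft : ∀ i, ‖f i‖ ^ 2 ≤ t)
    (u : AlgFock q H) :
    ∑ i, ‖annihilation q (f i) u‖ ^ 2 ≤ t / (1 - |(q : ℝ)|) * ‖u‖ ^ 2 := by
  refine sum_norm_annihilation_sq_le f ht (fun w => ?_) u
  have h : ∀ i, ∑ j, inner ℂ (f i) (f j) * inner ℂ (w i) (w j)
      = ((‖f i‖ ^ 2 * ‖w i‖ ^ 2 : ℝ) : ℂ) := by
    intro i
    rw [Finset.sum_eq_single i (fun j _ hj => by rw [hf i j hj.symm, zero_mul]) (by simp),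
      inner_self_eq_norm_sq_to_K, inner_self_eq_norm_sq_to_K]
    push_cast
    rfl
  simp only [h, ← Complex.ofReal_sum, Complex.ofReal_re, Finset.mul_sum]
  exact Finset.sum_le_sum fun i _ => mul_le_mul_of_nonneg_right (hft i) (sq_nonneg _)

end AlgFock

/-! ### Boundedness of the gauge operators and reversal of tensors -/

section Gauge

open scoped ComplexOrder

variable {q : Set.Ioo (-1 : ℝ) 1} {H : Type*} [NormedAddCommGroup H] [InnerProductSpace ℂ H]

/-- Amplification: a bounded operator acts boundedly on the Gram matrix of any finite family. -/
theorem re_sum_inner_map_le {ι F : Type*} [Fintype ι] [SeminormedAddCommGroup F]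
    [InnerProductSpace ℂ F] (T : H →L[ℂ] H) (e : ι → H) (w : ι → F) :
    (∑ i, ∑ j, inner ℂ (T (e i)) (T (e j)) * inner ℂ (w i) (w j)).re ≤
      ‖T‖ ^ 2 * (∑ i, ∑ j, inner ℂ (e i) (e j) * inner ℂ (w i) (w j)).re := by
  classical
  -- Positivity of this matrix is `‖T y‖ ≤ ‖T‖ ‖y‖` for `y = ∑ x i • e i`. Its Schur product with
  -- the Gram matrix of `w`, tested against the constant vector `1`, is the claim.
  have hM : (Matrix.of fun i j => ((‖T‖ ^ 2 : ℝ) : ℂ) * inner ℂ (e i) (e j) -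
      inner ℂ (T (e i)) (T (e j))).PosSemidef := by
    refine Matrix.PosSemidef.of_dotProduct_mulVec_nonneg ?_ fun x => ?_
    · ext i j
      simp [mul_comm]
    · have h : dotProduct (star x) ((Matrix.of fun i j => ((‖T‖ ^ 2 : ℝ) : ℂ) * inner ℂ (e i) (e j) -
          inner ℂ (T (e i)) (T (e j))).mulVec x) =
          ((‖T‖ ^ 2 * ‖∑ i, x i • e i‖ ^ 2 - ‖T (∑ i, x i • e i)‖ ^ 2 : ℝ) : ℂ) := by
        rw [Complex.ofReal_sub, Complex.ofReal_mul, Complex.ofReal_pow ‖T _‖,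
          Complex.ofReal_pow ‖∑ i, x i • e i‖]
        have h1 : ((‖∑ i, x i • e i‖ : ℝ) : ℂ) ^ 2 = _ :=
          (inner_self_eq_norm_sq_to_K (𝕜 := ℂ) (∑ i, x i • e i)).symm
        have h2 : ((‖T (∑ i, x i • e i)‖ : ℝ) : ℂ) ^ 2 = _ :=
          (inner_self_eq_norm_sq_to_K (𝕜 := ℂ) (T (∑ i, x i • e i))).symm
        rw [h1, h2]
        simp only [map_sum, map_smul, sum_inner, inner_sum, inner_smul_left, inner_smul_right,
          dotProduct, Matrix.mulVec, Finset.mul_sum, Matrix.of_apply, ← Finset.sum_sub_distrib]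
        rw [Finset.sum_comm]
        refine Finset.sum_congr rfl fun i _ => Finset.sum_congr rfl fun j _ => ?_
        simp only [Pi.star_apply, RCLike.star_def]
        ring
      rw [h]
      refine Complex.zero_le_real.2 (sub_nonneg.2 ?_)
      rw [← mul_pow]
      exact pow_le_pow_left₀ (norm_nonneg _) (T.le_opNorm _) 2
  -- `F` is only seminormed, so positivity of the Gram matrix is taken from the completion.
  have hG : (Matrix.of fun i j => (inner ℂ (w i) (w j) : ℂ)).PosSemidef := by
    convert posSemidef_inner (fun i => (w i : UniformSpace.Completion F)) using 1
    ext i j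
    simp
  have h := (hM.hadamard hG).dotProduct_mulVec_nonneg 1
  have h' := (RCLike.nonneg_iff.1 h).1
  simp only [dotProduct, Matrix.mulVec, star_one, Pi.one_apply, one_mul, mul_one,
    Matrix.hadamard_apply, Matrix.of_apply, sub_mul, Finset.sum_sub_distrib, mul_assoc,
    ← Finset.mul_sum, map_sub, RCLike.re_eq_complex_re, Complex.re_ofReal_mul] at h'
  linarith

theorem exists_finite_mem_span_tensor (v : AlgFock q H) :
    ∃ E : Set H, E.Finite ∧ v ∈ Submodule.span ℂ (tensor q '' {l | ∀ x ∈ l, x ∈ E}) := by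
  have mono : ∀ {D E : Set H}, D ⊆ E → Submodule.span ℂ (tensor q '' {l | ∀ x ∈ l, x ∈ D}) ≤
      Submodule.span ℂ (tensor q '' {l | ∀ x ∈ l, x ∈ E}) := fun h =>
    Submodule.span_mono (Set.image_mono fun l hl x hx => h (hl x hx))
  induction v using tensor_induction with
  | tensor l => exact ⟨{x | x ∈ l}, l.finite_toSet, Submodule.subset_span ⟨l, fun x hx => hx, rfl⟩⟩
  | add v w hv hw =>
    obtain ⟨D, hD, hv⟩ := hv
    obtain ⟨E, hE, hw⟩ := hw
    exact ⟨D ∪ E, hD.union hE, add_mem (mono Set.subset_union_left hv)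
      (mono Set.subset_union_right hw)⟩
  | smul c v hv => exact hv.imp fun n hn => ⟨hn.1, Submodule.smul_mem _ _ hn.2⟩

/-- Expanding each factor of `v` in the `e i` makes `T` act only on fixed vectors. The gauge form
becomes a pairing of two columns of annihilation operators, to which the column bound applies. -/
theorem inner_gauge_eq_sum {ι : Type*} [Fintype ι] (T : H →L[ℂ] H) (e : ι → H) {E : Set H}
    (hE : ∀ x ∈ E, x = ∑ i, inner ℂ (e i) x • e i) {v : AlgFock q H}
    (hv : v ∈ Submodule.span ℂ (tensor q '' {l | ∀ x ∈ l, x ∈ E})) (u : AlgFock q H) :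
    inner ℂ u (gauge q T v) =
      ∑ i, inner ℂ (annihilation q (T (e i)) u) (annihilation q (e i) v) := by
  induction hv using Submodule.span_induction with
  | mem v hv =>
    obtain ⟨l, hl, rfl⟩ := hv
    rw [inner_gauge_right]
    simp only [annihilation_tensor (e _), inner_sum, inner_smul_right]
    rw [Finset.sum_comm]
    refine Finset.sum_congr rfl fun k _ => ?_
    have hk : T (l.get k) = ∑ i, inner ℂ (e i) (l.get k) • T (e i) := by
      conv_lhs => rw [hE _ (hl _ (l.get_mem k))]
      simp only [map_sum, map_smul]
    rw [hk, annihilation_sum_smul, sum_inner, Finset.mul_sum]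
    refine Finset.sum_congr rfl fun i _ => ?_
    rw [inner_smul_left, Complex.conj_conj, mul_assoc]
  | zero => simp
  | add v w _ _ hv hw => simp only [map_add, inner_add_right, hv, hw, Finset.sum_add_distrib]
  | smul c v _ hv => simp only [map_smul, inner_smul_right, hv, Finset.mul_sum]

/-- Only finitely many vectors occur in `v`, so an orthonormal basis of their span is available.
Cauchy–Schwarz between the columns `a(T e i) u` and `a(e i) v` gives the product of the bounds `‖T‖
/ √(1 - |q|)` and `1 / √(1 - |q|)`. -/
theorem norm_inner_gauge_le (T : H →L[ℂ] H) (u v : AlgFock q H) :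
    ‖(inner ℂ u (gauge q T v) : ℂ)‖ ≤ ‖T‖ / (1 - |(q : ℝ)|) * ‖u‖ * ‖v‖ := by
  have hq := one_sub_abs_pos q
  obtain ⟨E, hE, hv⟩ := exists_finite_mem_span_tensor v
  have : FiniteDimensional ℂ (Submodule.span ℂ E) := FiniteDimensional.span_of_finite ℂ hE
  let b := stdOrthonormalBasis ℂ (Submodule.span ℂ E)
  let e : Fin (Module.finrank ℂ (Submodule.span ℂ E)) → H := fun i => b i
  have he : Orthonormal ℂ e := b.orthonormal.comp_linearIsometry (Submodule.subtypeₗᵢ _)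
  have hEe : ∀ x ∈ E, x = ∑ i, inner ℂ (e i) x • e i := by
    intro x hx
    have h := congrArg (Submodule.subtype _) (b.sum_repr' ⟨x, Submodule.subset_span hx⟩)
    simpa [e] using h.symm
  rw [inner_gauge_eq_sum T e hEe hv]
  have h1 : ∑ i, ‖annihilation q (T (e i)) u‖ ^ 2 ≤ ‖T‖ ^ 2 / (1 - |(q : ℝ)|) * ‖u‖ ^ 2 := by
    refine sum_norm_annihilation_sq_le _ (sq_nonneg _) (fun w => ?_) u
    refine (re_sum_inner_map_le T e w).trans (mul_le_mul_of_nonneg_left ?_ (sq_nonneg _))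
    simp only [orthonormal_iff_ite.1 he, ite_mul, one_mul, zero_mul, Finset.sum_ite_eq,
      Finset.mem_univ, if_true, Complex.re_sum]
    exact Finset.sum_le_sum fun i _ => (inner_self_eq_norm_sq (𝕜 := ℂ) (w i)).le
  have h2 : ∑ i, ‖annihilation q (e i) v‖ ^ 2 ≤ 1 / (1 - |(q : ℝ)|) * ‖v‖ ^ 2 :=
    sum_norm_annihilation_sq_le_of_orthogonal e (fun i j hij => he.2 hij) zero_le_one
      (fun i => by rw [he.1, one_pow]) v
  refine (norm_sum_le _ _).trans ((Finset.sum_le_sum fun i _ => norm_inner_le_norm _ _).trans ?_)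
  refine (Real.sum_mul_le_sqrt_mul_sqrt _ _ _).trans ?_
  refine (mul_le_mul (Real.sqrt_le_sqrt h1) (Real.sqrt_le_sqrt h2) (Real.sqrt_nonneg _)
    (Real.sqrt_nonneg _)).trans_eq ?_
  rw [← Real.sqrt_mul (by positivity), ← Real.sqrt_sq (by positivity :
    0 ≤ ‖T‖ / (1 - |(q : ℝ)|) * ‖u‖ * ‖v‖)]
  congr 1
  ring

theorem norm_gauge_le (T : H →L[ℂ] H) (v : AlgFock q H) :
    ‖gauge q T v‖ ≤ ‖T‖ / (1 - |(q : ℝ)|) * ‖v‖ := by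
  have h := norm_inner_gauge_le T (gauge q T v) v
  rw [inner_self_eq_norm_sq_to_K, norm_pow, RCLike.norm_ofReal, abs_norm] at h
  have hq := one_sub_abs_pos q
  rcases (norm_nonneg (gauge q T v)).eq_or_lt with h0 | h0
  · rw [← h0]; positivity
  · refine le_of_mul_le_mul_right ?_ h0
    linarith

theorem norm_annihilation_le (ζ : H) (v : AlgFock q H) :
    ‖annihilation q ζ v‖ ≤ ‖ζ‖ / √(1 - |(q : ℝ)|) * ‖v‖ := by
  have hq := one_sub_abs_pos q
  refine le_of_sq_le_sq ?_ (by positivity)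
  rw [mul_pow, div_pow, Real.sq_sqrt hq.le]
  exact norm_annihilation_sq_le ζ v

theorem norm_creation_le (ζ : H) (v : AlgFock q H) :
    ‖creation q ζ v‖ ≤ ‖ζ‖ / √(1 - |(q : ℝ)|) * ‖v‖ := by
  have hq := one_sub_abs_pos q
  have h : inner ℂ (creation q ζ v) (creation q ζ v) =
    inner ℂ v (annihilation q ζ (creation q ζ v)) := inner_creation_left _ _ _
  have h2 := norm_inner_le_norm (𝕜 := ℂ) v (annihilation q ζ (creation q ζ v))
  rw [← h, inner_self_eq_norm_sq_to_K, norm_pow, RCLike.norm_ofReal, abs_norm] at h2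
  have h3 := norm_annihilation_le ζ (creation q ζ v)
  rcases (norm_nonneg (creation q ζ v)).eq_or_lt with h0 | h0
  · rw [← h0]; positivity
  · refine le_of_mul_le_mul_right ?_ h0
    nlinarith [norm_nonneg v]

/-- Reversal of the factors of simple tensors. -/
def reversal (q : Set.Ioo (-1 : ℝ) 1) (H : Type*) [NormedAddCommGroup H] [InnerProductSpace ℂ H] :
    AlgFock q H →ₗ[ℂ] AlgFock q H :=
  extendTensor q fun l => tensor q l.reverse

@[simp] theorem reversal_tensor (l : List H) :
    reversal q H (tensor q l) = tensor q l.reverse := extendTensor_tensor _ _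

@[simp] theorem reversal_reversal (v : AlgFock q H) : reversal q H (reversal q H v) = v := by
  have h : reversal q H ∘ₗ reversal q H = LinearMap.id := algFock_ext fun l => by simp
  exact LinearMap.congr_fun h v

theorem inner_reversal (v w : AlgFock q H) :
    inner ℂ (reversal q H v) (reversal q H w) = inner ℂ v w := by
  induction v using tensor_induction with
  | tensor l =>
    induction w using tensor_induction with
    | tensor l' => simp only [reversal_tensor, inner_tensor, qKernel_reverse]
    | add v w hv hw => simp only [map_add, inner_add_right, hv, hw]
    | smul c v hv => simp only [map_smul, inner_smul_right, hv]
  | add v w hv hw => simp only [map_add, inner_add_left, hv, hw]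
  | smul c v hv => simp only [map_smul, inner_smul_left, hv]

theorem norm_reversal (v : AlgFock q H) : ‖reversal q H v‖ = ‖v‖ := by
  rw [@norm_eq_sqrt_re_inner ℂ, inner_reversal, ← @norm_eq_sqrt_re_inner ℂ]

end Gauge

/-! ### Bounded operators on the Fock space -/

section Fock

variable {q : Set.Ioo (-1 : ℝ) 1} {H : Type*} [NormedAddCommGroup H] [InnerProductSpace ℂ H]

/-- A simple tensor as a vector of the Fock space. -/
def fockTensor (q : Set.Ioo (-1 : ℝ) 1) {H : Type*} [NormedAddCommGroup H] [InnerProductSpace ℂ H]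
    (l : List H) : Fock q H := (tensor q l : AlgFock q H)

/-- The continuous extension to the Fock space of a bounded operator on the algebraic Fock space. -/
def boundedLift (B : AlgFock q H →ₗ[ℂ] AlgFock q H) (C : ℝ) (h : ∀ v, ‖B v‖ ≤ C * ‖v‖) :
    Fock q H →L[ℂ] Fock q H :=
  (B.mkContinuous C h).completion

@[simp] theorem boundedLift_coe (B : AlgFock q H →ₗ[ℂ] AlgFock q H) (C : ℝ)
    (h : ∀ v, ‖B v‖ ≤ C * ‖v‖) (v : AlgFock q H) :
    boundedLift B C h (v : Fock q H) = ((B v : AlgFock q H) : Fock q H) :=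
  ContinuousLinearMap.completion_apply_coe _ _

theorem fock_ext_coe {E : Type*} [TopologicalSpace E] [AddCommMonoid E] [Module ℂ E] [T2Space E]
    {A B : Fock q H →L[ℂ] E} (h : ∀ v : AlgFock q H, A (v : Fock q H) = B (v : Fock q H)) :
    A = B := by
  refine ContinuousLinearMap.ext fun x => ?_
  induction x using UniformSpace.Completion.induction_on with
  | hp => exact isClosed_eq A.continuous B.continuous
  | ih v => exact h v

theorem norm_boundedLift_le (B : AlgFock q H →ₗ[ℂ] AlgFock q H) {C : ℝ} (hC : 0 ≤ C)
    (h : ∀ v, ‖B v‖ ≤ C * ‖v‖) : ‖boundedLift B C h‖ ≤ C := by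
  refine ContinuousLinearMap.opNorm_le_bound _ hC fun x => ?_
  induction x using UniformSpace.Completion.induction_on with
  | hp => exact isClosed_le (by fun_prop) (by fun_prop)
  | ih v => simpa using h v

theorem star_boundedLift {B B' : AlgFock q H →ₗ[ℂ] AlgFock q H} {C C' : ℝ}
    (h : ∀ v, ‖B v‖ ≤ C * ‖v‖) (h' : ∀ v, ‖B' v‖ ≤ C' * ‖v‖)
    (hBB' : ∀ v w, inner ℂ (B v) w = inner ℂ v (B' w)) :
    star (boundedLift B C h) = boundedLift B' C' h' := by
  refine Eq.symm (ContinuousLinearMap.eq_adjoint_iff _ _ |>.2 fun x y => ?_)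
  induction x, y using UniformSpace.Completion.induction_on₂ with
  | hp => exact isClosed_eq (by fun_prop) (by fun_prop)
  | ih v w =>
    simp only [boundedLift_coe, UniformSpace.Completion.inner_coe]
    rw [← inner_conj_symm, ← hBB', inner_conj_symm]

/-- The bounded creation operator. -/
def cre (q : Set.Ioo (-1 : ℝ) 1) {H : Type*} [NormedAddCommGroup H] [InnerProductSpace ℂ H]
    (ζ : H) : Fock q H →L[ℂ] Fock q H := boundedLift (creation q ζ) _ (norm_creation_le ζ)

/-- The bounded annihilation operator. -/
def ann (q : Set.Ioo (-1 : ℝ) 1) {H : Type*} [NormedAddCommGroup H] [InnerProductSpace ℂ H]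
    (ζ : H) : Fock q H →L[ℂ] Fock q H := boundedLift (annihilation q ζ) _ (norm_annihilation_le ζ)

/-- The bounded gauge operator. -/
def gau (q : Set.Ioo (-1 : ℝ) 1) {H : Type*} [NormedAddCommGroup H] [InnerProductSpace ℂ H]
    (T : H →L[ℂ] H) : Fock q H →L[ℂ] Fock q H := boundedLift (gauge q T) _ (norm_gauge_le T)

/-- The unitary reversal of tensors. -/
def rev (q : Set.Ioo (-1 : ℝ) 1) (H : Type*) [NormedAddCommGroup H] [InnerProductSpace ℂ H] :
    Fock q H →L[ℂ] Fock q H :=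
  boundedLift (reversal q H) 1 fun v => by rw [norm_reversal, one_mul]

@[simp] theorem cre_coe (ζ : H) (v : AlgFock q H) : cre q ζ v = (creation q ζ v : AlgFock q H) :=
  boundedLift_coe _ _ _ _

@[simp] theorem ann_coe (ζ : H) (v : AlgFock q H) :
    ann q ζ v = (annihilation q ζ v : AlgFock q H) := boundedLift_coe _ _ _ _

@[simp] theorem gau_coe (T : H →L[ℂ] H) (v : AlgFock q H) :
    gau q T v = (gauge q T v : AlgFock q H) := boundedLift_coe _ _ _ _

@[simp] theorem rev_coe (v : AlgFock q H) :
    rev q H v = (reversal q H v : AlgFock q H) := boundedLift_coe _ _ _ _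

theorem norm_cre_le (ζ : H) : ‖cre q ζ‖ ≤ ‖ζ‖ / √(1 - |(q : ℝ)|) :=
  norm_boundedLift_le _ (by positivity) _

theorem norm_ann_le (ζ : H) : ‖ann q ζ‖ ≤ ‖ζ‖ / √(1 - |(q : ℝ)|) :=
  norm_boundedLift_le _ (by positivity) _

theorem norm_gau_le (T : H →L[ℂ] H) : ‖gau q T‖ ≤ ‖T‖ / (1 - |(q : ℝ)|) :=
  norm_boundedLift_le _ (div_nonneg (norm_nonneg _) (one_sub_abs_pos q).le) _

@[simp] theorem star_cre (ζ : H) : star (cre q ζ) = ann q ζ :=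
  star_boundedLift _ _ (inner_creation_left ζ)

@[simp] theorem star_ann (ζ : H) : star (ann q ζ) = cre q ζ := by
  rw [← star_cre, star_star]

theorem star_gau {T : H →L[ℂ] H} (hT : ∀ x y, inner ℂ (T x) y = inner ℂ x (T y)) :
    star (gau q T) = gau q T :=
  star_boundedLift _ _ (inner_gauge_left hT)

theorem star_rev : star (rev q H) = rev q H :=
  star_boundedLift _ _ fun v w => by rw [← inner_reversal, reversal_reversal]

@[simp] theorem rev_mul_rev : rev q H * rev q H = 1 := fock_ext_coe fun v => by simp

@[simp] theorem rev_rev (x : Fock q H) : rev q H (rev q H x) = x :=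
  DFunLike.congr_fun rev_mul_rev x

theorem norm_rev (x : Fock q H) : ‖rev q H x‖ = ‖x‖ := by
  induction x using UniformSpace.Completion.induction_on with
  | hp => exact isClosed_eq (by fun_prop) (by fun_prop)
  | ih v => simp [norm_reversal]

theorem ann_add (ζ η : H) : ann q (ζ + η) = ann q ζ + ann q η :=
  fock_ext_coe fun v => by simp [annihilation_add, UniformSpace.Completion.coe_add]

theorem ann_smul (c : ℂ) (ζ : H) : ann q (c • ζ) = conj c • ann q ζ :=
  fock_ext_coe fun v => by simp [annihilation_smul, UniformSpace.Completion.coe_smul]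

theorem cre_add (ζ η : H) : cre q (ζ + η) = cre q ζ + cre q η := by
  rw [← star_ann, ann_add, star_add, star_ann, star_ann]

theorem cre_smul (c : ℂ) (ζ : H) : cre q (c • ζ) = c • cre q ζ := by
  rw [← star_ann, ann_smul, star_smul, star_ann, RCLike.star_def, Complex.conj_conj]

theorem ann_mul_cre (ζ η : H) :
    ann q ζ * cre q η = inner ℂ ζ η • 1 + ((q : ℝ) : ℂ) • (cre q η * ann q ζ) :=
  fock_ext_coe fun v => by
    simp [annihilation_creation, UniformSpace.Completion.coe_add, UniformSpace.Completion.coe_smul]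

/-- The creation operators, as a bounded linear map of the created vector. -/
def creL (q : Set.Ioo (-1 : ℝ) 1) (H : Type*) [NormedAddCommGroup H] [InnerProductSpace ℂ H] :
    H →L[ℂ] Fock q H →L[ℂ] Fock q H :=
  LinearMap.mkContinuous ⟨⟨cre q, cre_add⟩, cre_smul⟩ (√(1 - |(q : ℝ)|))⁻¹ fun ζ =>
    (norm_cre_le ζ).trans_eq (by rw [div_eq_inv_mul])

@[simp] theorem cre_fockTensor (ζ : H) (l : List H) :
    cre q ζ (fockTensor q l) = fockTensor q (ζ :: l) := by
  simp [fockTensor]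

@[simp] theorem rev_fockTensor (l : List H) :
    rev q H (fockTensor q l) = fockTensor q l.reverse := by
  simp [fockTensor]

@[simp] theorem ann_vacuum (ζ : H) : ann q ζ (fockTensor q []) = 0 := by
  simp [fockTensor, UniformSpace.Completion.coe_zero]

@[simp] theorem gau_vacuum (T : H →L[ℂ] H) : gau q T (fockTensor q []) = 0 := by
  simp [fockTensor, UniformSpace.Completion.coe_zero]

theorem ann_fockTensor_cons (ζ x : H) (l : List H) :
    ann q ζ (fockTensor q (x :: l)) = (inner ℂ ζ x) • fockTensor q l +
      ((q : ℝ) : ℂ) • cre q x (ann q ζ (fockTensor q l)) := by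
  rw [← cre_fockTensor, ← mul_apply_eq_comp, ann_mul_cre]
  simp

theorem coe_algFock_sum {ι : Type*} (s : Finset ι) (v : ι → AlgFock q H) :
    ((∑ i ∈ s, v i : AlgFock q H) : Fock q H) = ∑ i ∈ s, (v i : Fock q H) :=
  map_sum (UniformSpace.Completion.toComplₗᵢ (𝕜 := ℂ) (E := AlgFock q H)) v s

theorem ann_fockTensor (ζ : H) (l : List H) :
    ann q ζ (fockTensor q l) = ∑ k : Fin l.length,
      (((q : ℝ) : ℂ) ^ (k : ℕ) * inner ℂ ζ (l.get k)) • fockTensor q (l.eraseIdx k) := by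
  simp only [fockTensor, ann_coe, annihilation_tensor]
  rw [coe_algFock_sum]
  simp only [UniformSpace.Completion.coe_smul]

theorem gau_fockTensor (T : H →L[ℂ] H) (l : List H) :
    gau q T (fockTensor q l) = ∑ k : Fin l.length,
      (((q : ℝ) : ℂ) ^ (k : ℕ)) • fockTensor q (T (l.get k) :: l.eraseIdx k) := by
  simp only [fockTensor, gau_coe, gauge_tensor]
  rw [coe_algFock_sum]
  simp only [UniformSpace.Completion.coe_smul]

theorem gau_fockTensor_cons (T : H →L[ℂ] H) (x : H) (l : List H) :
    gau q T (fockTensor q (x :: l)) = fockTensor q (T x :: l) +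
      ((q : ℝ) : ℂ) • ∑ k : Fin l.length,
        (((q : ℝ) : ℂ) ^ (k : ℕ)) • fockTensor q (T (l.get k) :: x :: l.eraseIdx k) := by
  rw [gau_fockTensor]
  refine (Fin.sum_univ_succ (n := l.length) _).trans ?_
  simp only [Finset.smul_sum, smul_smul, Fin.val_zero, Fin.val_succ, pow_zero, one_smul]
  congr 1
  refine Finset.sum_congr rfl fun k _ => ?_
  rw [pow_succ']
  rfl

theorem closure_span_range_fockTensor :
    (Submodule.span ℂ (Set.range (fockTensor q (H := H)))).topologicalClosure = ⊤ := by
  refine Submodule.dense_iff_topologicalClosure_eq_top.1 ?_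
  refine UniformSpace.Completion.denseRange_coe.mono ?_
  rintro _ ⟨v, rfl⟩
  induction v using tensor_induction with
  | tensor l => exact Submodule.subset_span ⟨l, rfl⟩
  | add v w hv hw => rw [UniformSpace.Completion.coe_add]; exact add_mem hv hw
  | smul c v hv => rw [UniformSpace.Completion.coe_smul]; exact Submodule.smul_mem _ _ hv

/-- Simple tensors with factors in a total set are total. -/
theorem closure_span_fockTensor {L : Set H} (hL : (Submodule.span ℂ L).topologicalClosure = ⊤) :
    (Submodule.span ℂ (fockTensor q '' {l | ∀ x ∈ l, x ∈ L})).topologicalClosure = ⊤ := by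
  set K := (Submodule.span ℂ (fockTensor q '' {l | ∀ x ∈ l, x ∈ L})).topologicalClosure with hK
  have hKc : IsClosed (K : Set (Fock q H)) := Submodule.isClosed_topologicalClosure _
  have h1 : ∀ ζ ∈ L, ∀ ξ ∈ K, cre q ζ ξ ∈ K := by
    intro ζ hζ
    have : K ≤ K.comap (cre q ζ : Fock q H →ₗ[ℂ] Fock q H) := by
      refine Submodule.topologicalClosure_minimal _ (Submodule.span_le.2 ?_)
        (hKc.preimage (cre q ζ).continuous)
      rintro _ ⟨l, hl, rfl⟩
      refine Submodule.le_topologicalClosure _ (Submodule.subset_span ⟨ζ :: l, ?_, ?_⟩)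
      · simpa [hζ] using hl
      · simp
    exact this
  -- Creation depends continuously and linearly on the created vector, so invariance of `K` extends
  -- from `L` to its closed span.
  have h2 : ∀ ζ, ∀ ξ ∈ K, cre q ζ ξ ∈ K := by
    intro ζ ξ hξ
    have : (⊤ : Submodule ℂ H) ≤ K.comap ((creL q H).flip ξ : H →ₗ[ℂ] Fock q H) := by
      rw [← hL]
      refine Submodule.topologicalClosure_minimal _ (Submodule.span_le.2 ?_)
        (hKc.preimage ((creL q H).flip ξ).continuous)
      intro ζ hζ
      exact h1 ζ hζ ξ hξ
    exact this (Submodule.mem_top (x := ζ))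
  rw [eq_top_iff, ← closure_span_range_fockTensor]
  refine Submodule.topologicalClosure_minimal _ (Submodule.span_le.2 ?_) hKc
  rintro _ ⟨l, rfl⟩
  induction l with
  | nil => exact Submodule.le_topologicalClosure _ (Submodule.subset_span ⟨[], by simp, rfl⟩)
  | cons x l ih => rw [← cre_fockTensor]; exact h2 x _ ih

end Fock

/-! ### Criteria for infiniteness and for the absence of traces -/

section VonNeumannGeneral

open Filter Topology

variable {F : Type*} [NormedAddCommGroup F] [InnerProductSpace ℂ F] [CompleteSpace F]

/-- With self-adjoint generators the adjoint conditions in the centralizers are automatic, so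
membership is the plain double commutant condition. -/
theorem mem_vonNeumannGenerated {S : Set (F →L[ℂ] F)} (hS : ∀ s ∈ S, star s = s)
    {A : F →L[ℂ] F} :
    A ∈ vonNeumannGenerated S ↔ ∀ B, (∀ s ∈ S, s * B = B * s) → B * A = A * B := by
  have h : ∀ B, B ∈ StarSubalgebra.centralizer ℂ S ↔ ∀ s ∈ S, s * B = B * s := by
    intro B
    rw [StarSubalgebra.mem_centralizer_iff]
    refine forall₂_congr fun s hs => ?_
    rw [hS s hs, and_self]
  change A ∈ StarSubalgebra.centralizer ℂ
    (StarSubalgebra.centralizer ℂ S : Set (F →L[ℂ] F)) ↔ _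
  rw [StarSubalgebra.mem_centralizer_iff]
  refine ⟨fun hA B hB => (hA B ((h B).2 hB)).1, fun hA B hB => ⟨hA B ((h B).1 hB), ?_⟩⟩
  exact hA _ ((h _).1 (star_mem hB))

theorem subset_vonNeumannGenerated {S : Set (F →L[ℂ] F)} (hS : ∀ s ∈ S, star s = s)
    {A : F →L[ℂ] F} (hA : A ∈ S) : A ∈ vonNeumannGenerated S :=
  (mem_vonNeumannGenerated hS).2 fun _ hB => (hB A hA).symm

theorem smul_mem_vonNeumann (M : VonNeumannAlgebra F) (c : ℂ) {A : F →L[ℂ] F} (hA : A ∈ M) :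
    c • A ∈ M := M.toStarSubalgebra.smul_mem hA c

theorem cfc_mem_vonNeumann (M : VonNeumannAlgebra F) (f : ℝ → ℝ) {A : F →L[ℂ] F} (hA : A ∈ M) :
    cfc f A ∈ M := by
  rw [← M.commutant_commutant, VonNeumannAlgebra.mem_commutant_iff]
  rw [← M.commutant_commutant, VonNeumannAlgebra.mem_commutant_iff] at hA
  intro B hB
  exact ((show Commute A B from (hA B hB).symm).cfc_real f).eq.symm

theorem rpow_mem_vonNeumann (M : VonNeumannAlgebra F) (y : ℝ) {A : F →L[ℂ] F} (hA : A ∈ M)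
    (hA0 : 0 ≤ A) : A ^ y ∈ M := by
  rw [CFC.rpow_eq_cfc_real hA0]
  exact cfc_mem_vonNeumann M _ hA

/-- The lower bound makes `x* x` invertible, so the polar part `x (x* x)^{-1/2}` is an isometry in
`M`. Its adjoint kills `Ω`, hence it is not unitary. -/
theorem isInfiniteVN_of_bounded_below {M : VonNeumannAlgebra F} {x : F →L[ℂ] F} (hx : x ∈ M)
    {c : ℝ} (hc : 0 < c) (hxc : ∀ ξ, c * ‖ξ‖ ^ 2 ≤ ‖x ξ‖ ^ 2) {Ω : F} (hΩ : Ω ≠ 0)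
    (hxΩ : star x Ω = 0) : IsInfiniteVN M := by
  set a := star x * x with ha
  have haM : a ∈ M := mul_mem (star_mem hx) hx
  have hle : algebraMap ℝ (F →L[ℂ] F) c ≤ a := by
    rw [ContinuousLinearMap.le_def, ContinuousLinearMap.isPositive_def']
    refine ⟨?_, fun ξ => ?_⟩
    · refine IsSelfAdjoint.sub (IsSelfAdjoint.star_mul_self x) ?_
      exact (IsSelfAdjoint.all c).algebraMap _
    · have h1 : inner ℂ (a ξ) ξ = inner ℂ (x ξ) (x ξ) :=
        ContinuousLinearMap.adjoint_inner_left x ξ (x ξ)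
      have h2 : inner ℂ (algebraMap ℝ (F →L[ℂ] F) c ξ) ξ = (c : ℂ) * inner ℂ ξ ξ := by
        rw [Algebra.algebraMap_eq_smul_one]
        simp [inner_smul_left_eq_smul]
      rw [ContinuousLinearMap.reApplyInnerSelf_apply, sub_apply,
        inner_sub_left, h1, h2, map_sub, RCLike.re_eq_complex_re, Complex.re_ofReal_mul]
      have h3 := inner_self_eq_norm_sq (𝕜 := ℂ) ξ
      have h4 := inner_self_eq_norm_sq (𝕜 := ℂ) (x ξ)
      rw [RCLike.re_eq_complex_re] at h3 h4
      rw [h3, h4]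
      linarith [hxc ξ]
  have hnt : Nontrivial F := ⟨Ω, 0, hΩ⟩
  have hspos : IsStrictlyPositive (algebraMap ℝ (F →L[ℂ] F) c) :=
    ⟨algebraMap_nonneg _ hc.le, (IsUnit.mk0 c hc.ne').map (algebraMap ℝ (F →L[ℂ] F))⟩
  have hapos : IsStrictlyPositive a :=
    ⟨hspos.nonneg.trans hle, CStarAlgebra.isUnit_of_le _ hle hspos⟩
  set r : F →L[ℂ] F := a ^ (-(1 / 2) : ℝ) with hr
  have hrM : r ∈ M := rpow_mem_vonNeumann M _ haM hapos.nonneg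
  have hrs : star r = r := (IsSelfAdjoint.of_nonneg CFC.rpow_nonneg).star_eq
  refine ⟨x * r, mul_mem hx hrM, ?_, fun h => hΩ ?_⟩
  · rw [star_mul, hrs, mul_assoc, ← mul_assoc (star x), ← mul_assoc]
    exact CFC.conjugate_rpow_neg_one_half a hapos
  · have h2 := DFunLike.congr_fun h Ω
    rw [star_mul] at h2
    simpa [hxΩ] using h2.symm

/-- Applied to `hrel`, a trace takes the same value `c / (1 - p) > 0` on all `A i * star (A i)`. The
sums of these operators are bounded by `C`, so their traces cannot grow linearly. -/
theorem not_exists_trace {M : VonNeumannAlgebra F} {A : ℕ → F →L[ℂ] F} (hA : ∀ i, A i ∈ M)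
    {c p C : ℝ} (hc : 0 < c) (hp : p < 1)
    (hrel : ∀ i, star (A i) * A i = (c : ℂ) • 1 + (p : ℂ) • (A i * star (A i)))
    (hC : ∀ (N : ℕ) ξ, ∑ i ∈ Finset.range N, ‖star (A i) ξ‖ ^ 2 ≤ C * ‖ξ‖ ^ 2) :
    ¬ ∃ τ : M.toStarSubalgebra →ₗ[ℂ] ℂ, IsNormalTracialState M τ := by
  rintro ⟨τ, hτ⟩
  let a : ℕ → M.toStarSubalgebra := fun i => ⟨A i, hA i⟩
  have h1 : ∀ i, (τ (a i * star (a i))).re = c / (1 - p) := by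
    intro i
    have h : star (a i) * a i = (c : ℂ) • 1 + (p : ℂ) • (a i * star (a i)) := Subtype.ext (hrel i)
    have h2 := congrArg τ h
    rw [map_add, map_smul, map_smul, hτ.map_one, hτ.trace] at h2
    have h3 := congrArg Complex.re h2
    simp only [smul_eq_mul, Complex.add_re, Complex.re_ofReal_mul, Complex.one_re] at h3
    rw [eq_div_iff (by linarith)]
    linarith
  have h2 : ∀ N : ℕ, N * (c / (1 - p)) ≤ C := by
    intro N
    let b : M.toStarSubalgebra := (C : ℂ) • 1 - ∑ i ∈ Finset.range N, a i * star (a i)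
    have hb : (0 : F →L[ℂ] F) ≤ (b : F →L[ℂ] F) := by
      rw [ContinuousLinearMap.nonneg_iff_isPositive, ContinuousLinearMap.isPositive_def']
      have hbe : (b : F →L[ℂ] F) = (C : ℂ) • 1 - ∑ i ∈ Finset.range N, A i * star (A i) := by
        simp [b, a]
      refine ⟨?_, fun ξ => ?_⟩
      · rw [hbe]
        refine IsSelfAdjoint.sub ?_ ?_
        · refine IsSelfAdjoint.smul ?_ (IsSelfAdjoint.one _)
          simp [isSelfAdjoint_iff]
        · exact isSelfAdjoint_sum _ fun i _ => IsSelfAdjoint.mul_star_self _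
      · have hi : ∀ i, inner ℂ (A i (star (A i) ξ)) ξ = inner ℂ (star (A i) ξ) (star (A i) ξ) :=
          fun i => (ContinuousLinearMap.adjoint_inner_right (A i) _ _).symm
        rw [ContinuousLinearMap.reApplyInnerSelf_apply, hbe]
        simp only [sub_apply, sum_apply, inner_sub_left,
          sum_inner, mul_apply_eq_comp, hi, map_sub, map_sum, inner_self_eq_norm_sq]
        have h3 : RCLike.re (inner ℂ (((C : ℂ) • (1 : F →L[ℂ] F)) ξ) ξ : ℂ) = C * ‖ξ‖ ^ 2 := by
          have h4 := inner_self_eq_norm_sq (𝕜 := ℂ) ξ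
          rw [← h4]
          simp
        rw [h3]
        linarith [hC N ξ]
    -- Positivity of `τ` is given on elements `star a * a` only, so `b` is written as the square of
    -- its root in `M`.
    let s : M.toStarSubalgebra := ⟨(b : F →L[ℂ] F) ^ (1 / 2 : ℝ), rpow_mem_vonNeumann M _ b.2 hb⟩
    have hs : star s * s = b := by
      refine Subtype.ext ?_
      change star ((b : F →L[ℂ] F) ^ (1 / 2 : ℝ)) * (b : F →L[ℂ] F) ^ (1 / 2 : ℝ) = b
      rw [(IsSelfAdjoint.of_nonneg CFC.rpow_nonneg).star_eq, ← CFC.sqrt_eq_rpow,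
        CFC.sqrt_mul_sqrt_self _ hb]
    have h3 := (hτ.nonneg s).1
    rw [hs] at h3
    simp only [b, map_sub, map_smul, map_sum, hτ.map_one, Complex.sub_re, Complex.re_sum, h1,
      smul_eq_mul, mul_one, Complex.ofReal_re, Finset.sum_const, Finset.card_range,
      nsmul_eq_mul] at h3
    linarith
  obtain ⟨N, hN⟩ := exists_nat_gt (C / (c / (1 - p)))
  have hpos : 0 < c / (1 - p) := div_pos hc (by linarith)
  rw [div_lt_iff₀ hpos] at hN
  exact absurd (h2 N) (not_le.2 hN)

/-! ### Weak limits -/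

theorem tendsto_inner_of_total {v : ℕ → F} {C : ℝ} (hv : ∀ n, ‖v n‖ ≤ C) {x : F} {W : Set F}
    (hW : (Submodule.span ℂ W).topologicalClosure = ⊤)
    (h : ∀ w ∈ W, Tendsto (fun n => inner ℂ w (v n)) atTop (𝓝 (inner ℂ w x))) (ξ : F) :
    Tendsto (fun n => inner ℂ ξ (v n)) atTop (𝓝 (inner ℂ ξ x)) := by
  have h2 : ∀ w ∈ Submodule.span ℂ W,
      Tendsto (fun n => inner ℂ w (v n)) atTop (𝓝 (inner ℂ w x)) := by
    intro w hw
    induction hw using Submodule.span_induction with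
    | mem w hw => exact h w hw
    | zero => simp
    | add y z _ _ hy hz => simpa only [inner_add_left] using hy.add hz
    | smul c y _ hy => simpa only [inner_smul_left] using hy.const_mul _
  have hC : 0 ≤ C := (norm_nonneg _).trans (hv 0)
  rw [Metric.tendsto_atTop]
  intro ε hε
  have hD : 0 < C + ‖x‖ + 1 := by positivity
  have hξ : ξ ∈ closure (Submodule.span ℂ W : Set F) := by
    rw [← Submodule.topologicalClosure_coe, hW]; trivial
  obtain ⟨w, hw, hwξ⟩ := Metric.mem_closure_iff.1 hξ (ε / 2 / (C + ‖x‖ + 1)) (by positivity)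
  obtain ⟨N, hN⟩ := Metric.tendsto_atTop.1 (h2 w hw) (ε / 2) (by positivity)
  refine ⟨N, fun n hn => ?_⟩
  have h3 := hN n hn
  rw [dist_eq_norm] at h3 hwξ ⊢
  have h4 : inner ℂ ξ (v n) - inner ℂ ξ x =
      (inner ℂ w (v n) - inner ℂ w x) + inner ℂ (ξ - w) (v n - x) := by
    simp only [inner_sub_left, inner_sub_right]; ring
  rw [lt_div_iff₀ hD] at hwξ
  have h5 : ‖(inner ℂ (ξ - w) (v n - x) : ℂ)‖ ≤ ‖ξ - w‖ * (C + ‖x‖ + 1) := by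
    refine (norm_inner_le_norm _ _).trans (mul_le_mul_of_nonneg_left ?_ (norm_nonneg _))
    linarith [norm_sub_le (v n) x, hv n]
  rw [h4]
  linarith [norm_add_le (inner ℂ w (v n) - inner ℂ w x : ℂ) (inner ℂ (ξ - w) (v n - x))]

theorem tendsto_inner_apply_of_total {Z : ℕ → F →L[ℂ] F} {C : ℝ} (hZ : ∀ n, ‖Z n‖ ≤ C)
    {A : F →L[ℂ] F} {W : Set F} (hW : (Submodule.span ℂ W).topologicalClosure = ⊤)
    (h : ∀ w ∈ W, ∀ w' ∈ W, ∀ᶠ n in atTop, inner ℂ w (Z n w') = inner ℂ w (A w')) (ξ ξ' : F) :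
    Tendsto (fun n => inner ℂ ξ (Z n ξ')) atTop (𝓝 (inner ℂ ξ (A ξ'))) := by
  have h1 : ∀ w' ∈ W, ∀ ξ : F, Tendsto (fun n => inner ℂ ξ (Z n w')) atTop
      (𝓝 (inner ℂ ξ (A w'))) := fun w' hw' =>
    tendsto_inner_of_total (fun n => (Z n).le_of_opNorm_le (hZ n) w') hW fun w hw =>
      tendsto_const_nhds.congr' ((h w hw w' hw').mono fun n hn => hn.symm)
  -- The left vector is already arbitrary by `h1`. Passing to adjoints exchanges the roles, so that
  -- the density argument also frees the right vector.
  have h2 := tendsto_inner_of_total (v := fun n => star (Z n) ξ) (C := C * ‖ξ‖)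
    (x := star A ξ) (fun n => (star (Z n)).le_of_opNorm_le (by rw [norm_star]; exact hZ n) ξ) hW
    (fun w hw => ?_) ξ'
  · have h3 := (Complex.continuous_conj.tendsto _).comp h2
    have h4 : ∀ (B : F →L[ℂ] F), conj (inner ℂ ξ' (star B ξ)) = inner ℂ ξ (B ξ') := fun B => by
      rw [inner_conj_symm]; exact ContinuousLinearMap.adjoint_inner_left B ξ' ξ
    rw [h4] at h3
    exact h3.congr fun n => h4 _
  · have h3 := (Complex.continuous_conj.tendsto _).comp (h1 w hw ξ)
    have h4 : ∀ (B : F →L[ℂ] F), conj (inner ℂ ξ (B w)) = inner ℂ w (star B ξ) := fun B => by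
      rw [inner_conj_symm]; exact (ContinuousLinearMap.adjoint_inner_right B w ξ).symm
    rw [h4] at h3
    exact h3.congr fun n => h4 _

/-- Von Neumann algebras are closed under limits of bounded sequences in the weak operator
topology. -/
theorem mem_vonNeumann_of_tendsto (M : VonNeumannAlgebra F) {Z : ℕ → F →L[ℂ] F}
    (hZ : ∀ n, Z n ∈ M) {A : F →L[ℂ] F}
    (h : ∀ ξ ξ', Tendsto (fun n => inner ℂ ξ (Z n ξ')) atTop (𝓝 (inner ℂ ξ (A ξ')))) : A ∈ M := by
  rw [← M.commutant_commutant, VonNeumannAlgebra.mem_commutant_iff]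
  intro B hB
  have hZB : ∀ n, B * Z n = Z n * B := fun n =>
    (VonNeumannAlgebra.mem_commutant_iff.1 hB (Z n) (hZ n)).symm
  refine ContinuousLinearMap.ext fun ξ' => ext_inner_left ℂ fun ξ => ?_
  have h1 := h ξ (B ξ')
  have h2 := h (star B ξ) ξ'
  have h3 : ∀ y : F, inner ℂ (star B ξ) y = inner ℂ ξ (B y) := fun y =>
    ContinuousLinearMap.adjoint_inner_left B y ξ
  simp only [h3] at h2
  refine tendsto_nhds_unique (h2.congr fun n => ?_) h1
  exact congrArg (inner ℂ ξ) (DFunLike.congr_fun (hZB n) ξ')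

end VonNeumannGeneral

/-! ### Moments, totality of the process vectors and the Brownian case -/

section Totality

open Filter Topology

variable {α : Type*} [MeasurableSpace α] {m : Measure α} {f : α → ℂ} {X : α → ℝ} {R : ℝ}

theorem integrable_continuous_comp_mul (hf : Integrable f m) (hX : Measurable X)
    (hR : ∀ᵐ a ∂m, X a ∈ Set.Icc (-R) R) {φ : ℝ → ℝ} (hφ : Continuous φ) :
    Integrable (fun a => (φ (X a) : ℂ) * f a) m := by
  obtain ⟨C, hC⟩ := isCompact_Icc.exists_bound_of_continuousOn (s := Set.Icc (-R) R) hφ.continuousOn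
  refine hf.bdd_mul (c := C) ?_ ?_
  · exact (Complex.measurable_ofReal.comp (hφ.measurable.comp hX)).aestronglyMeasurable
  · filter_upwards [hR] with a ha
    rw [Complex.norm_real]
    exact hC _ ha

/-- Vanishing moments annihilate polynomials in `X`. By Weierstrass a continuous function is
uniformly close to a polynomial on `[-R, R]`, with an error in the integral of at most `ε` times the
`L¹` norm of `f`. -/
theorem integral_continuous_comp_mul_eq_zero (hf : Integrable f m) (hX : Measurable X)
    (hR : ∀ᵐ a ∂m, X a ∈ Set.Icc (-R) R) (h : ∀ n : ℕ, ∫ a, (X a : ℂ) ^ n * f a ∂m = 0)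
    {φ : ℝ → ℝ} (hφ : Continuous φ) : ∫ a, (φ (X a) : ℂ) * f a ∂m = 0 := by
  have hpoly : ∀ P : Polynomial ℝ, ∫ a, ((P.eval (X a) : ℝ) : ℂ) * f a ∂m = 0 := by
    intro P
    induction P using Polynomial.induction_on' with
    | add P Q hP hQ =>
      simp only [Polynomial.eval_add, Complex.ofReal_add, add_mul]
      rw [integral_add (integrable_continuous_comp_mul hf hX hR P.continuous)
        (integrable_continuous_comp_mul hf hX hR Q.continuous), hP, hQ, add_zero]
    | monomial n c =>
      simp only [Polynomial.eval_monomial, Complex.ofReal_mul, Complex.ofReal_pow, mul_assoc]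
      rw [integral_const_mul, h, mul_zero]
  rw [← norm_le_zero_iff]
  refine le_of_forall_pos_le_add fun ε hε => ?_
  set I := ∫ a, ‖f a‖ ∂m with hI
  have hI0 : 0 ≤ I := integral_nonneg fun _ => norm_nonneg _
  obtain ⟨P, hP⟩ := exists_polynomial_near_of_continuousOn (-R) R φ hφ.continuousOn
    (ε / (I + 1)) (by positivity)
  have h1 : ∫ a, (φ (X a) : ℂ) * f a ∂m = ∫ a, ((φ (X a) - P.eval (X a) : ℝ) : ℂ) * f a ∂m := by
    simp only [Complex.ofReal_sub, sub_mul]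
    rw [integral_sub (integrable_continuous_comp_mul hf hX hR hφ)
      (integrable_continuous_comp_mul hf hX hR P.continuous), hpoly, sub_zero]
  rw [h1, zero_add]
  calc ‖∫ a, ((φ (X a) - P.eval (X a) : ℝ) : ℂ) * f a ∂m‖
      ≤ ∫ a, ε / (I + 1) * ‖f a‖ ∂m := by
        refine norm_integral_le_of_norm_le (hf.norm.const_mul _) ?_
        filter_upwards [hR] with a ha
        rw [norm_mul, Complex.norm_real, Real.norm_eq_abs, abs_sub_comm]
        exact mul_le_mul_of_nonneg_right (hP _ ha).le (norm_nonneg _)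
    _ = ε * (I / (I + 1)) := by rw [integral_const_mul]; ring
    _ ≤ ε * 1 := by
        refine mul_le_mul_of_nonneg_left ?_ hε.le
        rw [div_le_one (by positivity)]
        linarith
    _ = ε := mul_one ε

/-- A complex density whose moments against a bounded variable vanish has vanishing integral over
the preimages of closed sets. -/
theorem setIntegral_preimage_closed_eq_zero (hf : Integrable f m) (hX : Measurable X)
    (hR : ∀ᵐ a ∂m, X a ∈ Set.Icc (-R) R) (h : ∀ n : ℕ, ∫ a, (X a : ℂ) ^ n * f a ∂m = 0)
    {E : Set ℝ} (hE : IsClosed E) : ∫ a in X ⁻¹' E, f a ∂m = 0 := by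
  have hδ : ∀ n : ℕ, (0 : ℝ) < 1 / ((n : ℝ) + 1) := fun n => Nat.one_div_pos_of_nat
  -- The indicator of a closed set is a pointwise limit of continuous functions bounded by `1`;
  -- dominated convergence carries the vanishing over.
  have h1 := thickenedIndicator_tendsto_indicator_closure hδ tendsto_one_div_add_atTop_nhds_zero_nat E
  rw [hE.closure_eq, tendsto_pi_nhds] at h1
  have h2 : Tendsto (fun n => ∫ a, (((thickenedIndicator (hδ n) E (X a) : NNReal) : ℝ) : ℂ) * f a ∂m)
      atTop (𝓝 (∫ a, (X ⁻¹' E).indicator f a ∂m)) := by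
    refine tendsto_integral_of_dominated_convergence (fun a => ‖f a‖) (fun n => ?_) hf.norm
      (fun n => ?_) ?_
    · exact (integrable_continuous_comp_mul hf hX hR (φ := fun x => (thickenedIndicator (hδ n) E x : ℝ))
        (NNReal.continuous_coe.comp (thickenedIndicator (hδ n) E).continuous)).aestronglyMeasurable
    · refine Eventually.of_forall fun a => ?_
      rw [norm_mul, Complex.norm_real, NNReal.norm_eq]
      refine mul_le_of_le_one_left (norm_nonneg _) ?_
      exact_mod_cast thickenedIndicator_le_one (hδ n) E (X a)
    · refine Eventually.of_forall fun a => ?_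
      have h3 : Tendsto (fun n => (((thickenedIndicator (hδ n) E (X a) : NNReal) : ℝ) : ℂ) * f a)
          atTop (𝓝 ((((E.indicator (fun _ => (1 : NNReal)) (X a) : NNReal) : ℝ) : ℂ) * f a)) :=
        ((Complex.continuous_ofReal.comp NNReal.continuous_coe).tendsto _ |>.comp (h1 (X a))).mul_const _
      convert h3 using 2
      by_cases ha : X a ∈ E <;> simp [ha]
  rw [integral_indicator (hX hE.measurableSet)] at h2
  refine tendsto_nhds_unique h2 ?_
  have h3 : ∀ n : ℕ, ∫ a, (((thickenedIndicator (hδ n) E (X a) : NNReal) : ℝ) : ℂ) * f a ∂m = 0 :=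
    fun n => integral_continuous_comp_mul_eq_zero hf hX hR h
      (φ := fun x => (thickenedIndicator (hδ n) E x : ℝ))
      (NNReal.continuous_coe.comp (thickenedIndicator (hδ n) E).continuous)
  simp only [h3]
  exact tendsto_const_nhds

/-- These rectangles are the sets reached by varying the time `t` and by the moment argument in `x`,
and they generate the Borel sets of the plane. -/
theorem generateFrom_Iio_prod_closed :
    (inferInstance : MeasurableSpace (ℝ × ℝ)) = MeasurableSpace.generateFrom
      (Set.image2 (fun s t => s ×ˢ t) (Set.range Set.Iio) {E : Set ℝ | IsClosed E}) := by
  refine (generateFrom_eq_prod ?_ ?_ ?_ ?_).symm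
  · rw [← borel_eq_generateFrom_Iio]; exact (BorelSpace.measurable_eq (α := ℝ)).symm
  · rw [← borel_eq_generateFrom_isClosed]; exact (BorelSpace.measurable_eq (α := ℝ)).symm
  · refine ⟨fun n : ℕ => Set.Iio (n : ℝ), fun n => ⟨_, rfl⟩, ?_⟩
    exact Set.eq_univ_of_forall fun x => Set.mem_iUnion.2 (exists_nat_gt x)
  · exact ⟨fun _ => Set.univ, fun _ => isClosed_univ, Set.iUnion_const _⟩

variable (ν : Measure ℝ) [IsProbabilityMeasure ν]

theorem stepPow_eq_mul (k : ℕ) (t : ℝ) (p : ℝ × ℝ) :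
    stepPow k t p = (Set.Ico 0 t).indicator (fun _ => (1 : ℂ)) p.1 * (p.2 : ℂ) ^ k := by
  by_cases h : p.1 ∈ Set.Ico 0 t
  · rw [stepPow, Set.indicator_of_mem (Set.mk_mem_prod h (Set.mem_univ _)),
      Set.indicator_of_mem h, one_mul]
  · rw [stepPow, Set.indicator_of_notMem (fun h' => h h'.1), Set.indicator_of_notMem h, zero_mul]

theorem stepPow_mul_stepPow (k l : ℕ) (s t : ℝ) (p : ℝ × ℝ) :
    stepPow k s p * stepPow l t p = stepPow (k + l) (min s t) p := by
  simp only [stepPow_eq_mul]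
  by_cases h1 : p.1 ∈ Set.Ico 0 s <;> by_cases h2 : p.1 ∈ Set.Ico 0 t
  · have h : p.1 ∈ Set.Ico 0 (min s t) := ⟨h1.1, lt_min h1.2 h2.2⟩
    simp [h1, h2, h, pow_add]
  all_goals
    have h : p.1 ∉ Set.Ico 0 (min s t) := fun h => by
      first
      | exact h1 ⟨h.1, h.2.trans_le (min_le_left _ _)⟩
      | exact h2 ⟨h.1, h.2.trans_le (min_le_right _ _)⟩
    simp [h1, h2, h]

theorem conj_stepPow (k : ℕ) (t : ℝ) (p : ℝ × ℝ) : conj (stepPow k t p) = stepPow k t p := by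
  rw [stepPow_eq_mul]
  by_cases h : p.1 ∈ Set.Ico 0 t <;> simp [h]

theorem integral_stepPow (k : ℕ) {t : ℝ} (ht : 0 ≤ t) :
    ∫ p, stepPow k t p ∂(levyMeasure ν) = ((t * ∫ x, x ^ k ∂ν : ℝ) : ℂ) := by
  simp only [stepPow_eq_mul]
  rw [levyMeasure, integral_prod_mul ((Set.Ico 0 t).indicator fun _ => (1 : ℂ))
    (fun x : ℝ => (x : ℂ) ^ k), integral_indicator measurableSet_Ico,
    Measure.restrict_restrict measurableSet_Ico,
    Set.inter_eq_left.2 (Set.Ico_subset_Ici_self : Set.Ico (0 : ℝ) t ⊆ Set.Ici 0)]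
  have h : ∫ x, (x : ℂ) ^ k ∂ν = ((∫ x, x ^ k ∂ν : ℝ) : ℂ) := by
    have h' := integral_ofReal (𝕜 := ℂ) (μ := ν) (f := fun x : ℝ => x ^ k)
    simpa using h'
  rw [h]
  simp [ht]

variable (hν : CompactlySupported ν)
include hν

theorem inner_levyVector_left (k : ℕ) (t : ℝ) (f : OneParticle ν) :
    inner ℂ (levyVector ν hν k t) f = ∫ p, stepPow (k - 1) t p * f p ∂(levyMeasure ν) := by
  rw [L2.inner_def]
  refine integral_congr_ae ?_
  filter_upwards [(memLp_two_stepPow ν hν (k - 1) t).coeFn_toLp] with p hp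
  rw [levyVector, hp, RCLike.inner_apply, conj_stepPow, mul_comm]

theorem inner_levyVector_levyVector (k l : ℕ) {s t : ℝ} (hs : 0 ≤ s) (ht : 0 ≤ t) :
    inner ℂ (levyVector ν hν k s) (levyVector ν hν l t) =
      ((min s t * ∫ x, x ^ (k - 1 + (l - 1)) ∂ν : ℝ) : ℂ) := by
  rw [inner_levyVector_left, ← integral_stepPow ν _ (le_min hs ht)]
  refine integral_congr_ae ?_
  filter_upwards [(memLp_two_stepPow ν hν (l - 1) t).coeFn_toLp] with p hp
  rw [levyVector, hp, stepPow_mul_stepPow]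

theorem levyMul_levyVector (k l : ℕ) (hl : 1 ≤ l) (s t : ℝ) :
    levyMul ν hν k s (levyVector ν hν l t) = levyVector ν hν (k + l) (min s t) := by
  refine Lp.ext ?_
  filter_upwards [levyMul_apply ν hν k s (levyVector ν hν l t),
    (memLp_two_stepPow ν hν (l - 1) t).coeFn_toLp,
    (memLp_two_stepPow ν hν (k + l - 1) (min s t)).coeFn_toLp] with p h1 h2 h3
  rw [h1, levyVector, levyVector, h2, h3, stepPow_mul_stepPow, Nat.add_sub_assoc hl]

theorem inner_levyMul_left (k : ℕ) (t : ℝ) (f g : OneParticle ν) :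
    inner ℂ (levyMul ν hν k t f) g = inner ℂ f (levyMul ν hν k t g) := by
  rw [L2.inner_def, L2.inner_def]
  refine integral_congr_ae ?_
  filter_upwards [levyMul_apply ν hν k t f, levyMul_apply ν hν k t g] with p h1 h2
  rw [h1, h2, RCLike.inner_apply, RCLike.inner_apply, map_mul, conj_stepPow]
  ring

theorem levyMul_comm (k l : ℕ) (s t : ℝ) :
    levyMul ν hν k s * levyMul ν hν l t = levyMul ν hν l t * levyMul ν hν k s := by
  refine ContinuousLinearMap.ext fun f => Lp.ext ?_
  filter_upwards [levyMul_apply ν hν k s (levyMul ν hν l t f), levyMul_apply ν hν l t f,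
    levyMul_apply ν hν l t (levyMul ν hν k s f), levyMul_apply ν hν k s f] with p h1 h2 h3 h4
  rw [mul_apply_eq_comp, mul_apply_eq_comp, h1, h2, h3, h4]
  ring

theorem exists_ae_bound : ∃ R : ℝ, 0 ≤ R ∧ ∀ᵐ x ∂ν, x ∈ Set.Icc (-R) R := by
  obtain ⟨K, hK, hνK⟩ := hν
  obtain ⟨R, hR⟩ := hK.isBounded.exists_norm_le
  have h1 : ∀ᵐ x ∂ν, x ∈ K := by
    rw [ae_iff]
    exact hνK
  refine ⟨|R|, abs_nonneg R, ?_⟩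
  filter_upwards [h1] with x hx
  exact abs_le.1 ((hR x hx).trans (le_abs_self R))

/-- Uniformity in `t` is the point: it bounds all increments of the process at once, as weak limits
require. -/
theorem exists_norm_levyMul_le (k : ℕ) : ∃ C : ℝ, ∀ t, ‖levyMul ν hν k t‖ ≤ C := by
  obtain ⟨R, hR, h⟩ := exists_ae_bound ν hν
  refine ⟨R ^ k, fun t => ?_⟩
  refine ContinuousLinearMap.opNorm_le_bound _ (by positivity) fun f => ?_
  refine Lp.norm_le_mul_norm_of_ae_le_mul ?_
  have h2 : ∀ᵐ p ∂(levyMeasure ν), p.2 ∈ Set.Icc (-R) R :=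
    Measure.quasiMeasurePreserving_snd.ae h
  filter_upwards [h2, levyMul_apply ν hν k t f] with p hp hf
  rw [hf, norm_mul]
  refine mul_le_mul_of_nonneg_right ?_ (norm_nonneg _)
  refine (norm_indicator_le_norm_self _ _).trans ?_
  rw [norm_pow, Complex.norm_real]
  exact pow_le_pow_left₀ (norm_nonneg _) (abs_le.2 hp) k

/-- The vectors `1_{[0,t)} ⊗ x^{k-1}` of the operators `Y_k(t)`. -/
def levyVectors : Set (OneParticle ν) :=
  {v | ∃ (k : ℕ) (t : ℝ), 1 ≤ k ∧ 0 ≤ t ∧ v = levyVector ν hν k t}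

/-- The vectors of the operators `Y_k(t)` are total in the one-particle space. -/
theorem closure_span_levyVector :
    (Submodule.span ℂ (levyVectors ν hν)).topologicalClosure = ⊤ := by
  rw [Submodule.topologicalClosure_eq_top_iff, Submodule.eq_bot_iff]
  intro f hf
  have hf0 : ∀ (n : ℕ) (t : ℝ), 0 ≤ t → ∫ p, stepPow n t p * f p ∂(levyMeasure ν) = 0 := by
    intro n t ht
    have h := Submodule.inner_right_of_mem_orthogonal (u := levyVector ν hν (n + 1) t)
      (Submodule.subset_span (show _ ∈ levyVectors ν hν from ⟨n + 1, t, by omega, ht, rfl⟩)) hf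
    rwa [inner_levyVector_left, Nat.add_sub_cancel] at h
  obtain ⟨R, -, hR⟩ := exists_ae_bound ν hν
  have hRp : ∀ᵐ p ∂(levyMeasure ν), p.2 ∈ Set.Icc (-R) R :=
    Measure.quasiMeasurePreserving_snd.ae hR
  let S : ℝ → Set (ℝ × ℝ) := fun t => Set.Ico 0 t ×ˢ Set.univ
  have hS : ∀ t, MeasurableSet (S t) := fun t => measurableSet_Ico.prod MeasurableSet.univ
  have hfin : ∀ t, levyMeasure ν (S t) < ⊤ := by
    intro t
    rw [levyMeasure, Measure.prod_prod, measure_univ, mul_one]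
    exact (Measure.restrict_apply_le _ _).trans_lt measure_Ico_lt_top
  have hfi : ∀ t, Integrable f ((levyMeasure ν).restrict (S t)) := by
    intro t
    have : IsFiniteMeasure ((levyMeasure ν).restrict (S t)) := ⟨by simpa using hfin t⟩
    exact ((Lp.memLp f).restrict _).integrable (by norm_num)
  have hclosed : ∀ t, 0 ≤ t → ∀ E : Set ℝ, IsClosed E →
      ∫ p in Prod.snd ⁻¹' E, f p ∂((levyMeasure ν).restrict (S t)) = 0 := by
    intro t ht E hE
    refine setIntegral_preimage_closed_eq_zero (hfi t) measurable_snd (ae_restrict_of_ae hRp)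
      (fun n => ?_) hE
    rw [← hf0 n t ht, ← integral_indicator (hS t)]
    refine integral_congr_ae (Eventually.of_forall fun p => ?_)
    by_cases hp : p ∈ S t <;> simp [stepPow, hp, S]
  have hzero : ∀ N : ℕ, f =ᵐ[(levyMeasure ν).restrict (S N)] 0 := by
    intro N
    refine (hfi N).ae_eq_zero_of_forall_setIntegral_eq_zero fun s hs hsf => ?_
    clear hsf
    have huniv : ∫ p, f p ∂((levyMeasure ν).restrict (S N)) = 0 := by
      simpa using hclosed N (Nat.cast_nonneg N) Set.univ isClosed_univ
    induction s, hs using MeasurableSpace.induction_on_inter generateFrom_Iio_prod_closed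
      (isPiSystem_Iio.prod isPiSystem_isClosed) with
    | empty => simp
    | basic s hs =>
      obtain ⟨_, ⟨t, rfl⟩, E, hE, rfl⟩ := hs
      have hE' : IsClosed E := hE
      -- Inside the strip `S N` a rectangle is again a slice of a shorter strip; the maximum with
      -- `0` covers negative `t`.
      have h1 : (Set.Iio t ×ˢ E) ∩ S N = Prod.snd ⁻¹' E ∩ S (max 0 (min t N)) := by
        ext p
        simp only [S, Set.mem_inter_iff, Set.mem_prod, Set.mem_Iio, Set.mem_Ico, Set.mem_univ,
          and_true, Set.mem_preimage, lt_max_iff, lt_min_iff]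
        constructor
        · rintro ⟨⟨h1, h2⟩, h3, h4⟩
          exact ⟨h2, h3, Or.inr ⟨h1, h4⟩⟩
        · rintro ⟨h2, h3, h4 | h4⟩
          · exact absurd h3 (not_le.2 h4)
          · exact ⟨⟨h4.1, h2⟩, h3, h4.2⟩
      rw [Measure.restrict_restrict (measurableSet_Iio.prod hE'.measurableSet), h1,
        ← Measure.restrict_restrict (measurable_snd hE'.measurableSet)]
      exact hclosed _ (le_max_left _ _) E hE'
    | compl s hs ih =>
      have h2 := integral_add_compl hs (hfi N)
      rwa [ih, zero_add, huniv] at h2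
    | iUnion g hd hg ih =>
      have h2 := hasSum_integral_iUnion hg hd (hfi N).integrableOn
      simp only [ih] at h2
      exact h2.unique hasSum_zero
  have hall : ∀ᵐ p ∂(levyMeasure ν), ∀ N : ℕ, p ∈ S N → f p = 0 :=
    ae_all_iff.2 fun N => (ae_restrict_iff' (hS N)).1 (hzero N)
  have hpos : ∀ᵐ p ∂(levyMeasure ν), p.1 ∈ Set.Ici (0 : ℝ) :=
    Measure.quasiMeasurePreserving_fst.ae (ae_restrict_mem measurableSet_Ici)
  refine Lp.ext ?_
  filter_upwards [hall, hpos, Lp.coeFn_zero ℂ 2 (levyMeasure ν)] with p h1 h2 h3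
  obtain ⟨N, hN⟩ := exists_nat_gt p.1
  rw [h3, h1 N ⟨⟨h2, hN⟩, Set.mem_univ _⟩, Pi.zero_apply]

theorem integral_sq_eq_zero_iff : ∫ x, x ^ 2 ∂ν = 0 ↔ ∀ᵐ x ∂ν, x = 0 := by
  obtain ⟨R, hR, h⟩ := exists_ae_bound ν hν
  have hint : Integrable (fun x : ℝ => x ^ 2) ν := by
    refine Integrable.of_bound (by fun_prop) (R ^ 2) ?_
    filter_upwards [h] with x hx
    rw [norm_pow]
    exact pow_le_pow_left₀ (norm_nonneg _) (abs_le.2 hx) 2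
  rw [integral_eq_zero_iff_of_nonneg (fun x => sq_nonneg x) hint]
  refine Filter.eventually_congr (Eventually.of_forall fun x => ?_)
  simp

/-- The single number `r_4 = ∫ x² dν` already decides whether `ν` is concentrated at `0`. -/
theorem isBrownian_iff : IsBrownian ν ↔ ∀ᵐ x ∂ν, x = 0 := by
  refine ⟨fun h => (integral_sq_eq_zero_iff ν hν).1 (h 4 (by norm_num)), fun h k hk => ?_⟩
  rw [levyMoment, ← integral_zero ℝ ℝ (μ := ν)]
  refine integral_congr_ae ?_
  filter_upwards [h] with x hx
  rw [hx, zero_pow (by omega)]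

theorem levyMul_eq_zero_of_isBrownian (h : IsBrownian ν) {k : ℕ} (hk : 1 ≤ k) (t : ℝ) :
    levyMul ν hν k t = 0 := by
  have h2 : ∀ᵐ p ∂(levyMeasure ν), p.2 = 0 :=
    Measure.quasiMeasurePreserving_snd.ae ((isBrownian_iff ν hν).1 h)
  refine ContinuousLinearMap.ext fun f => Lp.ext ?_
  filter_upwards [levyMul_apply ν hν k t f, h2, Lp.coeFn_zero ℂ 2 (levyMeasure ν)] with p h1 h2 h3
  rw [h1, stepPow_eq_mul, h2, zero_apply, h3]
  simp [show k ≠ 0 by omega]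

end Totality

/-! ### Compression by creation of an orthogonal unit vector -/

section Compression

variable {q : Set.Ioo (-1 : ℝ) 1} {H : Type*} [NormedAddCommGroup H] [InnerProductSpace ℂ H]

theorem fock_ext {E : Type*} [TopologicalSpace E] [AddCommMonoid E] [Module ℂ E] [T2Space E]
    {A B : Fock q H →L[ℂ] E} (h : ∀ l, A (fockTensor q l) = B (fockTensor q l)) : A = B := by
  refine fock_ext_coe fun v => ?_
  induction v using tensor_induction with
  | tensor l => exact h l
  | add v w hv hw => simp only [UniformSpace.Completion.coe_add, map_add, hv, hw]
  | smul c v hv => simp only [UniformSpace.Completion.coe_smul, map_smul, hv]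

theorem inner_cre_left (ζ : H) (x y : Fock q H) :
    inner ℂ (cre q ζ x) y = inner ℂ x (ann q ζ y) := by
  rw [← star_cre]; exact (ContinuousLinearMap.adjoint_inner_right _ _ _).symm

theorem inner_ann_left (ζ : H) (x y : Fock q H) :
    inner ℂ (ann q ζ x) y = inner ℂ x (cre q ζ y) := by
  rw [← star_ann]; exact (ContinuousLinearMap.adjoint_inner_right _ _ _).symm

theorem cre_zero : cre q (0 : H) = 0 := by simpa using cre_smul (q := q) (0 : ℂ) (0 : H)

theorem cre_sub (ζ η : H) : cre q (ζ - η) = cre q ζ - cre q η :=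
  map_sub (creL q H) ζ η

theorem ann_sub (ζ η : H) : ann q (ζ - η) = ann q ζ - ann q η := by
  rw [← star_cre, cre_sub, star_sub, star_cre, star_cre]

theorem fockTensor_zero_cons (l : List H) : fockTensor q ((0 : H) :: l) = 0 := by
  rw [← cre_fockTensor, cre_zero, zero_apply]

theorem gau_sub (S T : H →L[ℂ] H) : gau q (S - T) = gau q S - gau q T := by
  refine fock_ext fun l => ?_
  rw [sub_apply]
  simp only [gau_fockTensor, ← cre_fockTensor, sub_apply, cre_sub, smul_sub,
    Finset.sum_sub_distrib]

@[simp] theorem ann_cre_apply (ζ η : H) (x : Fock q H) :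
    ann q ζ (cre q η x) = inner ℂ ζ η • x + ((q : ℝ) : ℂ) • cre q η (ann q ζ x) := by
  have h := DFunLike.congr_fun (ann_mul_cre (q := q) ζ η) x
  simpa using h

theorem norm_cre_sq (ζ : H) (x : Fock q H) :
    ‖cre q ζ x‖ ^ 2 = ‖ζ‖ ^ 2 * ‖x‖ ^ 2 + q * ‖ann q ζ x‖ ^ 2 := by
  have h : inner ℂ (cre q ζ x) (cre q ζ x) =
      ((‖ζ‖ ^ 2 * ‖x‖ ^ 2 + q * ‖ann q ζ x‖ ^ 2 : ℝ) : ℂ) := by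
    rw [inner_cre_left, ann_cre_apply, inner_add_right, inner_smul_right, inner_smul_right,
      ← inner_ann_left, inner_self_eq_norm_sq_to_K, inner_self_eq_norm_sq_to_K,
      inner_self_eq_norm_sq_to_K]
    push_cast
    rfl
  rw [← inner_self_eq_norm_sq (𝕜 := ℂ), h]
  exact Complex.ofReal_re _

/-- Creation operators are bounded below. -/
theorem le_norm_cre_sq (ζ : H) (x : Fock q H) :
    (1 - |(q : ℝ)|) * ‖ζ‖ ^ 2 * ‖x‖ ^ 2 ≤ ‖cre q ζ x‖ ^ 2 := by
  have hx : 0 ≤ ‖ζ‖ ^ 2 * ‖x‖ ^ 2 := by positivity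
  rcases le_or_gt 0 (q : ℝ) with h | h
  · rw [norm_cre_sq, abs_of_nonneg h]
    nlinarith [mul_nonneg h (sq_nonneg ‖ann q ζ x‖), mul_nonneg h hx]
  -- For `q < 0` the identity `norm_cre_sq` bounds creation by `‖ζ‖`, hence also its adjoint. Put
  -- back into the identity, this leaves the factor `1 + q`.
  · have h1 : ‖cre q ζ‖ ≤ ‖ζ‖ := by
      refine ContinuousLinearMap.opNorm_le_bound _ (norm_nonneg _) fun y => ?_
      refine le_of_sq_le_sq ?_ (by positivity)
      rw [norm_cre_sq, mul_pow]
      nlinarith [mul_nonneg (neg_nonneg.2 h.le) (sq_nonneg ‖ann q ζ y‖)]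
    have h2 : ‖ann q ζ x‖ ^ 2 ≤ ‖ζ‖ ^ 2 * ‖x‖ ^ 2 := by
      rw [← mul_pow]
      refine pow_le_pow_left₀ (norm_nonneg _) ((ann q ζ).le_of_opNorm_le ?_ x) 2
      rw [← star_cre]
      exact (LinearIsometryEquiv.norm_map ContinuousLinearMap.adjoint _).trans_le h1
    rw [norm_cre_sq, abs_of_neg h]
    nlinarith

theorem sum_norm_ann_sq_le {ι : Type*} [Fintype ι] (f : ι → H) {t : ℝ}
    (hf : ∀ i j, i ≠ j → inner ℂ (f i) (f j) = 0) (ht : 0 ≤ t) (hft : ∀ i, ‖f i‖ ^ 2 ≤ t)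
    (x : Fock q H) :
    ∑ i, ‖ann q (f i) x‖ ^ 2 ≤ t / (1 - |(q : ℝ)|) * ‖x‖ ^ 2 := by
  induction x using UniformSpace.Completion.induction_on with
  | hp => exact isClosed_le (by fun_prop) (by fun_prop)
  | ih v => simpa using sum_norm_annihilation_sq_le_of_orthogonal f hf ht hft v

theorem ann_fockTensor_of_orthogonal {e : H} {l : List H} (hl : ∀ x ∈ l, inner ℂ e x = 0) :
    ann q e (fockTensor q l) = 0 := by
  rw [ann_fockTensor]
  refine Finset.sum_eq_zero fun k _ => ?_
  rw [hl _ (l.get_mem k), mul_zero, zero_smul]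

theorem gau_fockTensor_of_forall_eq_zero {T : H →L[ℂ] H} {l : List H} (hl : ∀ x ∈ l, T x = 0) :
    gau q T (fockTensor q l) = 0 := by
  rw [gau_fockTensor]
  refine Finset.sum_eq_zero fun k _ => ?_
  rw [hl _ (l.get_mem k), fockTensor_zero_cons, smul_zero]

theorem forall_mem_eraseIdx {p : H → Prop} {l : List H} (hl : ∀ x ∈ l, p x) (k : ℕ) :
    ∀ x ∈ l.eraseIdx k, p x := fun x hx => hl x (List.mem_of_mem_eraseIdx hx)

variable {e : H} {l : List H}

theorem ann_fockTensor_self_cons (he : inner ℂ e e = 1) (hl : ∀ x ∈ l, inner ℂ e x = 0) :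
    ann q e (fockTensor q (e :: l)) = fockTensor q l := by
  rw [ann_fockTensor_cons, he, ann_fockTensor_of_orthogonal hl]
  simp

theorem ann_fockTensor_cons_of_orthogonal {x : H} (hx : inner ℂ e x = 0) (l : List H) :
    ann q e (fockTensor q (x :: l)) = ((q : ℝ) : ℂ) • cre q x (ann q e (fockTensor q l)) := by
  rw [ann_fockTensor_cons, hx, zero_smul, zero_add]

theorem ann_fockTensor_cons_cons (he : inner ℂ e e = 1) {x : H} (hx : inner ℂ e x = 0)
    (hl : ∀ y ∈ l, inner ℂ e y = 0) :
    ann q e (fockTensor q (x :: e :: l)) = ((q : ℝ) : ℂ) • fockTensor q (x :: l) := by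
  rw [ann_fockTensor_cons_of_orthogonal hx, ann_fockTensor_self_cons he hl, cre_fockTensor]

theorem ann_ann_fockTensor_of_orthogonal (η : H) (hl : ∀ x ∈ l, inner ℂ e x = 0) :
    ann q e (ann q η (fockTensor q l)) = 0 := by
  rw [ann_fockTensor, map_sum]
  refine Finset.sum_eq_zero fun k _ => ?_
  rw [map_smul, ann_fockTensor_of_orthogonal (forall_mem_eraseIdx hl k), smul_zero]

theorem ann_fockTensor_cons_eq {η : H} (hη : inner ℂ e η = 0) (l : List H) :
    ann q η (fockTensor q (e :: l)) = ((q : ℝ) : ℂ) • cre q e (ann q η (fockTensor q l)) :=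
  ann_fockTensor_cons_of_orthogonal (by rw [← inner_conj_symm, hη, map_zero]) l

theorem ann_ann_fockTensor_cons (he : inner ℂ e e = 1) {η : H} (hη : inner ℂ e η = 0)
    (hl : ∀ x ∈ l, inner ℂ e x = 0) :
    ann q e (ann q η (fockTensor q (e :: l))) = ((q : ℝ) : ℂ) • ann q η (fockTensor q l) := by
  rw [ann_fockTensor_cons_eq hη, map_smul, ann_cre_apply, he,
    ann_ann_fockTensor_of_orthogonal η hl]
  simp

variable {S : H →L[ℂ] H}

/-- The term in which `S` acts on `e` vanishes. In the others one factor `q` comes from moving `S x`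
past `e`, and a second from annihilating `e` at the second place. -/
theorem ann_gau_fockTensor_cons (he : inner ℂ e e = 1)
    (hS : ∀ x y, inner ℂ (S x) y = inner ℂ x (S y)) (hSe : S e = 0)
    (hl : ∀ x ∈ l, inner ℂ e x = 0) :
    ann q e (gau q S (fockTensor q (e :: l))) =
      ((q : ℝ) : ℂ) ^ 2 • gau q S (fockTensor q l) := by
  have hSx : ∀ x, inner ℂ e (S x) = 0 := fun x => by rw [← hS, hSe, inner_zero_left]
  rw [gau_fockTensor_cons, hSe, fockTensor_zero_cons, zero_add, map_smul, map_sum,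
    gau_fockTensor, Finset.smul_sum, Finset.smul_sum]
  refine Finset.sum_congr rfl fun k _ => ?_
  rw [map_smul, ann_fockTensor_cons_cons he (hSx _) (forall_mem_eraseIdx hl k), smul_smul,
    smul_smul, smul_smul]
  congr 1
  ring

theorem ann_fieldOp_fockTensor_cons (he : inner ℂ e e = 1) {η : H} (hη : inner ℂ e η = 0)
    (hS : ∀ x y, inner ℂ (S x) y = inner ℂ x (S y)) (hSe : S e = 0)
    (hl : ∀ x ∈ l, inner ℂ e x = 0) :
    ann q e ((ann q η + cre q η + gau q S) (fockTensor q (e :: l))) =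
      (((q : ℝ) : ℂ) • (ann q η + cre q η) + ((q : ℝ) : ℂ) ^ 2 • gau q S) (fockTensor q l) := by
  simp only [add_apply, smul_apply, map_add, cre_fockTensor, smul_add,
    ann_ann_fockTensor_cons he hη hl, ann_fockTensor_cons_cons he hη hl,
    ann_gau_fockTensor_cons he hS hSe hl]

theorem ann_gau_cre_ann_fockTensor (he : inner ℂ e e = 1)
    (hS : ∀ x y, inner ℂ (S x) y = inner ℂ x (S y)) (hSe : S e = 0) (η : H)
    (hl : ∀ x ∈ l, inner ℂ e x = 0) :
    ann q e (gau q S (cre q e (ann q η (fockTensor q l)))) =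
      ((q : ℝ) : ℂ) ^ 2 • gau q S (ann q η (fockTensor q l)) := by
  rw [ann_fockTensor]
  simp only [map_sum, map_smul, cre_fockTensor, Finset.smul_sum]
  refine Finset.sum_congr rfl fun k _ => ?_
  rw [ann_gau_fockTensor_cons he hS hSe (forall_mem_eraseIdx hl k), smul_comm]

/-- If `S` hits `η`, then `e` stays second and costs `q`. If it hits a later factor, that factor
passes one more letter and `e` becomes third, in total `q³`. -/
theorem ann_gau_fockTensor_cons_cons (he : inner ℂ e e = 1) {η : H} (hη : inner ℂ e η = 0)
    (hS : ∀ x y, inner ℂ (S x) y = inner ℂ x (S y)) (hSe : S e = 0)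
    (hl : ∀ x ∈ l, inner ℂ e x = 0) :
    ann q e (gau q S (fockTensor q (η :: e :: l))) = ((q : ℝ) : ℂ) • fockTensor q (S η :: l) +
      ((q : ℝ) : ℂ) ^ 3 • (gau q S (fockTensor q (η :: l)) - fockTensor q (S η :: l)) := by
  have hSx : ∀ x, inner ℂ e (S x) = 0 := fun x => by rw [← hS, hSe, inner_zero_left]
  rw [gau_fockTensor_cons, gau_fockTensor_cons, add_sub_cancel_left, map_add, map_smul,
    ann_fockTensor_cons_cons he (hSx η) hl]
  congr 1
  have h := Fin.sum_univ_succ (n := l.length) fun k : Fin (l.length + 1) =>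
    (((q : ℝ) : ℂ) ^ (k : ℕ)) • fockTensor q (S ((e :: l).get k) :: η :: (e :: l).eraseIdx k)
  have h0 : S ((e :: l).get 0) = 0 := hSe
  rw [h0, fockTensor_zero_cons, smul_zero, zero_add] at h
  refine (congrArg (fun x => ((q : ℝ) : ℂ) • ann q e x) h).trans ?_
  rw [map_sum, Finset.smul_sum, smul_smul, Finset.smul_sum]
  refine Finset.sum_congr rfl fun k _ => ?_
  have h1 : fockTensor q (S ((e :: l).get k.succ) :: η :: (e :: l).eraseIdx (k.succ : ℕ)) =
    fockTensor q (S (l.get k) :: η :: e :: l.eraseIdx k) := rfl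
  rw [h1, map_smul, ann_fockTensor_cons_of_orthogonal (hSx _),
    ann_fockTensor_cons_cons he hη (forall_mem_eraseIdx hl k), map_smul, cre_fockTensor,
    smul_smul, smul_smul, smul_smul, smul_smul, Fin.val_succ]
  congr 1
  ring

/-- The creation of `S η` hidden in the product of gauge and Gaussian parts scales by `q`, and
everything else by `q³`. The different weights allow the creation operator to be isolated. -/
theorem ann_gau_mul_fockTensor_cons (he : inner ℂ e e = 1) {η : H} (hη : inner ℂ e η = 0)
    (hS : ∀ x y, inner ℂ (S x) y = inner ℂ x (S y)) (hSe : S e = 0)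
    (hl : ∀ x ∈ l, inner ℂ e x = 0) :
    ann q e ((gau q S * (ann q η + cre q η)) (fockTensor q (e :: l))) =
      (((q : ℝ) : ℂ) • cre q (S η) + ((q : ℝ) : ℂ) ^ 3 •
        (gau q S * (ann q η + cre q η) - cre q (S η))) (fockTensor q l) := by
  simp only [mul_apply_eq_comp, add_apply, sub_apply, smul_apply, map_add, cre_fockTensor,
    ann_fockTensor_cons_eq hη, map_smul, ann_gau_cre_ann_fockTensor he hS hSe η hl,
    ann_gau_fockTensor_cons_cons he hη hS hSe hl, smul_sub, smul_add, smul_smul]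
  have h : ((q : ℝ) : ℂ) * ((q : ℝ) : ℂ) ^ 2 = ((q : ℝ) : ℂ) ^ 3 := by ring
  rw [h]
  abel

end Compression

/-! ### Creation operators in the algebra of a non-Brownian process with `q ≠ 0` -/

section LevyProcess

open Filter Topology

variable (ν : Measure ℝ) [IsProbabilityMeasure ν] (q : Set.Ioo (-1 : ℝ) 1)
  (hν : CompactlySupported ν)

/-- The bounded operator `Y_k(t)` on the Fock space. -/
def levyOp (k : ℕ) (t : ℝ) : Fock q (OneParticle ν) →L[ℂ] Fock q (OneParticle ν) :=
  ann q (levyVector ν hν k t) + cre q (levyVector ν hν k t) + gau q (levyMul ν hν k t)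

theorem mem_levyOperators {A : Fock q (OneParticle ν) →L[ℂ] Fock q (OneParticle ν)} :
    A ∈ levyOperators ν q hν ↔ ∃ (k : ℕ) (t : ℝ), 1 ≤ k ∧ 0 ≤ t ∧ A = levyOp ν q hν k t := by
  have h : ∀ (k : ℕ) (t : ℝ) (v : AlgFock q (OneParticle ν)), levyOp ν q hν k t v =
      ((fieldOp q (levyVector ν hν k t) (levyMul ν hν k t) v : AlgFock q (OneParticle ν)) :
        Fock q (OneParticle ν)) := by
    intro k t v
    simp only [levyOp, fieldOp, add_apply, LinearMap.add_apply, ann_coe, cre_coe, gau_coe,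
      UniformSpace.Completion.coe_add]
  refine exists₂_congr fun k t => and_congr_right fun _ => and_congr_right fun _ => ?_
  refine ⟨fun hA => fock_ext_coe fun v => (hA v).trans (h k t v).symm, ?_⟩
  rintro rfl
  exact h k t

theorem star_levyOp (k : ℕ) (t : ℝ) : star (levyOp ν q hν k t) = levyOp ν q hν k t := by
  rw [levyOp, star_add, star_add, star_ann, star_cre, star_gau (inner_levyMul_left ν hν k t),
    add_comm (cre q _)]

theorem star_of_mem_levyOperators : ∀ A ∈ levyOperators ν q hν, star A = A := by
  intro A hA
  obtain ⟨k, t, -, -, rfl⟩ := (mem_levyOperators ν q hν).1 hA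
  exact star_levyOp ν q hν k t

theorem levyOp_mem {k : ℕ} {t : ℝ} (hk : 1 ≤ k) (ht : 0 ≤ t) :
    levyOp ν q hν k t ∈ levyVN ν q hν :=
  subset_vonNeumannGenerated (star_of_mem_levyOperators ν q hν)
    ((mem_levyOperators ν q hν).2 ⟨k, t, hk, ht, rfl⟩)

/-- The increment of `1_{[0,t)} ⊗ x^{k-1}` over `[n, n + 1)`. -/
def incVec (k n : ℕ) : OneParticle ν :=
  levyVector ν hν k ((n : ℝ) + 1) - levyVector ν hν k n

/-- The increment of the process over `[n, n + 1)`. -/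
def incOp (n : ℕ) : Fock q (OneParticle ν) →L[ℂ] Fock q (OneParticle ν) :=
  levyOp ν q hν 1 ((n : ℝ) + 1) - levyOp ν q hν 1 n

theorem incOp_eq (n : ℕ) : incOp ν q hν n = ann q (incVec ν hν 1 n) + cre q (incVec ν hν 1 n) +
    gau q (levyMul ν hν 1 ((n : ℝ) + 1) - levyMul ν hν 1 n) := by
  rw [incOp, levyOp, levyOp, incVec, ann_sub, cre_sub, gau_sub]
  abel

theorem incOp_mem (n : ℕ) : incOp ν q hν n ∈ levyVN ν q hν :=
  sub_mem (levyOp_mem ν q hν le_rfl (by positivity)) (levyOp_mem ν q hν le_rfl (by positivity))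

theorem star_incOp (n : ℕ) : star (incOp ν q hν n) = incOp ν q hν n := by
  rw [incOp, star_sub, star_levyOp, star_levyOp]

theorem inner_incVec_levyVector (j k n : ℕ) {t : ℝ} (ht : 0 ≤ t) (htn : t ≤ n) :
    inner ℂ (incVec ν hν j n) (levyVector ν hν k t) = 0 := by
  rw [incVec, inner_sub_left, inner_levyVector_levyVector ν hν _ _ (by positivity) ht,
    inner_levyVector_levyVector ν hν _ _ (by positivity) ht, min_eq_right (by linarith),
    min_eq_right htn, sub_self]

theorem levyMul_incVec (j k n : ℕ) (hj : 1 ≤ j) {t : ℝ} (htn : t ≤ n) :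
    levyMul ν hν k t (incVec ν hν j n) = 0 := by
  rw [incVec, map_sub, levyMul_levyVector ν hν _ _ hj, levyMul_levyVector ν hν _ _ hj,
    min_eq_left (by linarith), min_eq_left htn, sub_self]

theorem inner_incVec_incVec (k n : ℕ) :
    inner ℂ (incVec ν hν k n) (incVec ν hν k n) = ((∫ x, x ^ (k - 1 + (k - 1)) ∂ν : ℝ) : ℂ) := by
  have h : inner ℂ (incVec ν hν k n) (incVec ν hν k n) =
      inner ℂ (incVec ν hν k n) (levyVector ν hν k ((n : ℝ) + 1)) := by
    conv_lhs => rw [incVec, inner_sub_right, ← incVec,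
      inner_incVec_levyVector ν hν k k n (by positivity) le_rfl, sub_zero]
  rw [h, incVec, inner_sub_left, inner_levyVector_levyVector ν hν _ _ (by positivity) (by positivity),
    inner_levyVector_levyVector ν hν _ _ (by positivity) (by positivity), min_self,
    min_eq_left (by linarith)]
  push_cast
  ring

theorem inner_incVec_incVec_of_ne (k : ℕ) {m n : ℕ} (hmn : m ≠ n) :
    inner ℂ (incVec ν hν k m) (incVec ν hν k n) = 0 := by
  have h : ∀ {m n : ℕ}, m < n → inner ℂ (incVec ν hν k n) (incVec ν hν k m) = 0 := by
    intro m n hmn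
    have h' : (m : ℝ) + 1 ≤ n := by exact_mod_cast hmn
    conv_lhs => rw [incVec.eq_def ν hν k m, inner_sub_right,
      inner_incVec_levyVector ν hν k k n (by positivity) h',
      inner_incVec_levyVector ν hν k k n (by positivity) (by linarith), sub_zero]
  rcases lt_or_gt_of_ne hmn with h1 | h1
  · rw [← inner_conj_symm, h h1, map_zero]
  · exact h h1

theorem inner_incVec_one (n : ℕ) : inner ℂ (incVec ν hν 1 n) (incVec ν hν 1 n) = 1 := by
  rw [inner_incVec_incVec]
  simp

theorem exists_norm_incOp_le : ∃ C : ℝ, ∀ n, ‖incOp ν q hν n‖ ≤ C := by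
  obtain ⟨C, hC⟩ := exists_norm_levyMul_le ν hν 1
  have hq := one_sub_abs_pos q
  refine ⟨1 / √(1 - |(q : ℝ)|) + 1 / √(1 - |(q : ℝ)|) + (C + C) / (1 - |(q : ℝ)|), fun n => ?_⟩
  have h1 : ‖incVec ν hν 1 n‖ = 1 := by
    have h := inner_self_eq_norm_sq (𝕜 := ℂ) (incVec ν hν 1 n)
    rw [inner_incVec_one, RCLike.one_re] at h
    nlinarith [norm_nonneg (incVec ν hν 1 n)]
  rw [incOp_eq]
  refine (norm_add₃_le).trans (add_le_add (add_le_add ?_ ?_) ?_)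
  · exact (norm_ann_le _).trans_eq (by rw [h1])
  · exact (norm_cre_le _).trans_eq (by rw [h1])
  · refine (norm_gau_le _).trans (div_le_div_of_nonneg_right ?_ hq.le)
    exact (norm_sub_le _ _).trans (add_le_add (hC _) (hC _))

/-- Each factor lives on some `[0, t)`, so an increment over `[n, n + 1)` with `n ≥ t` does not meet
it. On such a tensor the increment acts as pure creation. -/
theorem eventually_forall_mem {l : List (OneParticle ν)} (hl : ∀ x ∈ l, x ∈ levyVectors ν hν) :
    ∀ᶠ n : ℕ in atTop, ∀ x ∈ l, inner ℂ (incVec ν hν 1 n) x = 0 ∧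
      (levyMul ν hν 1 ((n : ℝ) + 1) - levyMul ν hν 1 n) x = 0 := by
  induction l with
  | nil => simp
  | cons x l ih =>
    have h1 := ih fun y hy => hl y (List.mem_cons_of_mem _ hy)
    obtain ⟨k, t, hk, ht, rfl⟩ := hl x List.mem_cons_self
    obtain ⟨N, hN⟩ := exists_nat_ge t
    filter_upwards [h1, eventually_ge_atTop N] with n hn hNn
    have htn : t ≤ n := hN.trans (by exact_mod_cast hNn)
    rintro y hy
    rcases List.mem_cons.1 hy with rfl | hy
    · refine ⟨inner_incVec_levyVector ν hν 1 k n ht htn, ?_⟩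
      rw [sub_apply, levyMul_levyVector ν hν _ _ hk, levyMul_levyVector ν hν _ _ hk,
        min_eq_right (by linarith), min_eq_right htn, sub_self]
    · exact hn y hy

theorem incOp_fockTensor {l : List (OneParticle ν)} {n : ℕ}
    (hl : ∀ x ∈ l, inner ℂ (incVec ν hν 1 n) x = 0 ∧
      (levyMul ν hν 1 ((n : ℝ) + 1) - levyMul ν hν 1 n) x = 0) :
    incOp ν q hν n (fockTensor q l) = fockTensor q (incVec ν hν 1 n :: l) := by
  rw [incOp_eq, add_apply, add_apply, ann_fockTensor_of_orthogonal fun x hx => (hl x hx).1,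
    gau_fockTensor_of_forall_eq_zero fun x hx => (hl x hx).2, cre_fockTensor, zero_add, add_zero]

theorem closure_span_levy_fockTensor :
    (Submodule.span ℂ (fockTensor q '' {l | ∀ x ∈ l, x ∈ levyVectors ν hν})).topologicalClosure
      = ⊤ :=
  closure_span_fockTensor (closure_span_levyVector ν hν)

/-- Compressions of an element of the algebra by creation operators of far away increments lie in
the algebra. -/
theorem mem_levyVN_of_compression {Z A : Fock q (OneParticle ν) →L[ℂ] Fock q (OneParticle ν)}
    (hZ : Z ∈ levyVN ν q hν)
    (h : ∀ l : List (OneParticle ν), ∀ᶠ n : ℕ in atTop,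
      (∀ x ∈ l, inner ℂ (incVec ν hν 1 n) x = 0) →
      ann q (incVec ν hν 1 n) (Z (fockTensor q (incVec ν hν 1 n :: l))) = A (fockTensor q l)) :
    A ∈ levyVN ν q hν := by
  obtain ⟨C, hC⟩ := exists_norm_incOp_le ν q hν
  have hC0 : 0 ≤ C := (norm_nonneg _).trans (hC 0)
  refine mem_vonNeumann_of_tendsto _ (Z := fun n => incOp ν q hν n * Z * incOp ν q hν n)
    (fun n => mul_mem (mul_mem (incOp_mem ν q hν n) hZ) (incOp_mem ν q hν n)) ?_
  refine tendsto_inner_apply_of_total (C := C * ‖Z‖ * C) (fun n => ?_)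
    (closure_span_levy_fockTensor ν q hν) ?_
  · refine (norm_mul_le _ _).trans (mul_le_mul ((norm_mul_le _ _).trans ?_) (hC n)
      (norm_nonneg _) (by positivity))
    exact mul_le_mul_of_nonneg_right (hC n) (norm_nonneg _)
  · rintro _ ⟨l, hl, rfl⟩ _ ⟨l', hl', rfl⟩
    filter_upwards [eventually_forall_mem ν hν hl, eventually_forall_mem ν hν hl', h l']
      with n h1 h2 h3
    have h4 : ∀ x y, inner ℂ x (incOp ν q hν n y) = inner ℂ (incOp ν q hν n x) y := by
      intro x y
      conv_lhs => rw [← star_incOp]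
      exact ContinuousLinearMap.adjoint_inner_right _ _ _
    -- The matrix coefficient is `⟨e_n ⊗ l, Z (e_n ⊗ l')⟩`; moving the creation of `e_n` to the
    -- right gives `⟨l, A l'⟩`.
    rw [mul_apply_eq_comp, mul_apply_eq_comp, h4, incOp_fockTensor ν q hν h1,
      incOp_fockTensor ν q hν h2, ← cre_fockTensor, inner_cre_left, h3 fun x hx => (h2 x hx).1]

variable {q}

/-- Compressing `Y = G + P` gives `q G + q² P`. As `q² ≠ q`, this and `Y` determine both summands.
-/
theorem gau_and_gaussian_mem (hq : (q : ℝ) ≠ 0) {k : ℕ} {t : ℝ} (hk : 1 ≤ k) (ht : 0 ≤ t) :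
    gau q (levyMul ν hν k t) ∈ levyVN ν q hν ∧
      ann q (levyVector ν hν k t) + cre q (levyVector ν hν k t) ∈ levyVN ν q hν := by
  have hY := levyOp_mem ν q hν hk ht
  set G := ann q (levyVector ν hν k t) + cre q (levyVector ν hν k t) with hG
  set P := gau q (levyMul ν hν k t) with hP
  have hA : ((q : ℝ) : ℂ) • G + ((q : ℝ) : ℂ) ^ 2 • P ∈ levyVN ν q hν := by
    refine mem_levyVN_of_compression ν q hν hY fun l => ?_
    obtain ⟨N, hN⟩ := exists_nat_ge t
    filter_upwards [eventually_ge_atTop N] with n hn hl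
    have htn : t ≤ n := hN.trans (by exact_mod_cast hn)
    exact ann_fieldOp_fockTensor_cons (inner_incVec_one ν hν n)
      (inner_incVec_levyVector ν hν 1 k n ht htn) (inner_levyMul_left ν hν k t)
      (levyMul_incVec ν hν 1 k n le_rfl htn) hl
  have hne : ((q : ℝ) : ℂ) ^ 2 - ((q : ℝ) : ℂ) ≠ 0 := by
    have h1 : (q : ℝ) ^ 2 - (q : ℝ) ≠ 0 := by
      rw [sq, ← mul_sub_one]
      exact mul_ne_zero hq (sub_ne_zero.2 q.2.2.ne)
    exact_mod_cast h1
  have hPm : P ∈ levyVN ν q hν := by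
    have h := smul_mem_vonNeumann _ (((q : ℝ) : ℂ) ^ 2 - ((q : ℝ) : ℂ))⁻¹
      (sub_mem hA (smul_mem_vonNeumann _ ((q : ℝ) : ℂ) hY))
    have h2 : (((q : ℝ) : ℂ) • G + ((q : ℝ) : ℂ) ^ 2 • P) - ((q : ℝ) : ℂ) • levyOp ν q hν k t =
        (((q : ℝ) : ℂ) ^ 2 - ((q : ℝ) : ℂ)) • P := by
      rw [show levyOp ν q hν k t = G + P from rfl, sub_smul, smul_add _ G P]
      abel
    rwa [h2, smul_smul, inv_mul_cancel₀ hne, one_smul] at h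
  refine ⟨hPm, ?_⟩
  have h := sub_mem hY hPm
  rwa [levyOp, ← hG, ← hP, add_sub_cancel_right] at h

/-- Compressing `P G` and subtracting `q³ P G` leaves `(q - q³)` times the creation of `1_{[0,t)} ⊗
x`, with a nonzero coefficient. -/
theorem cre_mem (hq : (q : ℝ) ≠ 0) {t : ℝ} (ht : 0 ≤ t) :
    cre q (levyVector ν hν 2 t) ∈ levyVN ν q hν := by
  obtain ⟨hP, hG⟩ := gau_and_gaussian_mem ν hν hq le_rfl ht
  have hPG := mul_mem hP hG
  have hS : levyMul ν hν 1 t (levyVector ν hν 1 t) = levyVector ν hν 2 t := by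
    rw [levyMul_levyVector ν hν 1 1 le_rfl, min_self]
  have hA : ((q : ℝ) : ℂ) • cre q (levyVector ν hν 2 t) + ((q : ℝ) : ℂ) ^ 3 •
      (gau q (levyMul ν hν 1 t) * (ann q (levyVector ν hν 1 t) + cre q (levyVector ν hν 1 t)) -
        cre q (levyVector ν hν 2 t)) ∈ levyVN ν q hν := by
    refine mem_levyVN_of_compression ν q hν hPG fun l => ?_
    obtain ⟨N, hN⟩ := exists_nat_ge t
    filter_upwards [eventually_ge_atTop N] with n hn hl
    have htn : t ≤ n := hN.trans (by exact_mod_cast hn)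
    rw [← hS]
    exact ann_gau_mul_fockTensor_cons (inner_incVec_one ν hν n)
      (inner_incVec_levyVector ν hν 1 1 n ht htn) (inner_levyMul_left ν hν 1 t)
      (levyMul_incVec ν hν 1 1 n le_rfl htn) hl
  have hne : ((q : ℝ) : ℂ) - ((q : ℝ) : ℂ) ^ 3 ≠ 0 := by
    have h1 : (q : ℝ) - (q : ℝ) ^ 3 ≠ 0 := by
      have : (q : ℝ) - (q : ℝ) ^ 3 = q * ((1 - q) * (1 + q)) := by ring
      rw [this]
      exact mul_ne_zero hq (mul_ne_zero (by linarith [q.2.2]) (by linarith [q.2.1]))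
    exact_mod_cast h1
  have h := smul_mem_vonNeumann _ (((q : ℝ) : ℂ) - ((q : ℝ) : ℂ) ^ 3)⁻¹
    (sub_mem hA (smul_mem_vonNeumann _ (((q : ℝ) : ℂ) ^ 3) hPG))
  rw [smul_sub (((q : ℝ) : ℂ) ^ 3), ← add_sub_assoc, add_sub_right_comm, add_sub_cancel_right,
    ← sub_smul, smul_smul, inv_mul_cancel₀ hne, one_smul] at h
  exact h

theorem cre_incVec_mem (hq : (q : ℝ) ≠ 0) (n : ℕ) : cre q (incVec ν hν 2 n) ∈ levyVN ν q hν := by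
  rw [incVec, cre_sub]
  exact sub_mem (cre_mem ν hν hq (by positivity)) (cre_mem ν hν hq (by positivity))

theorem inner_vacuum_vacuum {H : Type*} [NormedAddCommGroup H] [InnerProductSpace ℂ H] :
    inner ℂ (fockTensor q ([] : List H)) (fockTensor q ([] : List H)) = (1 : ℂ) := by
  rw [fockTensor, UniformSpace.Completion.inner_coe, inner_tensor,
    qKernel_eq_sum (n := 0) _ rfl rfl]
  simp [inversions_eq_sum]

theorem fockTensor_nil_ne_zero {H : Type*} [NormedAddCommGroup H] [InnerProductSpace ℂ H] :
    fockTensor q ([] : List H) ≠ 0 := by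
  intro h
  have h1 := inner_vacuum_vacuum (q := q) (H := H)
  rw [h, inner_zero_left] at h1
  exact zero_ne_one h1

theorem infinite_without_trace (hq : (q : ℝ) ≠ 0) (hB : ¬ IsBrownian ν) :
    (¬ ∃ τ : (levyVN ν q hν).toStarSubalgebra →ₗ[ℂ] ℂ, IsNormalTracialState (levyVN ν q hν) τ) ∧
      IsInfiniteVN (levyVN ν q hν) := by
  have hc : 0 < ∫ x, x ^ 2 ∂ν := by
    refine lt_of_le_of_ne (integral_nonneg fun x => sq_nonneg x) fun h => hB ?_
    exact (isBrownian_iff ν hν).2 ((integral_sq_eq_zero_iff ν hν).1 h.symm)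
  set c := ∫ x, x ^ 2 ∂ν with hc'
  have hin : ∀ n, inner ℂ (incVec ν hν 2 n) (incVec ν hν 2 n) = (c : ℂ) := fun n => by
    rw [inner_incVec_incVec]
  have hnorm : ∀ n, ‖incVec ν hν 2 n‖ ^ 2 = c := fun n => by
    rw [← inner_self_eq_norm_sq (𝕜 := ℂ), hin]
    exact Complex.ofReal_re c
  refine ⟨?_, ?_⟩
  · refine not_exists_trace (A := fun n => cre q (incVec ν hν 2 n))
      (fun n => cre_incVec_mem ν hν hq n) hc q.2.2 (C := c / (1 - |(q : ℝ)|)) (fun n => ?_)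
      fun N ξ => ?_
    · rw [star_cre, ann_mul_cre, hin]
    · rw [← Fin.sum_univ_eq_sum_range fun n => ‖star (cre q (incVec ν hν 2 n)) ξ‖ ^ 2]
      simp only [star_cre]
      refine sum_norm_ann_sq_le (fun i : Fin N => incVec ν hν 2 i) (fun i j hij => ?_) hc.le
        (fun i => (hnorm i).le) ξ
      exact inner_incVec_incVec_of_ne ν hν 2 fun h => hij (Fin.ext h)
  · refine isInfiniteVN_of_bounded_below (cre_incVec_mem ν hν hq 0)
      (mul_pos (one_sub_abs_pos q) hc) (fun ξ => ?_) fockTensor_nil_ne_zero ?_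
    · rw [← hnorm 0]
      exact le_norm_cre_sq _ _
    · rw [star_cre, ann_vacuum]

end LevyProcess

/-! ### Right operators and their commutation with left operators -/

section RightOperators

variable {q : Set.Ioo (-1 : ℝ) 1} {H : Type*} [NormedAddCommGroup H] [InnerProductSpace ℂ H]

/-- The right version of an operator on the Fock space. -/
def rightOp (A : Fock q H →L[ℂ] Fock q H) : Fock q H →L[ℂ] Fock q H := rev q H * A * rev q H

theorem rightOp_apply (A : Fock q H →L[ℂ] Fock q H) (x : Fock q H) :
    rightOp A x = rev q H (A (rev q H x)) := rfl

theorem star_rightOp (A : Fock q H →L[ℂ] Fock q H) : star (rightOp A) = rightOp (star A) := by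
  rw [rightOp, star_mul, star_mul, star_rev, ← mul_assoc, rightOp]

theorem rightOp_mul (A B : Fock q H →L[ℂ] Fock q H) :
    rightOp (A * B) = rightOp A * rightOp B := by
  ext x
  simp [rightOp_apply]

theorem rightOp_add (A B : Fock q H →L[ℂ] Fock q H) :
    rightOp (A + B) = rightOp A + rightOp B := by
  rw [rightOp, mul_add, add_mul, rightOp, rightOp]

theorem rightOp_sub (A B : Fock q H →L[ℂ] Fock q H) :
    rightOp (A - B) = rightOp A - rightOp B := by
  rw [rightOp, mul_sub, sub_mul, rightOp, rightOp]

@[simp] theorem rightOp_cre_fockTensor (ζ : H) (l : List H) :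
    rightOp (cre q ζ) (fockTensor q l) = fockTensor q (l ++ [ζ]) := by
  simp [rightOp_apply]

theorem cre_mul_rightOp_cre (ζ η : H) :
    cre q ζ * rightOp (cre q η) = rightOp (cre q η) * cre q ζ :=
  fock_ext fun l => by simp

theorem ann_mul_rightOp_ann (ζ η : H) :
    ann q ζ * rightOp (ann q η) = rightOp (ann q η) * ann q ζ := by
  have h := congrArg star (cre_mul_rightOp_cre (q := q) ζ η)
  rw [star_mul, star_mul, star_rightOp, star_cre, star_cre] at h
  exact h.symm

/-- Left annihilation and right creation fail to commute only through the contraction of the last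
factor, which lies behind `l.length` letters. -/
theorem ann_fockTensor_append (ζ η : H) (l : List H) :
    ann q ζ (fockTensor q (l ++ [η])) = rightOp (cre q η) (ann q ζ (fockTensor q l)) +
      (((q : ℝ) : ℂ) ^ l.length * inner ℂ ζ η) • fockTensor q l := by
  induction l with
  | nil => simp [ann_fockTensor_cons]
  | cons x l ih =>
    have h : ∀ y, cre q x (rightOp (cre q η) y) = rightOp (cre q η) (cre q x y) :=
      fun y => DFunLike.congr_fun (cre_mul_rightOp_cre x η) y
    rw [List.cons_append, ann_fockTensor_cons, ih, ann_fockTensor_cons]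
    simp only [map_add, map_smul, cre_fockTensor, rightOp_cre_fockTensor, h, smul_add, smul_smul,
      List.length_cons, pow_succ', mul_assoc, add_assoc]

theorem rightOp_ann_fockTensor_cons (ζ η : H) (l : List H) :
    rightOp (ann q ζ) (fockTensor q (η :: l)) = cre q η (rightOp (ann q ζ) (fockTensor q l)) +
      (((q : ℝ) : ℂ) ^ l.length * inner ℂ ζ η) • fockTensor q l := by
  rw [rightOp_apply, rev_fockTensor, List.reverse_cons, ann_fockTensor_append, map_add,
    rightOp_apply, rightOp_apply]
  simp

/-- The two mixed commutators contribute `q^m ⟨ζ, η⟩` and `-q^m ⟨η, ζ⟩` on tensors of degree `m`;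
they cancel when the inner product is symmetric. -/
theorem gaussian_mul_rightOp_gaussian {ζ η : H} (h : inner ℂ ζ η = inner ℂ η ζ) :
    (ann q ζ + cre q ζ) * rightOp (ann q η + cre q η) =
      rightOp (ann q η + cre q η) * (ann q ζ + cre q ζ) := by
  refine fock_ext fun l => ?_
  have h1 : ∀ y, ann q ζ (rightOp (ann q η) y) = rightOp (ann q η) (ann q ζ y) :=
    fun y => DFunLike.congr_fun (ann_mul_rightOp_ann ζ η) y
  have h2 : ∀ y, cre q ζ (rightOp (cre q η) y) = rightOp (cre q η) (cre q ζ y) :=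
    fun y => DFunLike.congr_fun (cre_mul_rightOp_cre ζ η) y
  simp only [rightOp_add, mul_apply_eq_comp, add_apply, map_add, h1, h2]
  have h3 := ann_fockTensor_append (q := q) ζ η l
  have h4 := rightOp_ann_fockTensor_cons (q := q) η ζ l
  rw [← rightOp_cre_fockTensor] at h3
  rw [← cre_fockTensor] at h4
  rw [h3, h4, h]
  abel

/-- For `q = 0` a left operator sees only the first letter and a right one only the last, so they
interact only in degrees `0` and `1`. There the conditions linking `ζ`, `η`, `S` and `T` are what
commutation requires. -/
theorem field_mul_rightOp_field_of_eq_zero (hq : (q : ℝ) = 0) {ζ η : H} {S T : H →L[ℂ] H}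
    (h : inner ℂ ζ η = inner ℂ η ζ) (hST : S * T = T * S) (hζη : S η = T ζ)
    (hS : ∀ x y, inner ℂ (S x) y = inner ℂ x (S y))
    (hT : ∀ x y, inner ℂ (T x) y = inner ℂ x (T y)) :
    (ann q ζ + cre q ζ + gau q S) * rightOp (ann q η + cre q η + gau q T) =
      rightOp (ann q η + cre q η + gau q T) * (ann q ζ + cre q ζ + gau q S) := by
  have hST' : ∀ x, S (T x) = T (S x) := fun x => DFunLike.congr_fun hST x
  have hL : ∀ (ξ : H) (R : H →L[ℂ] H) (x : H) (m : List H),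
      (ann q ξ + cre q ξ + gau q R) (fockTensor q (x :: m)) = inner ℂ ξ x • fockTensor q m +
        fockTensor q (ξ :: x :: m) + fockTensor q (R x :: m) := by
    intro ξ R x m
    simp [ann_fockTensor_cons, gau_fockTensor_cons, hq]
  have hL0 : ∀ (ξ : H) (R : H →L[ℂ] H),
      (ann q ξ + cre q ξ + gau q R) (fockTensor q []) = fockTensor q [ξ] := by
    intro ξ R
    simp
  have hR : ∀ (ξ : H) (R : H →L[ℂ] H) (x : H) (m : List H),
      rightOp (ann q ξ + cre q ξ + gau q R) (fockTensor q (m ++ [x])) =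
        inner ℂ ξ x • fockTensor q m + fockTensor q (m ++ [x, ξ]) + fockTensor q (m ++ [R x]) := by
    intro ξ R x m
    rw [rightOp_apply, rev_fockTensor, List.reverse_append, List.reverse_singleton,
      List.singleton_append, hL]
    simp
  have hR0 : ∀ (ξ : H) (R : H →L[ℂ] H),
      rightOp (ann q ξ + cre q ξ + gau q R) (fockTensor q []) = fockTensor q [ξ] := by
    intro ξ R
    rw [rightOp_apply, rev_fockTensor, List.reverse_nil, hL0]
    simp
  have hR1 : ∀ (ξ : H) (R : H →L[ℂ] H) (x : H),
      rightOp (ann q ξ + cre q ξ + gau q R) (fockTensor q [x]) =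
        inner ℂ ξ x • fockTensor q [] + fockTensor q [x, ξ] + fockTensor q [R x] :=
    fun ξ R x => hR ξ R x []
  have hR2 : ∀ (ξ : H) (R : H →L[ℂ] H) (x y : H),
      rightOp (ann q ξ + cre q ξ + gau q R) (fockTensor q [y, x]) =
        inner ℂ ξ x • fockTensor q [y] + fockTensor q [y, x, ξ] + fockTensor q [y, R x] :=
    fun ξ R x y => hR ξ R x [y]
  refine fock_ext fun l => ?_
  rw [mul_apply_eq_comp, mul_apply_eq_comp]
  rcases l with _ | ⟨x, l⟩
  · rw [hL0, hR0, hL, hR1, h, hζη]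
  · rcases l.eq_nil_or_concat with rfl | ⟨m, y, rfl⟩
    · rw [hL, hR1]
      simp only [map_add, map_smul, hL0, hR0, hL, hR1, hR2, hST' x]
      rw [show inner ℂ ζ (T x) = inner ℂ η (S x) by rw [← hT, ← hζη, hS]]
      abel
    · rw [List.concat_eq_append]
      have hR3 : ∀ x : H, rightOp (ann q η + cre q η + gau q T) (fockTensor q (x :: (m ++ [y]))) =
          inner ℂ η y • fockTensor q (x :: m) + fockTensor q (x :: (m ++ [y, η])) +
            fockTensor q (x :: (m ++ [T y])) := fun x => hR η T y (x :: m)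
      have hR4 : rightOp (ann q η + cre q η + gau q T) (fockTensor q (ζ :: x :: (m ++ [y]))) =
          inner ℂ η y • fockTensor q (ζ :: x :: m) + fockTensor q (ζ :: x :: (m ++ [y, η])) +
            fockTensor q (ζ :: x :: (m ++ [T y])) := hR η T y (ζ :: x :: m)
      rw [hL, hR3]
      simp only [map_add, map_smul, hR, hL, hR3, hR4]
      module

end RightOperators

/-! ### The vacuum trace and factoriality -/

section Finite

open Filter Topology

variable (ν : Measure ℝ) [IsProbabilityMeasure ν] (q : Set.Ioo (-1 : ℝ) 1)
  (hν : CompactlySupported ν)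

theorem levyOp_vacuum (k : ℕ) (t : ℝ) :
    levyOp ν q hν k t (fockTensor q []) = fockTensor q [levyVector ν hν k t] := by
  simp [levyOp]

theorem rightOp_levyOp_vacuum (k : ℕ) (t : ℝ) :
    rightOp (levyOp ν q hν k t) (fockTensor q []) = levyOp ν q hν k t (fockTensor q []) := by
  rw [levyOp_vacuum, rightOp_apply, rev_fockTensor, List.reverse_nil, levyOp_vacuum,
    rev_fockTensor, List.reverse_singleton]

/-- The algebra generated by the operators `Y_k(t)`. -/
def levyAlg : Subalgebra ℂ (Fock q (OneParticle ν) →L[ℂ] Fock q (OneParticle ν)) :=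
  Algebra.adjoin ℂ (levyOperators ν q hν)

theorem levyAlg_mem_levyVN {y : Fock q (OneParticle ν) →L[ℂ] Fock q (OneParticle ν)}
    (hy : y ∈ levyAlg ν q hν) : y ∈ levyVN ν q hν := by
  have h : levyAlg ν q hν ≤ (levyVN ν q hν).toStarSubalgebra.toSubalgebra :=
    Algebra.adjoin_le fun A hA =>
      subset_vonNeumannGenerated (star_of_mem_levyOperators ν q hν) hA
  exact h hy

/-- Applied to a tensor, `Y_k(t)` creates the wanted factor plus terms of no larger degree than that
tensor. These are again built from process vectors, which multiplication by `1_{[0,t)} ⊗ x^k`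
permutes among themselves up to shorter times. The bound `n` lets the induction hypothesis cover
these other lists. -/
theorem fockTensor_mem_levyAlg_vacuum (n : ℕ) (l : List (OneParticle ν)) (hn : l.length ≤ n)
    (hl : ∀ x ∈ l, x ∈ levyVectors ν hν) : ∃ y ∈ levyAlg ν q hν, y (fockTensor q []) =
      fockTensor q l := by
  let K : Submodule ℂ (Fock q (OneParticle ν)) := (Subalgebra.toSubmodule (levyAlg ν q hν)).map
    (ContinuousLinearMap.apply ℂ _ (fockTensor q ([] : List (OneParticle ν)))).toLinearMap
  change fockTensor q l ∈ K
  induction n generalizing l with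
  | zero =>
    obtain rfl : l = [] := List.length_eq_zero_iff.1 (Nat.le_zero.1 hn)
    exact ⟨1, (Subalgebra.mem_toSubmodule _).2 (one_mem _), rfl⟩
  | succ n ih =>
    rcases l with _ | ⟨x, l⟩
    · exact ⟨1, (Subalgebra.mem_toSubmodule _).2 (one_mem _), rfl⟩
    obtain ⟨k, t, hk, ht, rfl⟩ := hl x List.mem_cons_self
    have hn' : l.length ≤ n := by simpa using hn
    have hl' : ∀ y ∈ l, y ∈ levyVectors ν hν := fun y hy => hl y (List.mem_cons_of_mem _ hy)
    have h1 : levyOp ν q hν k t (fockTensor q l) ∈ K := by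
      obtain ⟨y, hy, hyl⟩ := ih l hn' hl'
      refine ⟨levyOp ν q hν k t * y, ?_, ?_⟩
      · exact (Subalgebra.mem_toSubmodule _).2 (mul_mem
          (Algebra.subset_adjoin ((mem_levyOperators ν q hν).2 ⟨k, t, hk, ht, rfl⟩)) hy)
      · rw [← hyl]; rfl
    have h2 : ann q (levyVector ν hν k t) (fockTensor q l) ∈ K := by
      rw [ann_fockTensor]
      refine Submodule.sum_mem _ fun j _ => Submodule.smul_mem _ _ (ih _ ?_ ?_)
      · exact (List.length_eraseIdx_le _ _).trans hn'
      · exact forall_mem_eraseIdx hl' j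
    have h3 : gau q (levyMul ν hν k t) (fockTensor q l) ∈ K := by
      rw [gau_fockTensor]
      refine Submodule.sum_mem _ fun j _ => Submodule.smul_mem _ _ (ih _ ?_ ?_)
      · rw [List.length_cons, List.length_eraseIdx_of_lt j.2]
        have := j.2
        omega
      · intro x hx
        rcases List.mem_cons.1 hx with rfl | hx
        · obtain ⟨k', t', hk', ht', he⟩ := hl' _ (l.get_mem j)
          rw [he, levyMul_levyVector ν hν k k' hk']
          exact ⟨k + k', min t t', by omega, le_min ht ht', rfl⟩
        · exact forall_mem_eraseIdx hl' j x hx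
    have h4 : fockTensor q (levyVector ν hν k t :: l) = levyOp ν q hν k t (fockTensor q l) -
        ann q (levyVector ν hν k t) (fockTensor q l) -
        gau q (levyMul ν hν k t) (fockTensor q l) := by
      rw [levyOp, add_apply, add_apply, cre_fockTensor]
      abel
    rw [h4]
    exact sub_mem (sub_mem h1 h2) h3

/-- The vacuum is cyclic. -/
theorem closure_span_levyAlg_vacuum :
    (Submodule.span ℂ {ξ | ∃ y ∈ levyAlg ν q hν, y (fockTensor q []) = ξ}).topologicalClosure
      = ⊤ := by
  rw [eq_top_iff, ← closure_span_levy_fockTensor ν q hν]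
  refine Submodule.topologicalClosure_mono (Submodule.span_mono ?_)
  rintro _ ⟨l, hl, rfl⟩
  exact fockTensor_mem_levyAlg_vacuum ν q hν _ l le_rfl hl

theorem incOp_vacuum (n : ℕ) :
    incOp ν q hν n (fockTensor q []) = fockTensor q [incVec ν hν 1 n] :=
  incOp_fockTensor ν q hν (by simp)

variable {q}

theorem levyOp_mul_rightOp_levyOp (hcase : (q : ℝ) = 0 ∨ IsBrownian ν) {k l : ℕ} {s t : ℝ}
    (hk : 1 ≤ k) (hl : 1 ≤ l) (hs : 0 ≤ s) (ht : 0 ≤ t) :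
    levyOp ν q hν k s * rightOp (levyOp ν q hν l t) =
      rightOp (levyOp ν q hν l t) * levyOp ν q hν k s := by
  have h : inner ℂ (levyVector ν hν k s) (levyVector ν hν l t) =
      inner ℂ (levyVector ν hν l t) (levyVector ν hν k s) := by
    rw [inner_levyVector_levyVector ν hν k l hs ht, inner_levyVector_levyVector ν hν l k ht hs,
      min_comm, add_comm (k - 1)]
  rcases hcase with hq | hB
  · refine field_mul_rightOp_field_of_eq_zero hq h (levyMul_comm ν hν k l s t) ?_
      (inner_levyMul_left ν hν k s) (inner_levyMul_left ν hν l t)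
    rw [levyMul_levyVector ν hν k l hl, levyMul_levyVector ν hν l k hk, min_comm, add_comm]
  · have h0 : gau q (0 : OneParticle ν →L[ℂ] OneParticle ν) = 0 := by
      simpa using gau_sub (q := q) (0 : OneParticle ν →L[ℂ] OneParticle ν) 0
    rw [levyOp, levyOp, levyMul_eq_zero_of_isBrownian ν hν hB hk,
      levyMul_eq_zero_of_isBrownian ν hν hB hl, h0, add_zero, add_zero]
    exact gaussian_mul_rightOp_gaussian h

section Commutant

variable (hcase : (q : ℝ) = 0 ∨ IsBrownian ν)
include hcase

theorem rightOp_levyOp_mul {k : ℕ} {t : ℝ} (hk : 1 ≤ k) (ht : 0 ≤ t)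
    {A : Fock q (OneParticle ν) →L[ℂ] Fock q (OneParticle ν)} (hA : A ∈ levyVN ν q hν) :
    rightOp (levyOp ν q hν k t) * A = A * rightOp (levyOp ν q hν k t) := by
  refine (mem_vonNeumannGenerated (star_of_mem_levyOperators ν q hν)).1 hA _ fun s hs => ?_
  obtain ⟨j, r, hj, hr, rfl⟩ := (mem_levyOperators ν q hν).1 hs
  exact levyOp_mul_rightOp_levyOp ν hν hcase hj hk hr ht

theorem rightOp_levyAlg_mul {y : Fock q (OneParticle ν) →L[ℂ] Fock q (OneParticle ν)}
    (hy : y ∈ levyAlg ν q hν) {A : Fock q (OneParticle ν) →L[ℂ] Fock q (OneParticle ν)}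
    (hA : A ∈ levyVN ν q hν) : rightOp y * A = A * rightOp y := by
  induction hy using Algebra.adjoin_induction with
  | mem s hs =>
    obtain ⟨k, t, hk, ht, rfl⟩ := (mem_levyOperators ν q hν).1 hs
    exact rightOp_levyOp_mul ν hν hcase hk ht hA
  | algebraMap c =>
    ext x
    simp [rightOp_apply, Algebra.algebraMap_eq_smul_one]
  | add y z _ _ hy hz => rw [rightOp_add, add_mul, mul_add, hy, hz]
  | mul y z _ _ hy hz => rw [rightOp_mul, mul_assoc, hz, ← mul_assoc, hy, mul_assoc]

/-- The vacuum is separating. -/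
theorem eq_zero_of_apply_vacuum {A : Fock q (OneParticle ν) →L[ℂ] Fock q (OneParticle ν)}
    (hA : A ∈ levyVN ν q hν) (hAΩ : A (fockTensor q []) = 0) : A = 0 := by
  have h : (⊤ : Submodule ℂ (Fock q (OneParticle ν))) ≤
      (A * rev q (OneParticle ν)).toLinearMap.ker := by
    rw [← closure_span_levyAlg_vacuum ν q hν]
    refine Submodule.topologicalClosure_minimal _ (Submodule.span_le.2 ?_)
      (A * rev q (OneParticle ν)).isClosed_ker
    rintro _ ⟨y, hy, rfl⟩
    -- The reversal of `y Ω` is the right copy of `y` applied to `Ω`, and `A` can be moved past this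
    -- copy onto `Ω`.
    have h1 := DFunLike.congr_fun (rightOp_levyAlg_mul ν hν hcase hy hA) (fockTensor q [])
    rw [mul_apply_eq_comp, mul_apply_eq_comp, hAΩ, map_zero, rightOp_apply, rev_fockTensor] at h1
    exact h1.symm
  ext x
  have h1 : (A * rev q (OneParticle ν)) (rev q (OneParticle ν) x) = 0 := h Submodule.mem_top
  simpa using h1

/-- The vacuum state is tracial. -/
theorem inner_vacuum_comm {y : Fock q (OneParticle ν) →L[ℂ] Fock q (OneParticle ν)}
    (hy : y ∈ levyAlg ν q hν) {A : Fock q (OneParticle ν) →L[ℂ] Fock q (OneParticle ν)}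
    (hA : A ∈ levyVN ν q hν) :
    inner ℂ (fockTensor q []) (y (A (fockTensor q []))) =
      inner ℂ (fockTensor q []) (A (y (fockTensor q []))) := by
  induction hy using Algebra.adjoin_induction generalizing A with
  | mem s hs =>
    obtain ⟨k, t, hk, ht, rfl⟩ := (mem_levyOperators ν q hν).1 hs
    have hs1 : ∀ x y, inner ℂ x (levyOp ν q hν k t y) = inner ℂ (levyOp ν q hν k t x) y := by
      intro x y
      conv_lhs => rw [← star_levyOp]
      exact ContinuousLinearMap.adjoint_inner_right _ _ _
    have hs2 : ∀ x y, inner ℂ (rightOp (levyOp ν q hν k t) x) y =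
        inner ℂ x (rightOp (levyOp ν q hν k t) y) := by
      intro x y
      conv_rhs => rw [← star_levyOp, ← star_rightOp]
      exact (ContinuousLinearMap.adjoint_inner_right _ _ _).symm
    -- On the vacuum a generator may be exchanged for its right copy, which commutes with `A`; the
    -- copy is moved across and exchanged back.
    rw [hs1, ← rightOp_levyOp_vacuum, hs2]
    exact congrArg _ (DFunLike.congr_fun (rightOp_levyOp_mul ν hν hcase hk ht hA) _)
  | algebraMap c => simp [Algebra.algebraMap_eq_smul_one]
  | add y z _ _ hy hz => simp only [add_apply, map_add, inner_add_right, hy hA, hz hA]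
  | mul y z hy' hz' hy hz =>
    have h1 := hy (mul_mem (levyAlg_mem_levyVN ν q hν hz') hA)
    have h2 := hz (mul_mem hA (levyAlg_mem_levyVN ν q hν hy'))
    simp only [mul_apply_eq_comp] at h1 h2 ⊢
    rw [h1, h2]

/-- For an isometry `v`, traciality should give `‖v* Ω‖ = ‖v Ω‖ = ‖Ω‖`, so that `v v*` fixes `Ω` and
equals `1` since `Ω` is separating. The trace property is at hand only with one factor in `levyAlg`,
so the needed inequality is first proved against vectors `y Ω` and then extended by density. -/
theorem isFiniteVN_levyVN : IsFiniteVN (levyVN ν q hν) := by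
  intro v hv hv1
  set Ω := fockTensor q ([] : List (OneParticle ν)) with hΩ
  have hadj : ∀ (B : Fock q (OneParticle ν) →L[ℂ] Fock q (OneParticle ν)) (x y),
      inner ℂ x (B y) = inner ℂ (star B x) y := fun B x y =>
    (ContinuousLinearMap.adjoint_inner_left B y x).symm
  have hadj' : ∀ (B : Fock q (OneParticle ν) →L[ℂ] Fock q (OneParticle ν)) (x y),
      inner ℂ x (star B y) = inner ℂ (B x) y := fun B x y => by rw [hadj, star_star]
  have hiso : ∀ x, star v (v x) = x := fun x => DFunLike.congr_fun hv1 x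
  have hnorm : ∀ x, ‖v x‖ = ‖x‖ := by
    intro x
    rw [@norm_eq_sqrt_re_inner ℂ, ← hadj', hiso, ← @norm_eq_sqrt_re_inner ℂ]
  have hbound : ∀ y ∈ levyAlg ν q hν, ‖(inner ℂ (v Ω) (y Ω) : ℂ)‖ ≤ ‖star v Ω‖ * ‖y Ω‖ := by
    intro y hy
    have h1 : ‖star y Ω‖ = ‖y Ω‖ := by
      rw [@norm_eq_sqrt_re_inner ℂ, ← hadj, inner_vacuum_comm ν hν hcase hy
        (star_mem (levyAlg_mem_levyVN ν q hν hy)), hadj', ← @norm_eq_sqrt_re_inner ℂ]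
    rw [← hadj', ← inner_vacuum_comm ν hν hcase hy (star_mem hv), hadj, ← h1, mul_comm]
    exact norm_inner_le_norm _ _
  have hclosed : ∀ x, ‖(inner ℂ (v Ω) x : ℂ)‖ ≤ ‖star v Ω‖ * ‖x‖ := by
    have hd : Dense {ξ | ∃ y ∈ levyAlg ν q hν, y Ω = ξ} := by
      have h2 := closure_span_levyAlg_vacuum ν q hν
      rw [← Submodule.dense_iff_topologicalClosure_eq_top] at h2
      refine h2.mono fun x hx => ?_
      let K : Submodule ℂ (Fock q (OneParticle ν)) :=
        (Subalgebra.toSubmodule (levyAlg ν q hν)).map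
          (ContinuousLinearMap.apply ℂ _ Ω).toLinearMap
      have h3 : Submodule.span ℂ {ξ | ∃ y ∈ levyAlg ν q hν, y Ω = ξ} ≤ K :=
        Submodule.span_le.2 fun ξ hξ => hξ
      exact h3 hx
    intro x
    refine hd.induction (P := fun x => ‖(inner ℂ (v Ω) x : ℂ)‖ ≤ ‖star v Ω‖ * ‖x‖) ?_ ?_ x
    · rintro _ ⟨y, hy, rfl⟩
      exact hbound y hy
    · exact isClosed_le (by fun_prop) (by fun_prop)
  have hΩ0 : 0 < ‖Ω‖ := norm_pos_iff.2 fockTensor_nil_ne_zero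
  have hle : ‖Ω‖ ≤ ‖star v Ω‖ := by
    -- At `x = v Ω` the bound reads `‖Ω‖² ≤ ‖v* Ω‖ ‖Ω‖`.
    have h := hclosed (v Ω)
    rw [inner_self_eq_norm_sq_to_K, norm_pow, RCLike.norm_ofReal, abs_norm, hnorm] at h
    nlinarith
  have hfix : Ω - v (star v Ω) = 0 := by
    have h : ‖Ω - v (star v Ω)‖ ^ 2 = ‖Ω‖ ^ 2 - ‖star v Ω‖ ^ 2 := by
      rw [@norm_sub_sq ℂ, hnorm, hadj, inner_self_eq_norm_sq]
      ring
    rw [← norm_eq_zero, ← sq_eq_zero_iff]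
    nlinarith [sq_nonneg ‖Ω - v (star v Ω)‖]
  have h1 := eq_zero_of_apply_vacuum ν hν hcase
    (sub_mem (one_mem _) (mul_mem hv (star_mem hv))) hfix
  exact (sub_eq_zero.1 h1).symm

end Commutant

/-- The increments of the process send the vacuum to an infinite orthonormal sequence. -/
theorem not_finiteDimensional_levyVN : ¬ FiniteDimensional ℂ (levyVN ν q hν).toStarSubalgebra := by
  intro hfin
  let a : ℕ → (levyVN ν q hν).toStarSubalgebra := fun n => ⟨incOp ν q hν n, incOp_mem ν q hν n⟩
  let f : (levyVN ν q hν).toStarSubalgebra →ₗ[ℂ] Fock q (OneParticle ν) :=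
    (ContinuousLinearMap.apply ℂ _ (fockTensor q ([] : List (OneParticle ν)))).toLinearMap ∘ₗ
      (levyVN ν q hν).toStarSubalgebra.subtype.toLinearMap
  have hf : ∀ n, f (a n) = fockTensor q [incVec ν hν 1 n] := incOp_vacuum ν q hν
  have ho : Orthonormal ℂ (f ∘ a) := by
    rw [orthonormal_iff_ite]
    intro i j
    have h : inner ℂ (fockTensor q [incVec ν hν 1 i]) (fockTensor q [incVec ν hν 1 j]) =
        inner ℂ (incVec ν hν 1 i) (incVec ν hν 1 j) := by
      rw [← cre_fockTensor, inner_cre_left, ann_fockTensor_cons, ann_vacuum, map_zero, smul_zero,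
        add_zero, inner_smul_right, inner_vacuum_vacuum, mul_one]
    rw [Function.comp_apply, Function.comp_apply, hf, hf, h]
    split_ifs with hij
    · rw [hij, inner_incVec_one]
    · exact inner_incVec_incVec_of_ne ν hν 1 hij
  have hli : LinearIndependent ℂ a := ho.linearIndependent.of_comp f
  exact hli.finite_of_isNoetherian.false

theorem inner_fockTensor_of_length_ne {H : Type*} [NormedAddCommGroup H] [InnerProductSpace ℂ H]
    {l l' : List H} (h : l.length ≠ l'.length) :
    inner ℂ (fockTensor q l) (fockTensor q l') = 0 := by
  rw [fockTensor, fockTensor, UniformSpace.Completion.inner_coe, inner_tensor,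
    qKernel_of_length_ne _ h]

/-- Annihilating the new vector from the far right end of `l'` costs one factor `q` per letter of
`l'`; when the lengths differ both sides vanish. -/
theorem inner_rightOp_incOp {l l' : List (OneParticle ν)} {n : ℕ}
    (hl' : ∀ x ∈ l', inner ℂ (incVec ν hν 1 n) x = 0) :
    inner ℂ (fockTensor q (incVec ν hν 1 n :: l)) (fockTensor q (l' ++ [incVec ν hν 1 n])) =
      ((q : ℝ) : ℂ) ^ l.length * inner ℂ (fockTensor q l) (fockTensor q l') := by
  rw [← cre_fockTensor, inner_cre_left, ann_fockTensor_append, ann_fockTensor_of_orthogonal hl',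
    map_zero, zero_add, inner_incVec_one, mul_one, inner_smul_right]
  by_cases h : l.length = l'.length
  · rw [h]
  · rw [inner_fockTensor_of_length_ne h, mul_zero, mul_zero]

theorem isFactor_levyVN (hcase : (q : ℝ) = 0 ∨ IsBrownian ν) : IsFactor (levyVN ν q hν) := by
  intro z hz hz'
  set Ω := fockTensor q ([] : List (OneParticle ν)) with hΩ
  set s := incOp ν q hν with hs
  have hsa : ∀ n x y, inner ℂ (s n x) y = inner ℂ x (s n y) := by
    intro n x y
    conv_rhs => rw [hs, ← star_incOp]
    exact (ContinuousLinearMap.adjoint_inner_right _ _ _).symm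
  have hra : ∀ n x y, inner ℂ (rightOp (s n) x) y = inner ℂ x (rightOp (s n) y) := by
    intro n x y
    conv_rhs => rw [hs, ← star_incOp, ← star_rightOp]
    exact (ContinuousLinearMap.adjoint_inner_right _ _ _).symm
  have hrn : ∀ n x, ‖rightOp (s n) x‖ ≤ ‖s n‖ * ‖x‖ := by
    have hr : ∀ x : Fock q (OneParticle ν), ‖rev q _ x‖ = ‖x‖ := norm_rev
    intro n x
    rw [rightOp_apply, hr]
    exact ((s n).le_opNorm _).trans_eq (by rw [hr])
  -- `z` commutes with the left increments because it is central and with the right ones because it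
  -- lies in the algebra, and both agree on `Ω`.
  have hcomm : ∀ n, s n (z Ω) = rightOp (s n) (z Ω) := by
    intro n
    have h1 : s n * z = z * s n := VonNeumannAlgebra.mem_commutant_iff.1 hz' _ (incOp_mem ν q hν n)
    have h2 : rightOp (s n) * z = z * rightOp (s n) := by
      rw [hs, incOp, rightOp_sub, sub_mul, mul_sub,
        rightOp_levyOp_mul ν hν hcase le_rfl (by positivity) hz,
        rightOp_levyOp_mul ν hν hcase le_rfl (by positivity) hz]
    have h3 : rightOp (s n) Ω = s n Ω := by
      rw [hs, incOp, rightOp_sub, sub_apply, sub_apply, rightOp_levyOp_vacuum,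
        rightOp_levyOp_vacuum]
    have h4 : s n (z Ω) = z (s n Ω) := DFunLike.congr_fun h1 Ω
    have h5 : rightOp (s n) (z Ω) = z (rightOp (s n) Ω) := DFunLike.congr_fun h2 Ω
    rw [h4, h5, h3]
  have horth : ∀ l : List (OneParticle ν), (∀ x ∈ l, x ∈ levyVectors ν hν) → l ≠ [] →
      inner ℂ (z Ω) (fockTensor q l) = 0 := by
    intro l hl hne
    obtain ⟨C, hC⟩ := exists_norm_incOp_le ν q hν
    have hC0 : 0 ≤ C := (norm_nonneg _).trans (hC 0)
    set η := fockTensor q l with hη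
    have hnorm : ∀ n, ‖s n (s n η) - rightOp (s n) (s n η)‖ ≤
        C * (C * ‖η‖) + C * (C * ‖η‖) := by
      intro n
      have h1 : ‖s n η‖ ≤ C * ‖η‖ := (s n).le_of_opNorm_le (hC n) η
      refine (norm_sub_le _ _).trans (add_le_add ?_ ?_)
      · exact ((s n).le_of_opNorm_le (hC n) _).trans (mul_le_mul_of_nonneg_left h1 hC0)
      · exact (hrn n _).trans (mul_le_mul (hC n) h1 (norm_nonneg _) hC0)
    -- In the weak limit `s n` applied twice acts as the identity on `η`. Right after left increment
    -- leaves `q^m η`, with `m` the length of `l`, since the new letter must cross the whole tensor.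
    have hlim := tendsto_inner_of_total hnorm (x := (1 - ((q : ℝ) : ℂ) ^ l.length) • η)
      (closure_span_levy_fockTensor ν q hν) ?_ (z Ω)
    · have h0 : ∀ n, inner ℂ (z Ω) (s n (s n η) - rightOp (s n) (s n η)) = 0 := by
        intro n
        rw [inner_sub_right, ← hsa, ← hra, hcomm, sub_self]
      simp only [h0] at hlim
      have h1 := tendsto_nhds_unique hlim tendsto_const_nhds
      rw [inner_smul_right] at h1
      refine (mul_eq_zero.1 h1).resolve_left fun h2 => ?_
      have h3 : ((q : ℝ) : ℂ) ^ l.length = 1 := (sub_eq_zero.1 h2).symm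
      have h4 := congrArg norm h3
      rw [norm_pow, Complex.norm_real, Real.norm_eq_abs, norm_one] at h4
      have h5 := pow_lt_one₀ (abs_nonneg (q : ℝ)) (abs_lt.2 q.2)
        (fun h : l.length = 0 => hne (List.length_eq_zero_iff.1 h))
      exact h5.ne h4
    · rintro _ ⟨l', hl', rfl⟩
      refine tendsto_const_nhds.congr' ?_
      have hrev : ∀ x ∈ l'.reverse, x ∈ levyVectors ν hν := fun x hx => hl' x (List.mem_reverse.1 hx)
      filter_upwards [eventually_forall_mem ν hν hl, eventually_forall_mem ν hν hl',
        eventually_forall_mem ν hν hrev] with n h1 h2 h3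
      have h4 : rightOp (s n) (fockTensor q l') = fockTensor q (l' ++ [incVec ν hν 1 n]) := by
        rw [rightOp_apply, rev_fockTensor, incOp_fockTensor ν q hν h3, rev_fockTensor,
          List.reverse_cons, List.reverse_reverse]
      rw [inner_sub_right, ← hsa, ← hra, h4, incOp_fockTensor ν q hν h1,
        incOp_fockTensor ν q hν h2, ← inner_conj_symm (fockTensor q (l' ++ _)),
        inner_rightOp_incOp ν hν (fun x hx => (h2 x hx).1), map_mul,
        inner_conj_symm, map_pow, Complex.conj_ofReal, ← cre_fockTensor, inner_cre_left,
        ann_fockTensor_self_cons (inner_incVec_one ν hν n) (fun x hx => (h1 x hx).1),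
        inner_smul_right]
      ring
  refine ⟨inner ℂ Ω (z Ω), ?_⟩
  -- This vector is orthogonal to every tensor from a total set, in positive degree by `horth` and
  -- in degree `0` by the choice of the scalar.
  have hzΩ : z Ω - (inner ℂ Ω (z Ω) : ℂ) • Ω = 0 := by
    have h : (Submodule.span ℂ (fockTensor q '' {l | ∀ x ∈ l, x ∈ levyVectors ν hν})).topologicalClosure
        ≤ (innerSL ℂ (z Ω - (inner ℂ Ω (z Ω) : ℂ) • Ω)).toLinearMap.ker := by
      refine Submodule.topologicalClosure_minimal _ (Submodule.span_le.2 ?_)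
        (innerSL ℂ _).isClosed_ker
      rintro _ ⟨l, hl, rfl⟩
      change inner ℂ (z Ω - (inner ℂ Ω (z Ω) : ℂ) • Ω) (fockTensor q l) = 0
      rw [inner_sub_left, inner_smul_left]
      rcases l with _ | ⟨x, l⟩
      · rw [← hΩ, hΩ, inner_vacuum_vacuum, inner_conj_symm, mul_one, sub_self]
      · rw [horth _ hl (List.cons_ne_nil _ _), hΩ, inner_fockTensor_of_length_ne (by simp),
          mul_zero, sub_zero]
    rw [closure_span_levy_fockTensor] at h
    have h1 : inner ℂ (z Ω - (inner ℂ Ω (z Ω) : ℂ) • Ω) (z Ω - (inner ℂ Ω (z Ω) : ℂ) • Ω) = (0 : ℂ) :=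
      h Submodule.mem_top
    exact inner_self_eq_zero.1 h1
  exact sub_eq_zero.1 (eq_zero_of_apply_vacuum ν hν hcase
    (sub_mem hz (smul_mem_vonNeumann _ _ (one_mem _))) hzΩ)

end Finite

end QLevy

end

theorem mainTheorem1 (q : Set.Ioo (-1 : ℝ) 1) (ν : MeasureTheory.Measure ℝ)
    [MeasureTheory.IsProbabilityMeasure ν] (hν : QLevy.CompactlySupported ν) :
    ((q : ℝ) = 0 ∨ QLevy.IsBrownian ν → QLevy.IsIIOneFactor (QLevy.levyVN ν q hν)) ∧
    ((q : ℝ) ≠ 0 → ¬ QLevy.IsBrownian ν →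
      (¬ ∃ τ : (QLevy.levyVN ν q hν).toStarSubalgebra →ₗ[ℂ] ℂ,
        QLevy.IsNormalTracialState (QLevy.levyVN ν q hν) τ) ∧
      QLevy.IsInfiniteVN (QLevy.levyVN ν q hν)) :=
  ⟨fun h => ⟨QLevy.isFactor_levyVN ν hν h, QLevy.isFiniteVN_levyVN ν hν h,
    QLevy.not_finiteDimensional_levyVN ν hν⟩, QLevy.infinite_without_trace ν hν⟩
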